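/- Let $0<q<1$ and let $a,b,c,d$ be nonzero complex numbers with $\max(|a|,|b|,|c|,|q/d|)<1$. Let $0<\operatorname{Re}\alpha_0<\tfrac12$, $\alpha=q^{\alpha_0}$, $\eta=\tfrac12(\alpha+\alpha^{-1})$, and put $x(z)=\tfrac12(q^z+q^{-z})$. We write $(s;q)_n=\prod_{k=0}^{n-1}(1-sq^k)$ for $n\le\infty$ and $(s_1,\dots,s_r;q)_n=\prod_j (s_j;q)_n$. For $\nu\in\mathbb C$ let $$\lambda_\nu=\frac{4q^{3/2}}{(1-q)^2}\,(1-q^{-\nu})(1-abcd\,q^{\nu-1}),$$ $$u_\nu(x(z))=\frac{(qa/d,\,bcq^\nu,\,q^{1-\nu+z}/d,\,q^{1-\nu-z}/d;q)_\infty}{(q^{1-\nu}a/d,\,bc,\,q^{1+z}/d,\,q^{1-z}/d;q)_\infty}\;{}_8\varphi_7\!\left(\begin{matrix}A,\,q\sqrt A,\,-q\sqrt A,\,q^{-\nu},\,\frac{q^{1-\nu}}{bd},\,\frac{q^{1-\nu}}{cd},\,aq^z,\,aq^{-z}\\ \sqrt A,\,-\sqrt A,\,\frac{aq}{d},\,ab,\,ac,\,\frac{q^{1-\nu+z}}{d},\,\frac{q^{1-\nu-z}}{d}\end{matrix};q,\,bcq^\nu\right),\qquad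 A=\frac{aq^{-\nu}}{d},$$ wherever $|bcq^\nu|<1$ and no denominator vanishes. The function $(q^{1+z}/d,q^{1-z}/d;q)_\infty\,u_\nu(x(z))$ extends uniquely to an entire function of the two variables $\lambda=\lambda_\nu$ and $x=x(z)$; its value at $(\lambda_\nu,x)$ is denoted $v_\nu(x)$ (this defines $v_\nu$ for all $\nu\in\mathbb C$), and $\partial/\partial\lambda_\nu$ is the derivative in the first variable. For functions $f,g$ of $x$ put $$\frac{\nabla f}{\nabla x}\Big|_{x(z)}=\frac{f(x(z))-f(x(z-1))}{x(z)-x(z-1)},\qquad W(f,g)(x(z))=f\,\frac{\nabla g}{\nabla x}-g\,\frac{\nabla f}{\nabla x}\Big|_{x(z)} ;$$ at $x=\eta$ these are taken at $z=\alpha_0$. Let $$w(\theta)=\frac{(e^{2i\theta},e^{-2i\theta};q)_\infty}{(ae^{i\theta},ae^{-i\theta},be^{i\theta},be^{-i\theta},ce^{i\theta},ce^{-i\theta},qe^{i\theta}/d,qe^{-i\theta}/d,\alpha e^{i\theta},\alpha e^{-i\theta},qe^{i\theta}/\alpha,qe^{-i\theta}/\alpha;q)_\infty},$$ $$K=\frac{-4\pi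 q^{1/2}d}{1-q}\,(q,q,\alpha a,qa/\alpha,\alpha b,qb/\alpha,\alpha c,qc/\alpha,q\alpha/d,q^2/(\alpha d);q)_\infty^{-1}.$$ Then, for all $\mu,\nu\in\mathbb C$, the integrals below exist and the following hold. 1. If $\lambda_\mu\ne\lambda_\nu$, then $\displaystyle\int_0^\pi v_\mu(\cos\theta)\,v_\nu(\cos\theta)\,w(\theta)\,d\theta=K\,\frac{W(v_\mu,v_\nu)(\eta)}{\lambda_\mu-\lambda_\nu}$. 2. $\displaystyle\int_0^\pi v_\nu(\cos\theta)^2\,w(\theta)\,d\theta=K\left[\frac{\partial v_\nu(\eta)}{\partial\lambda_\nu}\,\frac{\nabla v_\nu}{\nabla x}\Big|_{x=\eta}-v_\nu(\eta)\,\frac{\partial}{\partial\lambda_\nu}\Big(\frac{\nabla v_\nu}{\nabla x}\Big|_{x=\eta}\Big)\right]$. 3. If $\lambda_\mu\ne\lambda_\nu$ and $v_\mu(\eta)=v_\nu(\eta)=0$, then $\displaystyle\int_0^\pi v_\mu(\cos\theta)\,v_\nu(\cos\theta)\,w(\theta)\,d\theta=0$. 4. If $v_\nu(\eta)=0$, then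 $\displaystyle\int_0^\pi v_\nu(\cos\theta)^2\,w(\theta)\,d\theta=K\,\frac{\partial v_\nu(\eta)}{\partial\lambda_\nu}\,\frac{\nabla v_\nu}{\nabla x}\Big|_{x=\eta}$. -/

import Mathlib

/-- The finite `q`-shifted factorial `(a; q)_n = ∏_{k<n} (1 - a q^k)`. -/
noncomputable def qPoch (a q : ℂ) (n : ℕ) : ℂ :=
  ∏ k ∈ Finset.range n, (1 - a * q ^ k)

/-- The infinite `q`-shifted factorial `(a; q)_∞` (used for `|q| < 1`). -/
noncomputable def qPochInf (a q : ℂ) : ℂ :=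
  ∏' k : ℕ, (1 - a * q ^ k)

/-- `(a₁, …, a_r; q)_n`. -/
noncomputable def qPochs (as : List ℂ) (q : ℂ) (n : ℕ) : ℂ :=
  (as.map fun a => qPoch a q n).prod

/-- `(a₁, …, a_r; q)_∞`. -/
noncomputable def qPochInfs (as : List ℂ) (q : ℂ) : ℂ :=
  (as.map fun a => qPochInf a q).prod

/-- The basic hypergeometric series `_rφ_s` with upper parameters `as` (so `r = as.length`),
lower parameters `bs` (so `s = bs.length`), base `q` and argument `t`. -/
noncomputable def basicHypergeometric (as bs : List ℂ) (q t : ℂ) : ℂ :=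
  ∑' n : ℕ, qPochs as q n / (qPoch q q n * qPochs bs q n) *
    ((-1) ^ n * q ^ (n.choose 2)) ^ (1 + (bs.length : ℤ) - (as.length : ℤ)) * t ^ n

/-- The `q`-quadratic lattice `x(z) = (q^z + q^{-z}) / 2`. -/
noncomputable def qLattice (q : ℝ) (z : ℂ) : ℂ :=
  ((q : ℂ) ^ z + (q : ℂ) ^ (-z)) / 2

/-- The divided difference `∇f(x(z)) / ∇x(z)`, where `∇g(z) = g(z) - g(z - 1)`. -/
noncomputable def nablaX (q : ℝ) (f : ℂ → ℂ) (z : ℂ) : ℂ :=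
  (f (qLattice q z) - f (qLattice q (z - 1))) / (qLattice q z - qLattice q (z - 1))

/-- The analogue of the Wronskian of two functions of `x`, at the lattice point `x(z)`. -/
noncomputable def qWronskian (q : ℝ) (f g : ℂ → ℂ) (z : ℂ) : ℂ :=
  f (qLattice q z) * nablaX q g z - g (qLattice q z) * nablaX q f z

/-- The eigenvalue `λ_ν = 4 q^{3/2} (1 - q^{-ν}) (1 - abcd q^{ν-1}) / (1 - q)^2`. -/
noncomputable def awEigenvalue (q : ℝ) (a b c d ν : ℂ) : ℂ :=
  4 * (q : ℂ) ^ ((3 : ℂ) / 2) / (1 - (q : ℂ)) ^ 2 *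
    (1 - (q : ℂ) ^ (-ν)) * (1 - a * b * c * d * (q : ℂ) ^ (ν - 1))

/-- The function `u_ν(x(z); a, b, c; d)` as a multiple of a very-well-poised `₈φ₇` series.
The formula is meaningful at the points described by `AWRegular`. -/
noncomputable def awU (q : ℝ) (a b c d ν z : ℂ) : ℂ :=
  qPochInfs [q * a / d, b * c * (q : ℂ) ^ ν,
      (q : ℂ) ^ (1 - ν + z) / d, (q : ℂ) ^ (1 - ν - z) / d] q /
    qPochInfs [(q : ℂ) ^ (1 - ν) * a / d, b * c,
      (q : ℂ) ^ (1 + z) / d, (q : ℂ) ^ (1 - z) / d] q *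
  basicHypergeometric
    [a * (q : ℂ) ^ (-ν) / d,
      q * (a * (q : ℂ) ^ (-ν) / d) ^ ((1 : ℂ) / 2),
      -(q * (a * (q : ℂ) ^ (-ν) / d) ^ ((1 : ℂ) / 2)),
      (q : ℂ) ^ (-ν), (q : ℂ) ^ (1 - ν) / (b * d), (q : ℂ) ^ (1 - ν) / (c * d),
      a * (q : ℂ) ^ z, a * (q : ℂ) ^ (-z)]
    [(a * (q : ℂ) ^ (-ν) / d) ^ ((1 : ℂ) / 2),
      -(a * (q : ℂ) ^ (-ν) / d) ^ ((1 : ℂ) / 2),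
      a * q / d, a * b, a * c,
      (q : ℂ) ^ (1 - ν + z) / d, (q : ℂ) ^ (1 - ν - z) / d]
    q (b * c * (q : ℂ) ^ ν)

/-- The `₈φ₇` formula for `u_ν(x(z))` is meaningful: the series converges and no denominator
vanishes (the factors `1 - ab q^n`, `1 - ac q^n`, `1 - bc q^n`, `1 - a q^{n+1}/d` never vanish
when `|a|, |b|, |c|, |q/d| < 1`). -/
def AWRegular (q : ℝ) (a b c d ν z : ℂ) : Prop :=
  ‖b * c * (q : ℂ) ^ ν‖ < 1 ∧
  ∀ n : ℕ,
    a * (q : ℂ) ^ (n - ν) / d ≠ 1 ∧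
    (q : ℂ) ^ (n + 1 + z) / d ≠ 1 ∧ (q : ℂ) ^ (n + 1 - z) / d ≠ 1 ∧
    (q : ℂ) ^ (n + 1 - ν + z) / d ≠ 1 ∧ (q : ℂ) ^ (n + 1 - ν - z) / d ≠ 1

/-- `V` is the analytic continuation of `(q^{1+z}/d, q^{1-z}/d; q)_∞ u_ν(x(z); a, b, c; d)` to an
entire function of the two variables `l = λ_ν` and `x = x(z)`. -/
def IsAWContinuation (q : ℝ) (a b c d : ℂ) (V : ℂ → ℂ → ℂ) : Prop :=
  Differentiable ℂ (fun p : ℂ × ℂ => V p.1 p.2) ∧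
  ∀ ν z : ℂ, AWRegular q a b c d ν z →
    V (awEigenvalue q a b c d ν) (qLattice q z) =
      qPochInfs [(q : ℂ) ^ (1 + z) / d, (q : ℂ) ^ (1 - z) / d] q * awU q a b c d ν z

/-- The entire function `v` as a function of the eigenvalue and of `x`: the analytic continuation
described by `IsAWContinuation`. -/
noncomputable def awVOfEigenvalue (q : ℝ) (a b c d : ℂ) : ℂ → ℂ → ℂ :=
  Classical.epsilon (IsAWContinuation q a b c d)

/-- The entire function `v_ν(x; a, b, c; d)`. -/
noncomputable def awV (q : ℝ) (a b c d ν x : ℂ) : ℂ :=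
  awVOfEigenvalue q a b c d (awEigenvalue q a b c d ν) x

/-- The weight on `[0, π]`, with `α` the additional parameter. -/
noncomputable def awWeight (q : ℝ) (a b c d α : ℂ) (θ : ℝ) : ℂ :=
  qPochInfs [Complex.exp (2 * Complex.I * θ), Complex.exp (-(2 * Complex.I * θ))] q /
  (qPochInfs [a * Complex.exp (Complex.I * θ), a * Complex.exp (-(Complex.I * θ)),
      b * Complex.exp (Complex.I * θ), b * Complex.exp (-(Complex.I * θ)),
      c * Complex.exp (Complex.I * θ), c * Complex.exp (-(Complex.I * θ)),
      q * Complex.exp (Complex.I * θ) / d, q * Complex.exp (-(Complex.I * θ)) / d] q *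
    qPochInfs [α * Complex.exp (Complex.I * θ), α * Complex.exp (-(Complex.I * θ)),
      q * Complex.exp (Complex.I * θ) / α, q * Complex.exp (-(Complex.I * θ)) / α] q)

/-- The constant `-4π q^{1/2} d / (1 - q) ·
(q, q, αa, qa/α, αb, qb/α, αc, qc/α, qα/d, q²/(αd); q)_∞⁻¹`. -/
noncomputable def awConst (q : ℝ) (a b c d α : ℂ) : ℂ :=
  (qPochInfs [(q : ℂ), q, α * a, q * a / α, α * b, q * b / α, α * c, q * c / α,
    q * α / d, (q : ℂ) ^ 2 / (α * d)] q)⁻¹ *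
  (-4 * (Real.pi : ℂ) * (q : ℂ) ^ ((1 : ℂ) / 2) * d / (1 - (q : ℂ)))

section
open Filter Topology

/-! ### `q`-shifted factorials -/

/-! Put y = q^z and s = q^ν. The theorem is Green's formula for a second-order q-difference equation
in y, with a boundary term that is a residue. It needs v as an entire function of (λ, x), the
equation satisfied by v, and a contour argument.

The hypergeometric input is reduced to terminating series. Multiplying the very-well-poised series
by its lower parameters (`wpSum`) makes it holomorphic in all data as long as the argument has
modulus less than 1. When c = q^(n+1)/(ds) the series terminates, and Watson's transformation,
proved by applying Bailey's lemma twice to the unit Bailey pair, turns it into a finite sum. These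
values of c tend to 0, so by the identity theorem in c any identity analytic in c that holds for the
finite sums holds wherever both sides converge. This gives a second series for the same function
(`awSeries_transformation`) and the difference equation (`awSeries_equation`).

The two series complement each other. `awSeries` converges for |bcs| < 1 and every y ≠ 0, and is
visibly invariant under y ↦ 1/y. `awSeries'` converges for |cy| < 1 and every s ≠ 0, and is visibly
invariant under s ↦ q/(abcds), the involution that fixes λ. A holomorphic function on ℂ \ {0}
invariant under y ↦ 1/y is recovered from its values on one small circle by a kernel that depends
only on x = (y + 1/y)/2 (`chebAverage_eq`). Averaging the second series over a small circle
therefore defines a function of x for every s ≠ 0 which agrees with the first series where that one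
converges. Its symmetry in s, treated by the same reconstruction, makes it entire in λ
(`exists_isAWContinuation`). Uniqueness is the identity theorem from an open set of regular
parameters.

For two solutions F, G, multiply the equations by G and F, subtract, and multiply by the weight. The
result is minus the sum of T(y) and T(1/y), where T is weight times leading coefficient times
Casoratian (`casoratian_identity`). Now T changes sign under y ↦ 1/(qy), so its integral with
respect to dy/y over |y| = q^(-1/2) vanishes. The only possible pole between that circle and the
unit circle is y = 1/α, and the condition 0 < Re α₀ < 1/2 puts it strictly inside. Its residue is
the Wronskian at η times K (`circleIntegral_green`, `integral_green`). The formula for the squared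
norm is the derivative of Green's formula in one eigenvalue. -/

lemma qPoch_zero (a q : ℂ) : qPoch a q 0 = 1 := by simp [qPoch]

lemma qPoch_succ (a q : ℂ) (n : ℕ) : qPoch a q (n + 1) = qPoch a q n * (1 - a * q ^ n) := by
  simp [qPoch, Finset.prod_range_succ]

lemma qPoch_succ' (a q : ℂ) (n : ℕ) : qPoch a q (n + 1) = (1 - a) * qPoch (a * q) q n := by
  simp only [qPoch, Finset.prod_range_succ', pow_zero, mul_one]
  rw [mul_comm]
  congr 1
  exact Finset.prod_congr rfl fun k _ => by ring

lemma qPoch_add (a q : ℂ) (m n : ℕ) :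
    qPoch a q (m + n) = qPoch a q m * qPoch (a * q ^ m) q n := by
  simp only [qPoch, Finset.prod_range_add]
  congr 1
  exact Finset.prod_congr rfl fun k _ => by ring

lemma qPoch_ne_zero {a q : ℂ} {n : ℕ} (h : ∀ k < n, a * q ^ k ≠ 1) : qPoch a q n ≠ 0 :=
  Finset.prod_ne_zero_iff.2 fun k hk => sub_ne_zero.2 (h k (Finset.mem_range.1 hk)).symm

lemma differentiable_qPoch (q : ℂ) (n : ℕ) : Differentiable ℂ fun a => qPoch a q n := by
  unfold qPoch; fun_prop

/-! ### Infinite products: convergence, holomorphy and bounds uniform in the index. -/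

section
variable {q : ℂ} (hq : ‖q‖ < 1)
include hq

lemma summable_norm_mul_pow (a : ℂ) : Summable fun k : ℕ => ‖-(a * q ^ k)‖ := by
  simpa [norm_mul, norm_pow] using
    (summable_geometric_of_lt_one (norm_nonneg q) hq).mul_left ‖a‖

lemma multipliable_qPochInf (a : ℂ) : Multipliable fun k : ℕ => 1 - a * q ^ k := by
  simpa [sub_eq_add_neg] using multipliable_one_add_of_summable (summable_norm_mul_pow hq a)

lemma tendsto_qPoch (a : ℂ) : Tendsto (qPoch a q) atTop (𝓝 (qPochInf a q)) :=
  (multipliable_qPochInf hq a).tendsto_prod_tprod_nat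

lemma qPochInf_eq_qPoch_mul (a : ℂ) (n : ℕ) :
    qPochInf a q = qPoch a q n * qPochInf (a * q ^ n) q := by
  have h1 := (tendsto_qPoch hq a).comp (tendsto_add_atTop_nat n)
  have h2 := (tendsto_qPoch hq (a * q ^ n)).const_mul (qPoch a q n)
  refine tendsto_nhds_unique h1 (h2.congr fun m => ?_)
  simp only [Function.comp]
  rw [add_comm m n, qPoch_add]

lemma qPochInf_eq_mul (a : ℂ) : qPochInf a q = (1 - a) * qPochInf (a * q) q := by
  simpa [qPoch] using qPochInf_eq_qPoch_mul hq a 1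

lemma qPochInf_ne_zero {a : ℂ} (h : ∀ k : ℕ, a * q ^ k ≠ 1) : qPochInf a q ≠ 0 := by
  have := tprod_one_add_ne_zero_of_summable (f := fun k : ℕ => -(a * q ^ k))
    (fun k => by rw [← sub_eq_add_neg]; exact sub_ne_zero.2 (h k).symm)
    (summable_norm_mul_pow hq a)
  simpa [qPochInf, sub_eq_add_neg] using this

lemma qPochInf_ne_zero_of_norm_lt_one {a : ℂ} (h : ‖a‖ < 1) : qPochInf a q ≠ 0 := by
  refine qPochInf_ne_zero hq fun k hk => ?_
  have : ‖a * q ^ k‖ < 1 := by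
    rw [norm_mul, norm_pow]
    calc ‖a‖ * ‖q‖ ^ k ≤ ‖a‖ * 1 := by gcongr; exact pow_le_one₀ (norm_nonneg _) hq.le
      _ < 1 := by simpa
  rw [hk] at this
  simp at this

lemma qPochInf_eq_zero {a : ℂ} {k : ℕ} (h : a * q ^ k = 1) : qPochInf a q = 0 := by
  rw [qPochInf_eq_qPoch_mul hq a (k + 1), qPoch_succ, h]; simp

lemma differentiable_qPochInf : Differentiable ℂ fun a => qPochInf a q := by
  intro a₀
  set R := ‖a₀‖ + 1
  have hs : Summable fun k : ℕ => R * ‖q‖ ^ k :=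
    (summable_geometric_of_lt_one (norm_nonneg q) hq).mul_left R
  have h := (hs.hasProdLocallyUniformlyOn_nat_one_add (f := fun k a => -(a * q ^ k))
    (K := Metric.ball (0 : ℂ) R) Metric.isOpen_ball (.of_forall fun k a ha => by
      rw [norm_neg, norm_mul, norm_pow]
      gcongr
      exact (mem_ball_zero_iff.1 ha).le) (fun k => by fun_prop)).differentiableOn
    (.of_forall fun _ => by
      simpa [Finset.prod_fn] using DifferentiableOn.finsetProd (fun _ _ => by fun_prop))
    Metric.isOpen_ball
  have h2 : DifferentiableAt ℂ (fun a => ∏' k : ℕ, (1 + -(a * q ^ k))) a₀ :=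
    h.differentiableAt (Metric.isOpen_ball.mem_nhds (by simp [R]))
  simpa [qPochInf, sub_eq_add_neg] using h2

lemma continuous_qPochInf : Continuous fun a => qPochInf a q :=
  (differentiable_qPochInf hq).continuous

lemma sum_norm_pow_le (k : ℕ) : ∑ j ∈ Finset.range k, ‖q‖ ^ j ≤ (1 - ‖q‖)⁻¹ := by
  rw [← tsum_geometric_of_lt_one (norm_nonneg q) hq]
  exact (summable_geometric_of_lt_one (norm_nonneg q) hq).sum_le_tsum _ fun _ _ => by positivity

lemma prod_one_add_le_exp {x : ℝ} (hx : 0 ≤ x) (k : ℕ) :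
    ∏ j ∈ Finset.range k, (1 + x * ‖q‖ ^ j) ≤ Real.exp (x * (1 - ‖q‖)⁻¹) := by
  calc ∏ j ∈ Finset.range k, (1 + x * ‖q‖ ^ j)
      ≤ ∏ j ∈ Finset.range k, Real.exp (x * ‖q‖ ^ j) := by
        refine Finset.prod_le_prod (fun j _ => by positivity) fun j _ => ?_
        rw [add_comm]; exact Real.add_one_le_exp _
    _ = Real.exp (x * ∑ j ∈ Finset.range k, ‖q‖ ^ j) := by
        rw [← Real.exp_sum, Finset.mul_sum]
    _ ≤ _ := by gcongr; exact sum_norm_pow_le hq k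

lemma norm_qPoch_le {a : ℂ} {R : ℝ} (ha : ‖a‖ ≤ R) (k : ℕ) :
    ‖qPoch a q k‖ ≤ Real.exp (R * (1 - ‖q‖)⁻¹) := by
  refine le_trans ?_ (prod_one_add_le_exp hq ((norm_nonneg a).trans ha) k)
  rw [qPoch, norm_prod]
  refine Finset.prod_le_prod (fun j _ => norm_nonneg _) fun j _ => ?_
  refine (norm_sub_le _ _).trans ?_
  rw [norm_one, norm_mul, norm_pow]
  gcongr

lemma norm_qPochInf_le {a : ℂ} {R : ℝ} (ha : ‖a‖ ≤ R) :
    ‖qPochInf a q‖ ≤ Real.exp (R * (1 - ‖q‖)⁻¹) :=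
  le_of_tendsto (tendsto_qPoch hq a).norm (.of_forall fun k => norm_qPoch_le hq ha k)

lemma norm_mul_pow_le {a : ℂ} {R : ℝ} (ha : ‖a‖ ≤ R) (k : ℕ) : ‖a * q ^ k‖ ≤ R := by
  rw [norm_mul, norm_pow]
  calc ‖a‖ * ‖q‖ ^ k ≤ R * 1 := by
        gcongr
        · exact (norm_nonneg _).trans ha
        · exact pow_le_one₀ (norm_nonneg _) hq.le
    _ = R := mul_one R

lemma qPoch_self_ne_zero (n : ℕ) : qPoch q q n ≠ 0 := by
  refine qPoch_ne_zero fun k _ h => ?_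
  have : ‖q * q ^ k‖ < 1 := by
    rw [← pow_succ', norm_pow]; exact pow_lt_one₀ (norm_nonneg _) hq (by simp)
  rw [h] at this; simp at this

/-- The reciprocal is (q^(n+1); q)_∞ / (q; q)_∞, whose numerator is bounded independently of n. -/
lemma norm_inv_qPoch_self_le (n : ℕ) :
    ‖(qPoch q q n)⁻¹‖ ≤ Real.exp (1 * (1 - ‖q‖)⁻¹) / ‖qPochInf q q‖ := by
  have h0 : qPochInf q q ≠ 0 := qPochInf_ne_zero_of_norm_lt_one hq hq
  have h := qPochInf_eq_qPoch_mul hq q n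
  have h1 : (qPoch q q n)⁻¹ = qPochInf (q * q ^ n) q / qPochInf q q := by
    rw [eq_div_iff h0, h, ← mul_assoc, inv_mul_cancel₀ (qPoch_self_ne_zero hq n), one_mul]
  rw [h1, norm_div]
  gcongr
  exact norm_qPochInf_le hq (norm_mul_pow_le hq hq.le n)

end

/-! ### A regularized very-well-poised series -/

/-- The homogeneous form `∏_{j<k} (z - w q^j)` of `z^k (w/z; q)_k`. -/
noncomputable def qPochHom (z w q : ℂ) (k : ℕ) : ℂ :=
  ∏ j ∈ Finset.range k, (z - w * q ^ j)

/-- The terms of `wpSum`. -/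
noncomputable def wpTerm (q A : ℂ) (b : Fin 4 → ℂ) (g : Fin 5 → ℂ) (z w : ℂ) (k : ℕ) : ℂ :=
  (1 - A * q ^ (2 * k)) * (qPoch A q k * (qPoch q q k)⁻¹) * (∏ i, qPoch (b i) q k) *
    (∏ i, qPochInf (g i * q ^ k) q) * qPochHom z w q k

/-- A very-well-poised series, with the lower parameters cleared. -/
noncomputable def wpSum (q A : ℂ) (b : Fin 4 → ℂ) (g : Fin 5 → ℂ) (z w : ℂ) : ℂ :=
  ∑' k, wpTerm q A b g z w k

section
variable {q : ℂ} (hq : ‖q‖ < 1)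
include hq

lemma norm_qPochHom_le {z w : ℂ} {R ρ : ℝ} (hρ : 0 < ρ) (hz : ‖z‖ ≤ ρ) (hw : ‖w‖ ≤ R) (k : ℕ) :
    ‖qPochHom z w q k‖ ≤ Real.exp (R / ρ * (1 - ‖q‖)⁻¹) * ρ ^ k := by
  have hR : 0 ≤ R := (norm_nonneg w).trans hw
  calc ‖qPochHom z w q k‖ ≤ ∏ j ∈ Finset.range k, ((1 + R / ρ * ‖q‖ ^ j) * ρ) := by
        rw [qPochHom, norm_prod]
        refine Finset.prod_le_prod (fun j _ => norm_nonneg _) fun j _ => ?_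
        refine (norm_sub_le _ _).trans ?_
        rw [norm_mul, norm_pow, add_mul, one_mul]
        have : R / ρ * ‖q‖ ^ j * ρ = R * ‖q‖ ^ j := by field_simp
        rw [this]
        gcongr
    _ ≤ _ := by
        rw [Finset.prod_mul_distrib, Finset.prod_const, Finset.card_range]
        gcongr
        exact prod_one_add_le_exp hq (by positivity) k

/-- Every factor of a term is bounded uniformly in k except the homogeneous product, which is at
most ∏ (ρ + R|q|^j) = ρ^k ∏ (1 + (R/ρ)|q|^j). The bound ρ > 0 replaces |z|, so z = 0 is allowed. -/
lemma exists_norm_wpTerm_le (R : ℝ) {ρ : ℝ} (hρ : 0 < ρ) : ∃ C : ℝ,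
    ∀ (A : ℂ) (b : Fin 4 → ℂ) (g : Fin 5 → ℂ) (z w : ℂ), ‖A‖ ≤ R → (∀ i, ‖b i‖ ≤ R) →
      (∀ i, ‖g i‖ ≤ R) → ‖z‖ ≤ ρ → ‖w‖ ≤ R → ∀ k, ‖wpTerm q A b g z w k‖ ≤ C * ρ ^ k := by
  set e := Real.exp (R * (1 - ‖q‖)⁻¹)
  refine ⟨(1 + R) * (e * (Real.exp (1 * (1 - ‖q‖)⁻¹) / ‖qPochInf q q‖)) * (∏ _i : Fin 4, e) *
    (∏ _i : Fin 5, e) * Real.exp (R / ρ * (1 - ‖q‖)⁻¹), ?_⟩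
  intro A b g z w hA hb hg hz hw k
  have hR : 0 ≤ R := (norm_nonneg w).trans hw
  rw [wpTerm, norm_mul, norm_mul, norm_mul, norm_mul, norm_mul, norm_prod, norm_prod, mul_assoc _ _ (ρ ^ k)]
  gcongr
  · refine (norm_sub_le _ _).trans ?_
    rw [norm_one]
    gcongr
    exact norm_mul_pow_le hq hA _
  · exact norm_qPoch_le hq hA k
  · exact norm_inv_qPoch_self_le hq k
  · exact norm_qPoch_le hq (hb _) k
  · exact norm_qPochInf_le hq (norm_mul_pow_le hq (hg _) k)
  · exact norm_qPochHom_le hq hρ hz hw k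

/-- The local Weierstrass majorant behind the continuity and the holomorphy of `wpSum`: any ρ
strictly between |z| and 1 serves as ratio of a geometric series near the given point. -/
lemma exists_wpTerm_bound_nhds {X : Type*} [TopologicalSpace X] {S : Set X} (hS : IsOpen S)
    {A z w : X → ℂ} {b : X → Fin 4 → ℂ} {g : X → Fin 5 → ℂ}
    (hA : ContinuousOn A S) (hb : ∀ i, ContinuousOn (fun p => b p i) S)
    (hg : ∀ i, ContinuousOn (fun p => g p i) S) (hz : ContinuousOn z S) (hw : ContinuousOn w S)
    (hz1 : ∀ p ∈ S, ‖z p‖ < 1) {p₀ : X} (hp : p₀ ∈ S) :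
    ∃ N ⊆ S, IsOpen N ∧ p₀ ∈ N ∧ ∃ u : ℕ → ℝ, Summable u ∧
      ∀ k, ∀ p ∈ N, ‖wpTerm q (A p) (b p) (g p) (z p) (w p) k‖ ≤ u k := by
  obtain ⟨ρ, hρ1, hρ2⟩ := exists_between (hz1 p₀ hp)
  have hρ : 0 < ρ := (norm_nonneg _).trans_lt hρ1
  have hn := hS.mem_nhds hp
  set R := ‖A p₀‖ + ‖w p₀‖ + ∑ i, ‖b p₀ i‖ + ∑ i, ‖g p₀ i‖ + 1 with hR
  have hb0 : 0 ≤ ∑ i, ‖b p₀ i‖ := by positivity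
  have hg0 : 0 ≤ ∑ i, ‖g p₀ i‖ := by positivity
  have hA0 := norm_nonneg (A p₀)
  have hw0 := norm_nonneg (w p₀)
  have e1 : ∀ᶠ p in 𝓝 p₀, ‖A p‖ < R :=
    (hA.continuousAt hn).norm.eventually_lt_const (by linarith)
  have e2 : ∀ᶠ p in 𝓝 p₀, ‖w p‖ < R :=
    (hw.continuousAt hn).norm.eventually_lt_const (by linarith)
  have e3 : ∀ᶠ p in 𝓝 p₀, ∀ i, ‖b p i‖ < R := eventually_all.2 fun i =>
    ((hb i).continuousAt hn).norm.eventually_lt_const (by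
      have := Finset.single_le_sum (f := fun i => ‖b p₀ i‖) (fun _ _ => norm_nonneg _)
        (Finset.mem_univ i)
      linarith)
  have e4 : ∀ᶠ p in 𝓝 p₀, ∀ i, ‖g p i‖ < R := eventually_all.2 fun i =>
    ((hg i).continuousAt hn).norm.eventually_lt_const (by
      have := Finset.single_le_sum (f := fun i => ‖g p₀ i‖) (fun _ _ => norm_nonneg _)
        (Finset.mem_univ i)
      linarith)
  have e5 : ∀ᶠ p in 𝓝 p₀, ‖z p‖ < ρ := (hz.continuousAt hn).norm.eventually_lt_const hρ1
  obtain ⟨N, hN, hNo, hpN⟩ := eventually_nhds_iff.1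
    (e1.and (e2.and (e3.and (e4.and (e5.and (hS.eventually_mem hp))))))
  obtain ⟨C, hC⟩ := exists_norm_wpTerm_le hq R hρ
  refine ⟨N, fun p h => (hN p h).2.2.2.2.2, hNo, hpN, fun k => C * ρ ^ k,
    (summable_geometric_of_lt_one hρ.le hρ2).mul_left C, fun k p h => ?_⟩
  obtain ⟨h1, h2, h3, h4, h5, -⟩ := hN p h
  exact hC _ _ _ _ _ h1.le (fun i => (h3 i).le) (fun i => (h4 i).le) h5.le h2.le k

lemma continuousOn_wpTerm {X : Type*} [TopologicalSpace X] {S : Set X}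
    {A z w : X → ℂ} {b : X → Fin 4 → ℂ} {g : X → Fin 5 → ℂ}
    (hA : ContinuousOn A S) (hb : ∀ i, ContinuousOn (fun p => b p i) S)
    (hg : ∀ i, ContinuousOn (fun p => g p i) S) (hz : ContinuousOn z S) (hw : ContinuousOn w S)
    (k : ℕ) : ContinuousOn (fun p => wpTerm q (A p) (b p) (g p) (z p) (w p) k) S := by
  have h1 := (differentiable_qPoch q k).continuous
  have h2 := continuous_qPochInf hq
  unfold wpTerm qPochHom
  refine ContinuousOn.mul (ContinuousOn.mul (ContinuousOn.mul (by fun_prop) ?_) ?_) (by fun_prop)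
  · exact continuousOn_finsetProd _ fun i _ => h1.comp_continuousOn (hb i)
  · exact continuousOn_finsetProd _ fun i _ =>
      h2.comp_continuousOn ((hg i).mul continuousOn_const)

lemma continuousOn_wpSum {X : Type*} [TopologicalSpace X] {S : Set X} (hS : IsOpen S)
    {A z w : X → ℂ} {b : X → Fin 4 → ℂ} {g : X → Fin 5 → ℂ}
    (hA : ContinuousOn A S) (hb : ∀ i, ContinuousOn (fun p => b p i) S)
    (hg : ∀ i, ContinuousOn (fun p => g p i) S) (hz : ContinuousOn z S) (hw : ContinuousOn w S)
    (hz1 : ∀ p ∈ S, ‖z p‖ < 1) :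
    ContinuousOn (fun p => wpSum q (A p) (b p) (g p) (z p) (w p)) S := by
  intro p₀ hp
  obtain ⟨N, hNS, hNo, hpN, u, hu, hb'⟩ := exists_wpTerm_bound_nhds hq hS hA hb hg hz hw hz1 hp
  have := continuousOn_tsum (fun k => (continuousOn_wpTerm hq hA hb hg hz hw k).mono hNS) hu hb'
  exact (this.continuousAt (hNo.mem_nhds hpN)).continuousWithinAt

lemma differentiableOn_wpSum {S : Set ℂ} (hS : IsOpen S)
    {A z w : ℂ → ℂ} {b : ℂ → Fin 4 → ℂ} {g : ℂ → Fin 5 → ℂ}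
    (hA : DifferentiableOn ℂ A S) (hb : ∀ i, DifferentiableOn ℂ (fun p => b p i) S)
    (hg : ∀ i, DifferentiableOn ℂ (fun p => g p i) S) (hz : DifferentiableOn ℂ z S)
    (hw : DifferentiableOn ℂ w S) (hz1 : ∀ p ∈ S, ‖z p‖ < 1) :
    DifferentiableOn ℂ (fun p => wpSum q (A p) (b p) (g p) (z p) (w p)) S := by
  intro p₀ hp
  obtain ⟨N, hNS, hNo, hpN, u, hu, hb'⟩ := exists_wpTerm_bound_nhds hq hS hA.continuousOn
    (fun i => (hb i).continuousOn) (fun i => (hg i).continuousOn) hz.continuousOn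
    hw.continuousOn hz1 hp
  have h1 := differentiable_qPoch q
  have h2 := differentiable_qPochInf hq
  refine ((Complex.differentiableOn_tsum_of_summable_norm hu (fun k => ?_) hNo hb').differentiableAt
    (hNo.mem_nhds hpN)).differentiableWithinAt
  refine DifferentiableOn.mono ?_ hNS
  unfold wpTerm qPochHom
  refine DifferentiableOn.mul (DifferentiableOn.mul (DifferentiableOn.mul ?_ ?_) ?_) ?_
  · have := (h1 k).comp_differentiableOn hA
    simp only [Function.comp_def] at this
    fun_prop
  · exact DifferentiableOn.fun_finsetProd fun i _ => (h1 k).comp_differentiableOn (hb i)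
  · exact DifferentiableOn.fun_finsetProd fun i _ =>
      h2.comp_differentiableOn ((hg i).mul (differentiableOn_const _))
  · fun_prop

end

/-! ### The terminating `q`-Saalschütz sum, the unit Bailey pair and Watson's transformation -/

lemma qPoch_self_ne_zero' {q : ℂ} (hq : ∀ n : ℕ, q * q ^ n ≠ 1) (n : ℕ) : qPoch q q n ≠ 0 :=
  qPoch_ne_zero fun k _ => hq k

/-- The summand of the `q`-Saalschütz sum. -/
noncomputable def saalTerm (q D E t : ℂ) (N j : ℕ) : ℂ :=
  qPoch D q j * qPoch E q j * qPoch t q (N - j) * t ^ j /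
    (qPoch q q j * qPoch q q (N - j) * qPoch (D * E * t) q j)

section
variable {q : ℂ} (hq : ∀ n : ℕ, q * q ^ n ≠ 1)
include hq

/-- Creative telescoping in N. The expected value of the sum satisfies a first-order recurrence;
applied to the summand, this recurrence leaves a difference in j whose partial sums are the right
side. -/
lemma saalTerm_telescope {D E t : ℂ} (hg : ∀ n : ℕ, D * E * t * q ^ n ≠ 1) (N J : ℕ) (hJ : J ≤ N) :
    ∑ j ∈ Finset.range (J + 1), ((1 - q ^ (N + 1)) * (1 - D * E * t * q ^ N) *
        saalTerm q D E t (N + 1) j -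
      (1 - E * t * q ^ N) * (1 - D * t * q ^ N) * saalTerm q D E t N j) =
    -(q ^ (N - J) * (qPoch D q (J + 1) * qPoch E q (J + 1) * qPoch t q (N - J) * t ^ (J + 1)) /
      (qPoch q q J * qPoch q q (N - J) * qPoch (D * E * t) q J)) := by
  have key : ∀ j m : ℕ, (1 - q ^ (j + m + 1)) * (1 - D * E * t * q ^ (j + m)) *
        saalTerm q D E t (j + m + 1) j -
      (1 - E * t * q ^ (j + m)) * (1 - D * t * q ^ (j + m)) * saalTerm q D E t (j + m) j =
      qPoch D q j * qPoch E q j * qPoch t q m * t ^ j /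
        (qPoch q q j * qPoch q q (m + 1) * qPoch (D * E * t) q j) *
      ((1 - q ^ (j + m + 1)) * (1 - D * E * t * q ^ (j + m)) * (1 - t * q ^ m) -
        (1 - E * t * q ^ (j + m)) * (1 - D * t * q ^ (j + m)) * (1 - q ^ (m + 1))) := by
    intro j m
    have h1 : j + m + 1 - j = m + 1 := by omega
    have h2 : j + m - j = m := by omega
    have a1 := qPoch_self_ne_zero' hq j
    have a2 := qPoch_self_ne_zero' hq m
    have a3 : qPoch (D * E * t) q j ≠ 0 := qPoch_ne_zero fun k _ => hg k
    have a4 : 1 - q * q ^ m ≠ 0 := sub_ne_zero.2 (hq m).symm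
    simp only [saalTerm, h1, h2, qPoch_succ q q m, qPoch_succ t q m]
    rw [pow_succ' q m]
    generalize 1 - q * q ^ m = x at a4 ⊢
    field_simp
  induction J with
  | zero =>
    have := key 0 N
    simp only [zero_add] at this
    simp only [zero_add, Finset.range_one, Finset.sum_singleton, this, Nat.sub_zero]
    have a2 := qPoch_self_ne_zero' hq N
    have a4 : 1 - q * q ^ N ≠ 0 := sub_ne_zero.2 (hq N).symm
    simp only [qPoch_succ, qPoch_zero, pow_succ' q N]
    field_simp
    ring
  | succ J ih =>
    rw [Finset.sum_range_succ, ih (by omega)]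
    obtain ⟨m, rfl⟩ := Nat.exists_eq_add_of_le hJ
    rw [key (J + 1) m]
    have h1 : J + 1 + m - J = m + 1 := by omega
    have h2 : J + 1 + m - (J + 1) = m := by omega
    have a1 := qPoch_self_ne_zero' hq J
    have a2 := qPoch_self_ne_zero' hq m
    have a3 : qPoch (D * E * t) q J ≠ 0 := qPoch_ne_zero fun k _ => hg k
    have a4 : 1 - q * q ^ m ≠ 0 := sub_ne_zero.2 (hq m).symm
    have a5 : 1 - q * q ^ J ≠ 0 := sub_ne_zero.2 (hq J).symm
    have a6 : 1 - D * E * t * q ^ J ≠ 0 := sub_ne_zero.2 (hg J).symm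
    rw [h1, h2]
    simp only [qPoch_succ]
    rw [show q ^ (J + 1 + m + 1) = q * q ^ J * (q * q ^ m) by ring,
      show q ^ (J + 1 + m) = q * q ^ J * q ^ m by ring, pow_succ' q m]
    obtain ⟨x, hx⟩ : ∃ x, x = 1 - q * q ^ m := ⟨_, rfl⟩
    obtain ⟨y, hy⟩ : ∃ y, y = 1 - q * q ^ J := ⟨_, rfl⟩
    obtain ⟨z, hz⟩ : ∃ z, z = 1 - D * E * t * q ^ J := ⟨_, rfl⟩
    rw [← hx] at a4
    rw [← hy] at a5
    rw [← hz] at a6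
    rw [← hx, ← hy, ← hz]
    field_simp
    rw [hx, hy, hz]
    ring

/-- This is the balanced ₃φ₂ sum with upper parameters D, E, q^(-N). Writing the factors that
involve q^(-N) as (t; q)_{N-j} / (q; q)_{N-j} avoids dividing by t or by powers of q. -/
theorem sum_saalTerm {D E t : ℂ} (hg : ∀ n : ℕ, D * E * t * q ^ n ≠ 1) (N : ℕ) :
    ∑ j ∈ Finset.range (N + 1), saalTerm q D E t N j =
      qPoch (D * t) q N * qPoch (E * t) q N / (qPoch q q N * qPoch (D * E * t) q N) := by
  induction N with
  | zero => simp [saalTerm, qPoch_zero]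
  | succ N ih =>
    have a2 := qPoch_self_ne_zero' hq N
    have a3 : qPoch (D * E * t) q N ≠ 0 := qPoch_ne_zero fun k _ => hg k
    have a5 : 1 - q * q ^ N ≠ 0 := sub_ne_zero.2 (hq N).symm
    have a6 : 1 - D * E * t * q ^ N ≠ 0 := sub_ne_zero.2 (hg N).symm
    -- The boundary term at J = N is cancelled by the extra summand j = N + 1 of the sum for N + 1.
    have h := saalTerm_telescope hq hg N N le_rfl
    rw [Finset.sum_sub_distrib, ← Finset.mul_sum, ← Finset.mul_sum, ih, Nat.sub_self] at h
    rw [Finset.sum_range_succ]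
    rw [pow_succ' q N] at h
    rw [saalTerm, Nat.sub_self]
    simp only [qPoch_succ, qPoch_zero] at h ⊢
    generalize ∑ j ∈ Finset.range (N + 1), saalTerm q D E t (N + 1) j = S at h ⊢
    obtain ⟨y, hy⟩ : ∃ y, y = 1 - q * q ^ N := ⟨_, rfl⟩
    obtain ⟨z, hz⟩ : ∃ z, z = 1 - D * E * t * q ^ N := ⟨_, rfl⟩
    rw [← hy] at a5 h ⊢
    rw [← hz] at a6 h ⊢
    generalize qPoch (D * E * t) q N = P at a3 h ⊢
    generalize qPoch (D * t) q N = P₁ at h ⊢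
    generalize qPoch (E * t) q N = P₂ at h ⊢
    field_simp at h ⊢
    linear_combination h

/-- The weights in Bailey's lemma. -/
noncomputable def baileyWeight (q D E t : ℂ) (n j : ℕ) : ℂ :=
  qPoch D q j * qPoch E q j * qPoch t q (n - j) * t ^ j / qPoch q q (n - j)

/-- Bailey's lemma in kernel form: up to explicit factors, the weights reproduce the kernel 1/((q;
q)_{j-k} (Aq; q)_{j+k}) that defines Bailey pairs. After j = k + i it is the q-Saalschütz sum with D
q^k and E q^k in place of D and E. -/
theorem sum_baileyWeight {A D E t : ℂ} (hA : ∀ n : ℕ, A * q * q ^ n ≠ 1)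
    (ht : D * E * t = A * q) {k n : ℕ} (hk : k ≤ n) :
    ∑ j ∈ Finset.Icc k n, baileyWeight q D E t n j /
        (qPoch q q (j - k) * qPoch (A * q) q (j + k)) =
      qPoch D q k * qPoch E q k * t ^ k *
        (qPoch (D * t * q ^ k) q (n - k) * qPoch (E * t * q ^ k) q (n - k)) /
        (qPoch q q (n - k) * qPoch (A * q) q (n + k)) := by
  obtain ⟨m, rfl⟩ := Nat.exists_eq_add_of_le hk
  have hg : ∀ i : ℕ, D * q ^ k * (E * q ^ k) * t * q ^ i ≠ 1 := fun i => by
    have := hA (k + k + i)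
    rw [← ht] at this
    rwa [show D * q ^ k * (E * q ^ k) * t * q ^ i = D * E * t * q ^ (k + k + i) by ring]
  have h := sum_saalTerm hq hg m
  have e1 : D * q ^ k * (E * q ^ k) * t = A * q * q ^ (k + k) := by
    rw [← ht]; ring
  have hz : qPoch (A * q) q (k + k) ≠ 0 := qPoch_ne_zero fun i _ => hA i
  have e2 : Finset.Icc k (k + m) = (Finset.range (m + 1)).image (k + ·) := by
    ext j
    simp only [Finset.mem_Icc, Finset.mem_image, Finset.mem_range]
    exact ⟨fun ⟨h1, h2⟩ => ⟨j - k, by omega, by omega⟩, fun ⟨i, h1, h2⟩ => by omega⟩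
  rw [e2, Finset.sum_image (fun _ _ _ _ h => by simpa using h)]
  have e3 : ∀ i ∈ Finset.range (m + 1), baileyWeight q D E t (k + m) (k + i) /
        (qPoch q q (k + i - k) * qPoch (A * q) q (k + i + k)) =
      qPoch D q k * qPoch E q k * t ^ k / qPoch (A * q) q (k + k) *
        saalTerm q (D * q ^ k) (E * q ^ k) t m i := by
    intro i _
    have f1 : k + m - (k + i) = m - i := by omega
    have f2 : k + i - k = i := by omega
    have f3 : k + i + k = (k + k) + i := by omega
    simp only [baileyWeight, saalTerm, f1, f2, e1]
    rw [f3, qPoch_add D, qPoch_add E, qPoch_add (A * q) q (k + k) i, pow_add]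
    field_simp
  rw [Finset.sum_congr rfl e3, ← Finset.mul_sum, h, e1]
  have f2 : k + m - k = m := by omega
  have f3 : k + m + k = (k + k) + m := by omega
  rw [f2, f3, qPoch_add (A * q) q (k + k) m,
    show D * q ^ k * t = D * t * q ^ k by ring, show E * q ^ k * t = E * t * q ^ k by ring]
  field_simp

/-- The sequence `α` of the unit Bailey pair, multiplied by `1 - A`. -/
noncomputable def unitBailey (q A : ℂ) (k : ℕ) : ℂ :=
  (1 - A * q ^ (2 * k)) * qPoch A q k * ((-1) ^ k * q ^ (k.choose 2)) / qPoch q q k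

/-- The sum for j = K + m + 1 is summable indefinitely: already its first K + 1 terms have a closed
form, which makes an induction on K possible. At m = 0 exactly one term is missing, and it cancels
the partial sum. -/
lemma sum_unitBailey_partial {A : ℂ} (hA : ∀ n : ℕ, A * q * q ^ n ≠ 1) (K m : ℕ) :
    ∑ k ∈ Finset.range (K + 1), unitBailey q A k /
        (qPoch q q (K + m + 1 - k) * qPoch (A * q) q (K + m + 1 + k)) =
      qPoch A q (K + 1) * ((-1) ^ K * q ^ ((K + 1).choose 2)) /
        (qPoch q q K * qPoch q q m * qPoch (A * q) q (K + m + 1 + K) *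
          (1 - q ^ (K + m + 1))) := by
  have hA' : ∀ n, qPoch (A * q) q n ≠ 0 := fun n => qPoch_ne_zero fun i _ => hA i
  have hqn : ∀ n : ℕ, 1 - q ^ n * q ≠ 0 := fun n => sub_ne_zero.2 (by
    rw [mul_comm]; exact (hq n).symm)
  have hqn' : ∀ n : ℕ, 1 - q * q ^ n ≠ 0 := fun n => sub_ne_zero.2 (hq n).symm
  induction K generalizing m with
  | zero =>
    have h1 := hqn m
    have h1' := hqn' m
    have h2 := qPoch_self_ne_zero' hq m
    have h3 := hA' (m + 1)
    simp only [zero_add, Finset.range_one, Finset.sum_singleton, unitBailey, qPoch_zero, mul_zero,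
      pow_zero, Nat.sub_zero, add_zero, Nat.choose_zero_succ,
      qPoch_succ A, qPoch_succ q q m, pow_succ q m]
    simp only [show Nat.choose 1 2 = 0 from rfl, pow_zero]
    field_simp
  | succ K ih =>
    rw [Finset.sum_range_succ]
    have h := ih (m + 1)
    rw [show K + (m + 1) + 1 = K + 1 + m + 1 by omega] at h
    rw [h]
    have f1 : K + 1 + m + 1 - (K + 1) = m + 1 := by omega
    have f2 : K + 1 + m + 1 + (K + 1) = (K + 1 + m + 1 + K) + 1 := by omega
    have f3 : (K + 1 + 1).choose 2 = (K + 1) + (K + 1).choose 2 := by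
      rw [Nat.choose_succ_succ' (K + 1) 1, Nat.choose_one_right]
    rw [f1, f2, f3, unitBailey]
    simp only [qPoch_succ q, qPoch_succ (A * q) q (K + 1 + m + 1 + K), qPoch_succ A q (K + 1)]
    have a1 := qPoch_self_ne_zero' hq K
    have a2 := qPoch_self_ne_zero' hq m
    have a3 := hA' (K + 1 + m + 1 + K)
    have a4 := hqn' K
    have a5 := hqn' m
    have a6 := hqn (K + 1 + m)
    have a7 : 1 - A * q * q ^ (K + 1 + m + 1 + K) ≠ 0 := sub_ne_zero.2 (hA _).symm
    rw [pow_succ q (K + 1 + m), pow_add q (K + 1) (Nat.choose _ _)]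
    rw [pow_succ (-1 : ℂ) K]
    obtain ⟨x, hx⟩ : ∃ x, x = 1 - q * q ^ m := ⟨_, rfl⟩
    obtain ⟨y, hy⟩ : ∃ y, y = 1 - q * q ^ K := ⟨_, rfl⟩
    obtain ⟨z, hz⟩ : ∃ z, z = 1 - q ^ (K + 1 + m) * q := ⟨_, rfl⟩
    obtain ⟨w, hw⟩ : ∃ w, w = 1 - A * q * q ^ (K + 1 + m + 1 + K) := ⟨_, rfl⟩
    rw [← hx] at a5
    rw [← hy] at a4
    rw [← hz] at a6
    rw [← hw] at a7
    rw [← hx, ← hy, ← hz, ← hw]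
    field_simp
    rw [hx, hy, hz, hw]
    have e1 : q ^ (K + 1 + m + 1 + K) = q ^ K * q ^ K * q ^ m * q * q := by ring
    have e2 : q ^ (K + 1 + m) = q ^ K * q ^ m * q := by ring
    have e3 : q ^ (2 * (K + 1)) = q ^ K * q ^ K * q * q := by ring
    have e4 : q ^ (K + 1) = q ^ K * q := by ring
    rw [e1, e2, e3, e4]
    ring

/-- The unit Bailey pair: its β-sequence is supported at 0. Both sides carry the factor 1 - A, so
that A = 1 need not be excluded. -/
theorem sum_unitBailey {A : ℂ} (hA : ∀ n : ℕ, A * q * q ^ n ≠ 1) (j : ℕ) :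
    ∑ k ∈ Finset.range (j + 1), unitBailey q A k /
        (qPoch q q (j - k) * qPoch (A * q) q (j + k)) = if j = 0 then 1 - A else 0 := by
  rcases j with _ | j
  · simp [unitBailey, qPoch_zero]
  · rw [Finset.sum_range_succ]
    have h := sum_unitBailey_partial hq hA j 0
    simp only [add_zero] at h
    rw [h, unitBailey, if_neg (by omega)]
    have hqn : ∀ n : ℕ, 1 - q ^ n * q ≠ 0 := fun n => sub_ne_zero.2 (by
      rw [mul_comm]; exact (hq n).symm)
    have hqn' : ∀ n : ℕ, 1 - q * q ^ n ≠ 0 := fun n => sub_ne_zero.2 (hq n).symm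
    have a1 := qPoch_self_ne_zero' hq j
    have a3 : qPoch (A * q) q (j + 1 + j) ≠ 0 := qPoch_ne_zero fun i _ => hA i
    have a4 := hqn' j
    have a6 := hqn j
    have a7 : 1 - A * q * q ^ (j + 1 + j) ≠ 0 := sub_ne_zero.2 (hA _).symm
    rw [show j + 1 + (j + 1) = j + 1 + j + 1 by omega]
    simp only [Nat.sub_self, qPoch_succ q, qPoch_succ (A * q) q (j + 1 + j), qPoch_zero]
    rw [pow_succ q j, pow_succ (-1 : ℂ) j]
    field_simp
    ring

/-- Bailey's lemma is applied twice to the unit pair, with (B, C, u) inside and (D, E, t) outside.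
After the summations are interchanged, the unit pair leaves only the term i = 0 of the inner sum. -/
theorem watson_regularized (hq1 : ‖q‖ < 1) {A B C D E t u : ℂ}
    (hA : ∀ n : ℕ, A * q * q ^ n ≠ 1) (ht : D * E * t = A * q) (hu : B * C * u = A * q) (n : ℕ) :
    ∑ k ∈ Finset.range (n + 1), unitBailey q A k * (qPoch B q k * qPoch C q k * u ^ k) *
        (qPochInf (B * u * q ^ k) q * qPochInf (C * u * q ^ k) q) *
        (qPoch D q k * qPoch E q k * t ^ k *
        (qPoch (D * t * q ^ k) q (n - k) * qPoch (E * t * q ^ k) q (n - k)) /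
        (qPoch q q (n - k) * qPoch (A * q) q (n + k))) =
      (1 - A) * ∑ j ∈ Finset.range (n + 1), baileyWeight q D E t n j *
        (qPochInf (B * u * q ^ j) q * qPochInf (C * u * q ^ j) q) *
          (qPoch u q j / qPoch q q j) := by
  have h1 : ∀ k ∈ Finset.range (n + 1), unitBailey q A k * (qPoch B q k * qPoch C q k * u ^ k) *
        (qPochInf (B * u * q ^ k) q * qPochInf (C * u * q ^ k) q) *
        (qPoch D q k * qPoch E q k * t ^ k *
        (qPoch (D * t * q ^ k) q (n - k) * qPoch (E * t * q ^ k) q (n - k)) /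
        (qPoch q q (n - k) * qPoch (A * q) q (n + k))) =
      ∑ j ∈ Finset.Icc k n, baileyWeight q D E t n j *
        (qPochInf (B * u * q ^ j) q * qPochInf (C * u * q ^ j) q) *
        (unitBailey q A k * (∑ i ∈ Finset.Icc k j, baileyWeight q B C u j i /
          (qPoch q q (i - k) * qPoch (A * q) q (i + k)))) := by
    intro k hk
    rw [← sum_baileyWeight hq hA ht (Nat.lt_succ_iff.1 (Finset.mem_range.1 hk)), Finset.mul_sum]
    refine Finset.sum_congr rfl fun j hj => ?_
    have hkj := (Finset.mem_Icc.1 hj).1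
    rw [sum_baileyWeight hq hA hu hkj]
    have e : ∀ x : ℂ, qPochInf (x * q ^ k) q =
        qPoch (x * q ^ k) q (j - k) * qPochInf (x * q ^ j) q := fun x => by
      rw [qPochInf_eq_qPoch_mul hq1 (x * q ^ k) (j - k), mul_assoc x, ← pow_add,
        Nat.add_sub_cancel' hkj]
    -- Splitting off the first j - k factors of the infinite products gives the finite products of
    -- Bailey's lemma; what remains depends on j only and passes out of the sum over k.
    rw [e (B * u), e (C * u)]
    ring
  rw [Finset.sum_congr rfl h1, Finset.sum_comm' (t' := Finset.range (n + 1))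
    (s' := fun j => Finset.range (j + 1)) (by
      intro k j; simp only [Finset.mem_range, Finset.mem_Icc]; omega), Finset.mul_sum]
  refine Finset.sum_congr rfl fun j hj => ?_
  rw [← Finset.mul_sum]
  have h2 : ∑ k ∈ Finset.range (j + 1), unitBailey q A k *
      (∑ i ∈ Finset.Icc k j, baileyWeight q B C u j i /
          (qPoch q q (i - k) * qPoch (A * q) q (i + k))) =
      ∑ i ∈ Finset.range (j + 1), baileyWeight q B C u j i * (if i = 0 then 1 - A else 0) := by
    simp_rw [Finset.mul_sum]
    rw [Finset.sum_comm' (t' := Finset.range (j + 1)) (s' := fun i => Finset.range (i + 1)) (by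
      intro k i; simp only [Finset.mem_range, Finset.mem_Icc]; omega)]
    refine Finset.sum_congr rfl fun i hi => ?_
    rw [← sum_unitBailey hq hA i, Finset.mul_sum]
    exact Finset.sum_congr rfl fun k _ => by ring
  rw [h2]
  simp only [mul_ite, mul_zero, Finset.sum_ite_eq', Finset.mem_range]
  rw [if_pos (by omega)]
  simp only [baileyWeight, qPoch_zero, Nat.sub_zero, pow_zero]
  ring

end

lemma mul_pow_ne_one {q : ℂ} (hq : ‖q‖ < 1) (n : ℕ) : q * q ^ n ≠ 1 := fun h => by
  have : ‖q * q ^ n‖ < 1 := by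
    rw [← pow_succ', norm_pow]; exact pow_lt_one₀ (norm_nonneg _) hq (by simp)
  rw [h] at this; simp at this

/-- The upper parameter q^(-n) of a terminating series, with its power of the argument absorbed:
each factor x(q^n - q^j) equals -x q^j (1 - q^(n-j)). -/
lemma qPochHom_pow (q x : ℂ) (hq : ∀ n : ℕ, q * q ^ n ≠ 1) {k n : ℕ} (hk : k ≤ n) :
    qPochHom (x * q ^ n) x q k =
      x ^ k * ((-1) ^ k * q ^ (k.choose 2)) * (qPoch q q n / qPoch q q (n - k)) := by
  induction k with
  | zero => simp [qPochHom, div_self (qPoch_self_ne_zero' hq n)]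
  | succ k ih =>
    have h := ih (by omega)
    obtain ⟨m, rfl⟩ := Nat.exists_eq_add_of_le hk
    have f1 : k + 1 + m - k = m + 1 := by omega
    have f2 : k + 1 + m - (k + 1) = m := by omega
    have f3 : (k + 1).choose 2 = k + k.choose 2 := by
      rw [Nat.choose_succ_succ' k 1, Nat.choose_one_right]
    rw [f1] at h
    rw [qPochHom, Finset.prod_range_succ, ← qPochHom, h, f2, f3, qPoch_succ q q m]
    have a2 := qPoch_self_ne_zero' hq m
    have a5 : 1 - q * q ^ m ≠ 0 := sub_ne_zero.2 (hq m).symm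
    rw [show k + 1 + m = k + (m + 1) by ring, pow_add q k (m + 1), pow_add q k (k.choose 2)]
    field_simp
    ring

lemma qPochHom_pow_eq_zero (q x : ℂ) {k n : ℕ} (hk : n < k) : qPochHom (x * q ^ n) x q k = 0 :=
  Finset.prod_eq_zero (Finset.mem_range.2 hk) (sub_self _)

/-- **Watson's transformation** for the regularized series. -/
theorem wpSum_terminating {q : ℂ} (hq : ‖q‖ < 1) {A B C D E t u : ℂ}
    (hA : ∀ n : ℕ, A * q * q ^ n ≠ 1) (ht : D * E * t = A * q) (hu : B * C * u = A * q) (n : ℕ) :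
    wpSum q A ![B, C, D, E] ![C * u, B * u, E * t, D * t, A * q * q ^ n] (u * t * q ^ n) (u * t) =
      qPochInf A q * (qPoch q q n * qPochInf (D * t * q ^ n) q * qPochInf (E * t * q ^ n) q) *
      ∑ j ∈ Finset.range (n + 1), baileyWeight q D E t n j *
        (qPochInf (B * u * q ^ j) q * qPochInf (C * u * q ^ j) q) *
          (qPoch u q j / qPoch q q j) := by
  have hq' := mul_pow_ne_one hq
  rw [qPochInf_eq_mul hq A]
  rw [show ∀ x y z w : ℂ, x * y * z * w = y * z * (x * w) by intros; ring,
    ← watson_regularized hq' hq hA ht hu n, Finset.mul_sum, wpSum,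
    tsum_eq_sum (s := Finset.range (n + 1))]
  · refine Finset.sum_congr rfl fun k hk => ?_
    have hkn : k ≤ n := Nat.lt_succ_iff.1 (Finset.mem_range.1 hk)
    rw [wpTerm, qPochHom_pow q (u * t) hq' hkn, unitBailey]
    simp only [Fin.prod_univ_four, Fin.prod_univ_five, Matrix.cons_val]
    have e : ∀ x : ℂ, qPochInf (x * q ^ k) q =
        qPoch (x * q ^ k) q (n - k) * qPochInf (x * q ^ n) q := fun x => by
      rw [qPochInf_eq_qPoch_mul hq (x * q ^ k) (n - k), mul_assoc x, ← pow_add,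
        Nat.add_sub_cancel' hkn]
    have a3 : qPoch (A * q) q (n + k) ≠ 0 := qPoch_ne_zero fun i _ => hA i
    -- The lower parameter A q^(n+1) provides the factor 1/(Aq; q)_{n+k} of the Bailey kernel.
    have e2 : qPochInf (A * q * q ^ n * q ^ k) q =
        qPochInf (A * q) q * (qPoch (A * q) q (n + k))⁻¹ := by
      rw [qPochInf_eq_qPoch_mul hq (A * q) (n + k), mul_assoc (A * q), ← pow_add]
      field_simp
    rw [e2, e (E * t), e (D * t)]
    generalize qPochInf (A * q) q = x₁
    generalize qPoch (A * q) q (n + k) = x₂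
    generalize qPoch (E * t * q ^ k) q (n - k) = x₃
    generalize qPoch (D * t * q ^ k) q (n - k) = x₄
    generalize qPochInf (E * t * q ^ n) q = x₅
    generalize qPochInf (D * t * q ^ n) q = x₆
    generalize qPochInf (C * u * q ^ k) q = x₇
    generalize qPochInf (B * u * q ^ k) q = x₈
    ring
  · intro k hk
    rw [wpTerm, qPochHom_pow_eq_zero q (u * t) (by simpa using hk), mul_zero]

/-! ### A transformation of very-well-poised series -/

/-- The `₈φ₇` series for `v_ν` (with `s = q^ν`, `y = q^z`), up to the factor
`(a/(ds), ab, ac, bc; q)_∞`. -/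
noncomputable def awSeries (q a b c d s y : ℂ) : ℂ :=
  qPochInf (b * c * s) q * wpSum q (a / (d * s)) ![1 / s, q / (b * d * s), a * y, a / y]
    ![q * a / d, a * b, q / (d * s * y), q * y / (d * s), a * c] (b * c * s) (b * q / d)

/-- The transformed `₈φ₇` series for `v_ν`, up to the factor `(ab/(dy), ab, ac, bc; q)_∞`. -/
noncomputable def awSeries' (q a b c d s y : ℂ) : ℂ :=
  qPochInf (c * y) q * wpSum q (a * b / (d * y)) ![b / y, q / (d * y), a / y, a * b * s]
    ![q * a / d, a * b, q * b / d, q / (d * s * y), a * b * c * s / y] (c * y) (q * y / (d * s))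

/-- The coefficients of the terminating form of `awSeries` in the basis `(ay, a/y; q)_j`. -/
noncomputable def awCoeff (q a b d s : ℂ) (n j : ℕ) : ℂ :=
  qPoch (q / (a * d * s)) q (n - j) * (q / (a * d * s)) ^ j / qPoch q q (n - j) *
    (qPochInf (a * b * q ^ j) q * qPochInf (q * a / d * q ^ j) q) *
      (qPoch (a * b * s) q j / qPoch q q j)

/-- The terminating form of `awSeries`. -/
noncomputable def awTerminating (q a b c d s y : ℂ) (n : ℕ) : ℂ :=
  qPochInf (b * c * s) q * qPoch q q n * (qPochInf (c * y) q * qPochInf (c / y) q *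
    ∑ j ∈ Finset.range (n + 1), awCoeff q a b d s n j * (qPoch (a * y) q j * qPoch (a / y) q j))

lemma fin4_forall {P : Fin 4 → Prop} (h0 : P 0) (h1 : P 1) (h2 : P 2) (h3 : P 3) : ∀ i, P i := by
  intro i; fin_cases i <;> assumption

lemma fin5_forall {P : Fin 5 → Prop} (h0 : P 0) (h1 : P 1) (h2 : P 2) (h3 : P 3) (h4 : P 4) :
    ∀ i, P i := by
  intro i; fin_cases i <;> assumption

/-- A holomorphic function on a disc vanishing along a sequence tending to the centre vanishes. -/
lemma eq_zero_of_tendsto_zero {f : ℂ → ℂ} {S : Set ℂ} (hS : IsOpen S) (hc : IsPreconnected S)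
    (h0 : (0 : ℂ) ∈ S) (hf : DifferentiableOn ℂ f S) {u : ℕ → ℂ} (hu : Tendsto u atTop (𝓝 0))
    (hu0 : ∀ n, u n ≠ 0) (hfu : ∀ n, u n ∈ S → f (u n) = 0) : Set.EqOn f 0 S := by
  refine (hf.analyticOnNhd hS).eqOn_zero_of_preconnected_of_frequently_eq_zero hc h0 ?_
  have h : Tendsto u atTop (𝓝[≠] 0) := tendsto_nhdsWithin_iff.2 ⟨hu, .of_forall hu0⟩
  refine h.frequently (Eventually.frequently ?_)
  filter_upwards [hu.eventually (hS.mem_nhds h0)] with n hn using hfu n hn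

lemma convex_norm_lt_one (x y : ℂ) : Convex ℝ {c : ℂ | ‖x * c * y‖ < 1} := by
  have := (convex_ball (0 : ℂ) 1).is_linear_preimage (f := fun c : ℂ => x * c * y)
    ⟨fun u v => by ring, fun r u => by simp [Complex.real_smul]; ring⟩
  have e : {c : ℂ | ‖x * c * y‖ < 1} = (fun c : ℂ => x * c * y) ⁻¹' Metric.ball 0 1 := by
    ext; simp
  rw [e]; exact this

section
variable {q : ℂ} (hq : ‖q‖ < 1) (hq0 : q ≠ 0) {a b d s y : ℂ} (ha : a ≠ 0) (hb : b ≠ 0)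
  (hd : d ≠ 0) (hs : s ≠ 0) (hy : y ≠ 0)
include hq hq0 ha hb hd hs hy

/-- With this c the hidden upper parameter q/(cds) equals q^(-n), so the series terminates. Watson's
transformation is used with u = abs and D, E = ay, a/y. -/
lemma awSeries_terminating (hA : ∀ n : ℕ, a / (d * s) * q ^ n ≠ 1) (n : ℕ) :
    awSeries q a b (q * q ^ n / (d * s)) d s y =
      qPochInf (a / (d * s)) q * awTerminating q a b (q * q ^ n / (d * s)) d s y n := by
  have h := wpSum_terminating hq (A := a / (d * s)) (B := 1 / s) (C := q / (b * d * s))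
    (D := a * y) (E := a / y) (t := q / (a * d * s)) (u := a * b * s)
    (fun n => by rw [mul_assoc, ← pow_succ']; exact hA (n + 1))
    (by field_simp) (by field_simp) n
  have e1 : q / (b * d * s) * (a * b * s) = q * a / d := by field_simp
  have e2 : 1 / s * (a * b * s) = a * b := by field_simp
  have e3 : a / y * (q / (a * d * s)) = q / (d * s * y) := by field_simp
  have e4 : a * y * (q / (a * d * s)) = q * y / (d * s) := by field_simp
  have e5 : a / (d * s) * q * q ^ n = a * (q * q ^ n / (d * s)) := by field_simp
  have e6 : a * b * s * (q / (a * d * s)) * q ^ n = b * (q * q ^ n / (d * s)) * s := by field_simp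
  have e7 : a * b * s * (q / (a * d * s)) = b * q / d := by field_simp
  have e8 : q / (d * s * y) * q ^ n = q * q ^ n / (d * s) / y := by field_simp
  have e9 : q * y / (d * s) * q ^ n = q * q ^ n / (d * s) * y := by field_simp
  rw [e6, e7, e1, e2, e3, e4, e5, e8, e9] at h
  rw [awSeries, h, awTerminating, Finset.mul_sum, Finset.mul_sum, Finset.mul_sum, Finset.mul_sum,
    Finset.mul_sum]
  refine Finset.sum_congr rfl fun j _ => ?_
  rw [awCoeff, baileyWeight]
  ring

/-- For given t, Bu and Cu, the sum produced by Watson's transformation is symmetric in D, E, u.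
Here abs and ay trade places compared with `awSeries_terminating`, while t = q/(ads), Bu = ab and Cu
= qa/d are the same; hence the same finite sum appears. -/
lemma awSeries'_terminating (hA : ∀ n : ℕ, a * b / (d * y) * q ^ n ≠ 1) (n : ℕ) :
    awSeries' q a b (q * q ^ n / (d * s)) d s y =
      qPochInf (a * b / (d * y)) q * awTerminating q a b (q * q ^ n / (d * s)) d s y n := by
  have h := wpSum_terminating hq (A := a * b / (d * y)) (B := b / y) (C := q / (d * y))
    (D := a / y) (E := a * b * s) (t := q / (a * d * s)) (u := a * y)
    (fun n => by rw [mul_assoc, ← pow_succ']; exact hA (n + 1))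
    (by field_simp) (by field_simp) n
  have e1 : q / (d * y) * (a * y) = q * a / d := by field_simp
  have e2 : b / y * (a * y) = a * b := by field_simp
  have e3 : a * b * s * (q / (a * d * s)) = q * b / d := by field_simp
  have e4 : a / y * (q / (a * d * s)) = q / (d * s * y) := by field_simp
  have e5 : a * b / (d * y) * q * q ^ n = a * b * (q * q ^ n / (d * s)) * s / y := by field_simp
  have e6 : a * y * (q / (a * d * s)) * q ^ n = q * q ^ n / (d * s) * y := by field_simp
  have e7 : a * y * (q / (a * d * s)) = q * y / (d * s) := by field_simp
  have e8 : q / (d * s * y) * q ^ n = q * q ^ n / (d * s) / y := by field_simp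
  have e9 : q * b / d * q ^ n = b * (q * q ^ n / (d * s)) * s := by field_simp
  rw [e6, e7, e1, e2, e3, e4, e5, e8, e9] at h
  rw [awSeries', h, awTerminating, Finset.mul_sum, Finset.mul_sum, Finset.mul_sum, Finset.mul_sum,
    Finset.mul_sum]
  refine Finset.sum_congr rfl fun j _ => ?_
  rw [awCoeff, baileyWeight]
  ring

omit hq0 ha hb hd hs hy in
lemma tendsto_terminating_param (x : ℂ) : Tendsto (fun n : ℕ => q * q ^ n / x) atTop (𝓝 0) := by
  have := ((tendsto_pow_atTop_nhds_zero_of_norm_lt_one hq).const_mul q).div_const x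
  simpa using this

omit hq0 ha hb hd hs hy in
lemma differentiableOn_awSeries_param (y : ℂ) :
    DifferentiableOn ℂ (fun c => awSeries q a b c d s y) {c | ‖b * c * s‖ < 1} := by
  have h := differentiable_qPochInf hq
  have hS : IsOpen {c : ℂ | ‖b * c * s‖ < 1} := isOpen_lt (by fun_prop) (by fun_prop)
  unfold awSeries
  refine DifferentiableOn.mul (h.comp (by fun_prop : Differentiable ℂ fun c => b * c * s)).differentiableOn
    (differentiableOn_wpSum hq hS (by fun_prop) (fin4_forall ?_ ?_ ?_ ?_)
      (fin5_forall ?_ ?_ ?_ ?_ ?_) (by fun_prop) (by fun_prop) (fun c hc => hc)) <;>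
  · simp only [Matrix.cons_val]; fun_prop

omit hq0 ha hb hd hs hy in
lemma differentiableOn_awSeries'_param (y : ℂ) :
    DifferentiableOn ℂ (fun c => awSeries' q a b c d s y) {c | ‖c * y‖ < 1} := by
  have h := differentiable_qPochInf hq
  have hS : IsOpen {c : ℂ | ‖c * y‖ < 1} := isOpen_lt (by fun_prop) (by fun_prop)
  unfold awSeries'
  refine DifferentiableOn.mul (h.comp (by fun_prop : Differentiable ℂ fun c => c * y)).differentiableOn
    (differentiableOn_wpSum hq hS (by fun_prop) (fin4_forall ?_ ?_ ?_ ?_)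
      (fin5_forall ?_ ?_ ?_ ?_ ?_) (by fun_prop) (by fun_prop) (fun c hc => hc)) <;>
  · simp only [Matrix.cons_val]; fun_prop

/-- Both `₈φ₇` series represent the same function. -/
theorem awSeries_transformation {c : ℂ} (hA : ∀ n : ℕ, a / (d * s) * q ^ n ≠ 1)
    (hA' : ∀ n : ℕ, a * b / (d * y) * q ^ n ≠ 1) (h1 : ‖b * c * s‖ < 1) (h2 : ‖c * y‖ < 1) :
    awSeries q a b c d s y / qPochInf (a / (d * s)) q =
      awSeries' q a b c d s y / qPochInf (a * b / (d * y)) q := by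
  have n1 := qPochInf_ne_zero hq hA
  have n2 := qPochInf_ne_zero hq hA'
  set S : Set ℂ := {c | ‖b * c * s‖ < 1} ∩ {c | ‖c * y‖ < 1}
  have hS : IsOpen S := (isOpen_lt (by fun_prop) (by fun_prop)).inter
    (isOpen_lt (by fun_prop) (by fun_prop))
  have hconv : Convex ℝ S := by
    have := convex_norm_lt_one 1 y
    simp only [one_mul] at this
    exact (convex_norm_lt_one b s).inter this
  -- Both sides agree at c = q^(n+1)/(ds) whenever this lies in S; these points accumulate at 0, and
  -- S is convex, hence connected.
  have key := eq_zero_of_tendsto_zero (S := S)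
    (f := fun c => awSeries q a b c d s y / qPochInf (a / (d * s)) q -
      awSeries' q a b c d s y / qPochInf (a * b / (d * y)) q) hS hconv.isPreconnected
    (by simp [S])
    ((((differentiableOn_awSeries_param hq y).mono Set.inter_subset_left).div_const _).sub
      (((differentiableOn_awSeries'_param hq y).mono Set.inter_subset_right).div_const _))
    (tendsto_terminating_param hq (d * s)) (fun n => by positivity) (fun n _ => by
      rw [awSeries_terminating hq hq0 ha hb hd hs hy hA,
        awSeries'_terminating hq hq0 ha hb hd hs hy hA', mul_div_cancel_left₀ _ n1,
        mul_div_cancel_left₀ _ n2, sub_self])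
  exact sub_eq_zero.1 (key (show c ∈ S from ⟨h1, h2⟩))

end

/-! ### The difference equation -/

/-- The coefficient of `v(qy)` in the difference equation for `v`. -/
noncomputable def awB (q a b c d y : ℂ) : ℂ :=
  -(d * y) * (1 - a * y) * (1 - b * y) * (1 - c * y) * (1 - q * y / d) /
    ((1 - y ^ 2) * (1 - q * y ^ 2))

/-- The coefficient function of the Askey–Wilson operator. -/
noncomputable def awA (q a b c d y : ℂ) : ℂ :=
  (1 - a * y) * (1 - b * y) * (1 - c * y) * (1 - d * y) / ((1 - y ^ 2) * (1 - q * y ^ 2))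

/-- The eigenvalue of the Askey–Wilson operator. -/
noncomputable def awE (q a b c d s : ℂ) : ℂ := -((1 - 1 / s) * (1 - a * b * c * d * s / q))

section
variable {q : ℂ} (hq : ‖q‖ < 1) (hq0 : q ≠ 0) {a b c d s y : ℂ} (ha : a ≠ 0) (hb : b ≠ 0)
  (hd : d ≠ 0) (hs : s ≠ 0) (hy : y ≠ 0) (hy1 : 1 - y ^ 2 ≠ 0) (hy2 : 1 - q * y ^ 2 ≠ 0)
  (hy3 : y ^ 2 - q ≠ 0)

include hq0 hd hy hy1 hy2 hy3 ha in
-- The rational identity, with Q = q^j, that remains when the common factors are removed from the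
-- action of the difference operator on the basis function of index j + 1. On the right, the part
-- free of y is the coefficient of index j, and the other part is the diagonal one. The coefficient
-- `awB` is `awA` conjugated by (qy/d, q/(dy); q)_∞, the factor that distinguishes v from u; this
-- multiplies `awA` by -dy(1 - qy/d)/(1 - dy).
lemma aw_basis_identity {Q : ℂ} (hQ : Q ≠ 0) :
    -(d * y) * (1 - b * y) * (1 - q * y / d) * (1 - c / (q * y)) * (1 - a / (q * y)) *
        (1 - a * q * Q * y) * (1 - a * Q * y) / ((1 - y ^ 2) * (1 - q * y ^ 2)) +
      -(d * (1 / y)) * (1 - b * (1 / y)) * (1 - q * (1 / y) / d) * (1 - c * y / q) *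
        (1 - a * y / q) * (1 - a * q * Q / y) * (1 - a * Q / y) /
          ((1 - (1 / y) ^ 2) * (1 - q * (1 / y) ^ 2)) -
      (awA q a b c d y + awA q a b c d (1 / y)) * ((1 - a * Q * y) * (1 - a * Q / y)) =
    a * d / q * (1 - q * Q) * (1 - c / (a * q * Q)) * (1 - a * b * Q) * (1 - a * q * Q / d) +
      (c * d / (q ^ 2 * Q) + a * b * q * Q - 1 - a * b * c * d / q) *
        ((1 - a * Q * y) * (1 - a * Q / y)) := by
  have e1 : 1 - (1 / y) ^ 2 = -(1 - y ^ 2) / y ^ 2 := by field_simp; ring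
  have e2 : 1 - q * (1 / y) ^ 2 = (y ^ 2 - q) / y ^ 2 := by field_simp
  unfold awA
  rw [e1, e2]
  -- The denominators are kept as atoms while they are cleared and are expanded only for the final
  -- polynomial identity.
  obtain ⟨u, hu⟩ : ∃ u, u = 1 - y ^ 2 := ⟨_, rfl⟩
  obtain ⟨v, hv⟩ : ∃ v, v = 1 - q * y ^ 2 := ⟨_, rfl⟩
  obtain ⟨w, hw⟩ : ∃ w, w = y ^ 2 - q := ⟨_, rfl⟩
  rw [← hu] at hy1 ⊢
  rw [← hv] at hy2 ⊢
  rw [← hw] at hy3 ⊢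
  field_simp
  rw [hu, hv, hw]
  ring

include hq0 hd hy hy1 hy2 hy3 in
lemma aw_basis_identity_zero :
    -(d * y) * (1 - a * y) * (1 - b * y) * (1 - q * y / d) * (1 - c / (q * y)) /
        ((1 - y ^ 2) * (1 - q * y ^ 2)) +
      -(d * (1 / y)) * (1 - a * (1 / y)) * (1 - b * (1 / y)) * (1 - q * (1 / y) / d) *
        (1 - c * y / q) / ((1 - (1 / y) ^ 2) * (1 - q * (1 / y) ^ 2)) -
      (awA q a b c d y + awA q a b c d (1 / y)) =
    c * d / q + a * b - 1 - a * b * c * d / q := by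
  have e1 : 1 - (1 / y) ^ 2 = -(1 - y ^ 2) / y ^ 2 := by field_simp; ring
  have e2 : 1 - q * (1 / y) ^ 2 = (y ^ 2 - q) / y ^ 2 := by field_simp
  unfold awA
  rw [e1, e2]
  obtain ⟨u, hu⟩ : ∃ u, u = 1 - y ^ 2 := ⟨_, rfl⟩
  obtain ⟨v, hv⟩ : ∃ v, v = 1 - q * y ^ 2 := ⟨_, rfl⟩
  obtain ⟨w, hw⟩ : ∃ w, w = y ^ 2 - q := ⟨_, rfl⟩
  rw [← hu] at hy1 ⊢
  rw [← hv] at hy2 ⊢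
  rw [← hw] at hy3 ⊢
  field_simp
  rw [hu, hv, hw]
  ring
end

section
variable {q : ℂ} (hq : ‖q‖ < 1) (hq0 : q ≠ 0) {a b c d s y : ℂ} (ha : a ≠ 0) (hb : b ≠ 0)
  (hd : d ≠ 0) (hs : s ≠ 0) (hy : y ≠ 0) (hy1 : 1 - y ^ 2 ≠ 0) (hy2 : 1 - q * y ^ 2 ≠ 0)
  (hy3 : y ^ 2 - q ≠ 0)

/-- The basis function `(cy, c/y; q)_∞ (ay, a/y; q)_j`. -/
noncomputable def awBasis (q a c y : ℂ) (j : ℕ) : ℂ :=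
  qPochInf (c * y) q * qPochInf (c / y) q * (qPoch (a * y) q j * qPoch (a / y) q j)

include hq0 hy in
-- The shift y ↦ qy moves one factor from one product to the other. The factor 1 - ay, which is
-- present in `awB`, replaces a division.
lemma qPoch_shift_basis (j : ℕ) :
    (1 - a * y) * (qPoch (a * (q * y)) q (j + 1) * qPoch (a / (q * y)) q (j + 1)) =
      (1 - a * q * q ^ j * y) * (1 - a * q ^ j * y) * (1 - a / (q * y)) *
        (qPoch (a * y) q j * qPoch (a / y) q j) := by
  have h1 := (qPoch_succ' (a * y) q j).symm.trans (qPoch_succ (a * y) q j)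
  rw [qPoch_succ, qPoch_succ' (a / (q * y)), show a / (q * y) * q = a / y by field_simp,
    show a * (q * y) = a * y * q by ring]
  linear_combination (1 - a * y * q * q ^ j) * (1 - a / (q * y)) * qPoch (a / y) q j * h1

include hq hq0 hy in
-- The products at y, qy and y/q share the factor H = (cqy, cq/y; q)_∞, so that only rational
-- functions remain to be compared.
lemma qPochInf_shift_basis :
    ∃ H : ℂ, qPochInf (c * y) q * qPochInf (c / y) q = (1 - c * y) * (1 - c / y) * H ∧
      qPochInf (c * (q * y)) q * qPochInf (c / (q * y)) q = (1 - c / (q * y)) * (1 - c / y) * H ∧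
      qPochInf (c * (y / q)) q * qPochInf (c / (y / q)) q = (1 - c * y / q) * (1 - c * y) * H := by
  refine ⟨qPochInf (c * y * q) q * qPochInf (c / y * q) q, ?_, ?_, ?_⟩
  · rw [qPochInf_eq_mul hq (c * y), qPochInf_eq_mul hq (c / y)]; ring
  · rw [qPochInf_eq_mul hq (c / (q * y)), show c / (q * y) * q = c / y by field_simp,
      qPochInf_eq_mul hq (c / y), show c * (q * y) = c * y * q by ring]; ring
  · rw [qPochInf_eq_mul hq (c * (y / q)), show c * (y / q) * q = c * y by field_simp,
      qPochInf_eq_mul hq (c * y), show c / (y / q) = c / y * q by field_simp,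
      show c * (y / q) = c * y / q by ring]; ring

include hq hq0 hd hy hy1 hy2 hy3 ha in
-- The operator is bidiagonal on this basis, so an eigenfunction expansion has coefficients with a
-- two-term recurrence.
lemma awBasis_succ_equation (j : ℕ) :
    awB q a b c d y * awBasis q a c (q * y) (j + 1) +
      awB q a b c d (1 / y) * awBasis q a c (y / q) (j + 1) -
      (awA q a b c d y + awA q a b c d (1 / y)) * awBasis q a c y (j + 1) =
    a * d / q * (1 - q * q ^ j) * (1 - c / (a * q * q ^ j)) * (1 - a * b * q ^ j) *
        (1 - a * q * q ^ j / d) * awBasis q a c y j +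
      (c * d / (q ^ 2 * q ^ j) + a * b * q * q ^ j - 1 - a * b * c * d / q) *
        awBasis q a c y (j + 1) := by
  obtain ⟨H, h1, h2, h3⟩ := qPochInf_shift_basis (c := c) hq hq0 hy
  have key := aw_basis_identity (b := b) (c := c) hq0 ha hd hy hy1 hy2 hy3 (pow_ne_zero j hq0)
  have k1 := qPoch_shift_basis (a := a) hq0 hy j
  have k2 := qPoch_shift_basis (a := a) hq0 (one_div_ne_zero hy) j
  have e1 : a * (q * (1 / y)) = a / (y / q) := by field_simp
  have e2 : a / (q * (1 / y)) = a * (y / q) := by field_simp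
  have e3 : a / (1 / y) = a * y := by field_simp
  have e4 : a * (1 / y) = a / y := by field_simp
  rw [e1, e2, e3, e4] at k2
  have k3 : qPoch (a * y) q (j + 1) * qPoch (a / y) q (j + 1) =
      (1 - a * q ^ j * y) * (1 - a * q ^ j / y) * (qPoch (a * y) q j * qPoch (a / y) q j) := by
    rw [qPoch_succ, qPoch_succ]; ring
  unfold awBasis
  rw [h1, h2, h3, k3]
  set P := qPoch (a * y) q j * qPoch (a / y) q j
  unfold awB
  linear_combination ((1 - c * y) * (1 - c / y) * H * P) * key +
    (-(d * y) * (1 - b * y) * (1 - c * y) * (1 - q * y / d) /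
      ((1 - y ^ 2) * (1 - q * y ^ 2)) * ((1 - c / (q * y)) * (1 - c / y) * H)) * k1 +
    (-(d * (1 / y)) * (1 - b * (1 / y)) * (1 - c * (1 / y)) * (1 - q * (1 / y) / d) /
      ((1 - (1 / y) ^ 2) * (1 - q * (1 / y) ^ 2)) * ((1 - c * y / q) * (1 - c * y) * H)) * k2

include hq hq0 hd hy hy1 hy2 hy3 in
lemma awBasis_zero_equation :
    awB q a b c d y * awBasis q a c (q * y) 0 + awB q a b c d (1 / y) * awBasis q a c (y / q) 0 -
      (awA q a b c d y + awA q a b c d (1 / y)) * awBasis q a c y 0 =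
    (c * d / q + a * b - 1 - a * b * c * d / q) * awBasis q a c y 0 := by
  obtain ⟨H, h1, h2, h3⟩ := qPochInf_shift_basis (c := c) hq hq0 hy
  have key := aw_basis_identity_zero (a := a) (b := b) (c := c) hq0 hd hy hy1 hy2 hy3
  unfold awBasis
  rw [h1, h2, h3]
  simp only [qPoch_zero, mul_one]
  unfold awB
  linear_combination ((1 - c * y) * (1 - c / y) * H) * key

include hq hq0 ha hd hs in
-- This is the vanishing of the coefficient of the basis function of index j in the eigenvalue
-- equation. The choice of c enters through c/(a q^(j+1)) = q^(n-j)/(ads), which is what the factor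
-- (q/(ads); q)_{n-j} requires.
lemma awCoeff_recurrence {n j : ℕ} (hj : j < n) (hc : c = q * q ^ n / (d * s)) :
    awCoeff q a b d s n (j + 1) * (a * d / q * (1 - q * q ^ j) * (1 - c / (a * q * q ^ j)) *
      (1 - a * b * q ^ j) * (1 - a * q * q ^ j / d)) =
    -(awCoeff q a b d s n j *
      (c * d / (q * q ^ j) + a * b * q ^ j - 1 - a * b * c * d / q - awE q a b c d s)) := by
  obtain ⟨m, rfl⟩ := Nat.exists_eq_add_of_lt hj
  have f1 : j + m + 1 - (j + 1) = m := by omega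
  have f2 : j + m + 1 - j = m + 1 := by omega
  have hq' := mul_pow_ne_one hq
  have a1 := qPoch_self_ne_zero' hq' j
  have a2 := qPoch_self_ne_zero' hq' m
  have a3 : 1 - q * q ^ j ≠ 0 := sub_ne_zero.2 (hq' j).symm
  have a4 : 1 - q * q ^ m ≠ 0 := sub_ne_zero.2 (hq' m).symm
  have e1 : c / (a * q * q ^ j) = q / (a * d * s) * q ^ m := by
    rw [hc]; field_simp; ring
  have e2 : c * d / (q * q ^ j) + a * b * q ^ j - 1 - a * b * c * d / q - awE q a b c d s =
      -(1 / s * (1 - q * q ^ m) * (1 - a * b * s * q ^ j)) := by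
    rw [hc, awE]; field_simp; ring
  rw [e1, e2]
  simp only [awCoeff, f1, f2, qPoch_succ]
  rw [qPochInf_eq_mul hq (a * b * q ^ j), qPochInf_eq_mul hq (q * a / d * q ^ j),
    show a * b * q ^ j * q = a * b * q ^ (j + 1) by ring,
    show q * a / d * q ^ j * q = q * a / d * q ^ (j + 1) by ring]
  generalize qPochInf (a * b * q ^ (j + 1)) q = x₁
  generalize qPochInf (q * a / d * q ^ (j + 1)) q = x₂
  generalize qPoch (a * b * s) q j = x₃
  obtain ⟨t, ht⟩ : ∃ t, t = q / (a * d * s) := ⟨_, rfl⟩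
  have ht' : a * d / q = 1 / (s * t) := by rw [ht]; field_simp
  have ht0 : t ≠ 0 := by rw [ht]; positivity
  rw [← ht, ht', show a * q * q ^ j / d = q * a / d * q ^ j by ring]
  generalize qPoch t q m = x₄
  generalize q * a / d * q ^ j = x₅
  generalize 1 - q * q ^ j = x₆ at a3 ⊢
  generalize 1 - q * q ^ m = x₇ at a4 ⊢
  generalize qPoch q q j = x₈ at a1 ⊢
  generalize qPoch q q m = x₉ at a2 ⊢
  field_simp
  ring

include hq hq0 ha hd hs hy hy1 hy2 hy3 in
lemma awTerminating_equation {n : ℕ} (hc : c = q * q ^ n / (d * s)) :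
    awB q a b c d y * awTerminating q a b c d s (q * y) n +
      awB q a b c d (1 / y) * awTerminating q a b c d s (y / q) n -
      (awA q a b c d y + awA q a b c d (1 / y) + awE q a b c d s) *
        awTerminating q a b c d s y n = 0 := by
  have e : ∀ y, awTerminating q a b c d s y n = qPochInf (b * c * s) q * qPoch q q n *
      ∑ j ∈ Finset.range (n + 1), awCoeff q a b d s n j * awBasis q a c y j := fun y => by
    rw [awTerminating, Finset.mul_sum]
    congr 1
    exact Finset.sum_congr rfl fun j _ => by rw [awBasis]; ring
  set L : ℕ → ℂ := fun j => c * d / (q * q ^ j) + a * b * q ^ j - 1 - a * b * c * d / q -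
    awE q a b c d s with hL
  set κ : ℕ → ℂ := fun j => a * d / q * (1 - q * q ^ j) * (1 - c / (a * q * q ^ j)) *
      (1 - a * b * q ^ j) * (1 - a * q * q ^ j / d) with hκ
  -- The recurrence makes the sum telescope to its top term, which L n = 0 removes; this is where c
  -- = q^(n+1)/(ds) closes the finite expansion.
  have hLn : L n = 0 := by
    simp only [hL, awE, hc]; field_simp; ring
  have hsum : ∑ j ∈ Finset.range (n + 1), awCoeff q a b d s n j *
      (awB q a b c d y * awBasis q a c (q * y) j + awB q a b c d (1 / y) * awBasis q a c (y / q) j -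
      (awA q a b c d y + awA q a b c d (1 / y) + awE q a b c d s) * awBasis q a c y j) = 0 := by
    have h0 : awCoeff q a b d s n 0 * (awB q a b c d y * awBasis q a c (q * y) 0 +
        awB q a b c d (1 / y) * awBasis q a c (y / q) 0 -
        (awA q a b c d y + awA q a b c d (1 / y) + awE q a b c d s) * awBasis q a c y 0) =
        awCoeff q a b d s n 0 * L 0 * awBasis q a c y 0 := by
      have := awBasis_zero_equation (a := a) (b := b) (c := c) hq hq0 hd hy hy1 hy2 hy3
      simp only [hL, pow_zero, mul_one]
      linear_combination awCoeff q a b d s n 0 * this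
    have h1 : ∀ j ∈ Finset.range n, awCoeff q a b d s n (j + 1) *
        (awB q a b c d y * awBasis q a c (q * y) (j + 1) +
        awB q a b c d (1 / y) * awBasis q a c (y / q) (j + 1) -
        (awA q a b c d y + awA q a b c d (1 / y) + awE q a b c d s) * awBasis q a c y (j + 1)) =
        awCoeff q a b d s n (j + 1) * L (j + 1) * awBasis q a c y (j + 1) -
          awCoeff q a b d s n j * L j * awBasis q a c y j := by
      intro j hj
      have h2 := awBasis_succ_equation (b := b) (c := c) hq hq0 ha hd hy hy1 hy2 hy3 j
      have h3 := awCoeff_recurrence (b := b) hq hq0 ha hd hs (Finset.mem_range.1 hj) hc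
      have h4 : L (j + 1) = c * d / (q ^ 2 * q ^ j) + a * b * q * q ^ j - 1 - a * b * c * d / q -
          awE q a b c d s := by simp only [hL]; ring
      rw [h4]
      simp only [hL]
      linear_combination awCoeff q a b d s n (j + 1) * h2 + awBasis q a c y j * h3
    rw [Finset.sum_range_succ', h0, Finset.sum_congr rfl h1, Finset.sum_range_sub
      (fun j => awCoeff q a b d s n j * L j * awBasis q a c y j), hLn]
    ring
  rw [e, e, e]
  have e' : ∀ S₁ S₂ S₃ p q r k : ℂ, p * (k * S₁) + q * (k * S₂) - r * (k * S₃) =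
    k * (p * S₁ + q * S₂ - r * S₃) := by intros; ring
  rw [e', Finset.mul_sum, Finset.mul_sum, Finset.mul_sum, ← Finset.sum_add_distrib,
    ← Finset.sum_sub_distrib]
  refine mul_eq_zero_of_right _ (Eq.trans (Finset.sum_congr rfl fun j _ => ?_) hsum)
  ring

include hq hq0 ha hb hd hs hy hy1 hy2 hy3 in
/-- The difference equation for the `₈φ₇` series. -/
theorem awSeries_equation (hA : ∀ n : ℕ, a / (d * s) * q ^ n ≠ 1) (h : ‖b * c * s‖ < 1) :
    awB q a b c d y * awSeries q a b c d s (q * y) +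
      awB q a b c d (1 / y) * awSeries q a b c d s (y / q) -
      (awA q a b c d y + awA q a b c d (1 / y) + awE q a b c d s) * awSeries q a b c d s y = 0 := by
  set S : Set ℂ := {c | ‖b * c * s‖ < 1}
  have hS : IsOpen S := isOpen_lt (by fun_prop) (by fun_prop)
  have hdiff := fun y => differentiableOn_awSeries_param (a := a) (b := b) (d := d) (s := s) hq y
  -- The coefficients and the eigenvalue are polynomials in c, so the equation passes from the
  -- terminating values of c to the whole disc of convergence.
  have key := eq_zero_of_tendsto_zero (S := S)
    (f := fun c => awB q a b c d y * awSeries q a b c d s (q * y) +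
      awB q a b c d (1 / y) * awSeries q a b c d s (y / q) -
      (awA q a b c d y + awA q a b c d (1 / y) + awE q a b c d s) * awSeries q a b c d s y)
    hS (convex_norm_lt_one b s).isPreconnected (by simp [S]) (by
      have hB : ∀ y, Differentiable ℂ fun c => awB q a b c d y := fun y => by
        unfold awB; fun_prop
      have hA : ∀ y, Differentiable ℂ fun c => awA q a b c d y := fun y => by
        unfold awA; fun_prop
      have hE : Differentiable ℂ fun c => awE q a b c d s := by unfold awE; fun_prop
      exact ((((hB y).differentiableOn.mul (hdiff _)).add ((hB _).differentiableOn.mul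
        (hdiff _))).sub ((((hA y).add (hA _)).add hE).differentiableOn.mul (hdiff _))))
    (tendsto_terminating_param hq (d * s)) (fun n => by positivity) (fun n _ => by
      have hqy : q * y ≠ 0 := mul_ne_zero hq0 hy
      have hyq : y / q ≠ 0 := div_ne_zero hy hq0
      rw [awSeries_terminating hq hq0 ha hb hd hs hy hA,
        awSeries_terminating hq hq0 ha hb hd hs hqy hA,
        awSeries_terminating hq hq0 ha hb hd hs hyq hA]
      have := awTerminating_equation (b := b) hq hq0 ha hd hs hy hy1 hy2 hy3
        (c := q * q ^ n / (d * s)) rfl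
      linear_combination qPochInf (a / (d * s)) q * this)
  exact key h

end

/-! ### Complex-analytic tools -/

lemma continuousOn_intervalIntegral {X : Type*} [TopologicalSpace X] {S : Set X} {f : X → ℝ → ℂ}
    (hf : ContinuousOn (Function.uncurry f) (S ×ˢ Set.univ)) (a b : ℝ) :
    ContinuousOn (fun p => ∫ θ in a..b, f p θ) S := by
  rw [continuousOn_iff_continuous_domRestrict]
  refine intervalIntegral.continuous_parametric_intervalIntegral_of_continuous'
    (f := fun (p : S) θ => f p θ) ?_ a b
  have h : Continuous fun p : S × ℝ => ((p.1 : X), p.2) := by fun_prop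
  exact hf.comp_continuous h fun p => ⟨p.1.2, trivial⟩

lemma deriv_eq_intervalIntegral {f : ℂ → ℂ} {z : ℂ} {r : ℝ} (hr : 0 < r)
    (hf : DifferentiableOn ℂ f (Metric.closedBall z r)) :
    deriv f z = (2 * Real.pi : ℂ)⁻¹ * ∫ θ in (0 : ℝ)..2 * Real.pi,
      f (circleMap z r θ) * (circleMap 0 r θ)⁻¹ := by
  have h := hf.circleIntegral_one_div_sub_center_pow_smul hr 1
  rw [circleIntegral] at h
  have e : ∀ θ, deriv (circleMap z r) θ • ((1 / (circleMap z r θ - z) ^ (1 + 1)) •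
      f (circleMap z r θ)) = Complex.I * (f (circleMap z r θ) * (circleMap 0 r θ)⁻¹) := fun θ => by
    have h0 : circleMap 0 r θ ≠ 0 := circleMap_ne_center hr.ne'
    rw [deriv_circleMap, smul_eq_mul, smul_eq_mul, circleMap_sub_center]
    field_simp
  simp_rw [e] at h
  rw [intervalIntegral.integral_const_mul, iteratedDeriv_one] at h
  have hI := Complex.I_ne_zero
  have hpi : (Real.pi : ℂ) ≠ 0 := by exact_mod_cast Real.pi_ne_zero
  have h2 : ∫ θ in (0 : ℝ)..2 * Real.pi, f (circleMap z r θ) * (circleMap 0 r θ)⁻¹ =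
      2 * Real.pi * deriv f z := mul_left_cancel₀ hI (by rw [h]; simp; ring)
  rw [h2]
  field_simp

/-- Cauchy's formula on a circle of fixed radius writes the derivative as an integral of f, which is
jointly continuous. One third of the available radius leaves room for the centre to move. -/
lemma continuousOn_deriv_param {X : Type*} [TopologicalSpace X] {S : Set X} (hS : IsOpen S)
    {Ω : Set ℂ} (hΩ : IsOpen Ω) {f : X → ℂ → ℂ}
    (hf : ContinuousOn (Function.uncurry f) (S ×ˢ Ω)) (hd : ∀ p ∈ S, DifferentiableOn ℂ (f p) Ω) :
    ContinuousOn (fun v : X × ℂ => deriv (f v.1) v.2) (S ×ˢ Ω) := by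
  rintro ⟨p₀, z₀⟩ ⟨hp, hz⟩
  obtain ⟨R, hR, hball⟩ := Metric.isOpen_iff.1 hΩ z₀ hz
  set r := R / 3
  have hr : 0 < r := by positivity
  have hmem : ∀ z ∈ Metric.ball z₀ r, Metric.closedBall z r ⊆ Ω := fun z hz w hw => by
    refine hball ?_
    rw [Metric.mem_ball] at hz ⊢
    rw [Metric.mem_closedBall] at hw
    have := dist_triangle w z z₀
    have : r * 3 = R := by simp [r]
    linarith
  have hO : IsOpen (S ×ˢ Metric.ball z₀ r) := hS.prod Metric.isOpen_ball
  have hcont : ContinuousOn (fun v : X × ℂ => (2 * Real.pi : ℂ)⁻¹ *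
      ∫ θ in (0 : ℝ)..2 * Real.pi, f v.1 (circleMap v.2 r θ) * (circleMap 0 r θ)⁻¹)
      (S ×ˢ Metric.ball z₀ r) := by
    refine continuousOn_const.mul (continuousOn_intervalIntegral ?_ _ _)
    refine ContinuousOn.mul ?_ ?_
    · have h : Continuous fun w : (X × ℂ) × ℝ => (w.1.1, circleMap w.1.2 r w.2) := by
        unfold circleMap; fun_prop
      refine hf.comp h.continuousOn fun w hw => ⟨hw.1.1, hmem _ hw.1.2 ?_⟩
      exact circleMap_mem_closedBall _ hr.le _
    · refine ContinuousOn.inv₀ (by fun_prop) fun w _ => circleMap_ne_center hr.ne'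
  have heq : Set.EqOn (fun v : X × ℂ => deriv (f v.1) v.2) (fun v : X × ℂ => (2 * Real.pi : ℂ)⁻¹ *
      ∫ θ in (0 : ℝ)..2 * Real.pi, f v.1 (circleMap v.2 r θ) * (circleMap 0 r θ)⁻¹)
      (S ×ˢ Metric.ball z₀ r) := fun v hv =>
    deriv_eq_intervalIntegral hr ((hd _ hv.1).mono (hmem _ hv.2))
  exact ((hcont.congr heq).continuousAt
    (hO.mem_nhds ⟨hp, Metric.mem_ball_self hr⟩)).continuousWithinAt

/-- Differentiation under the integral: the derivative of the integrand is jointly continuous, hence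
bounded on a compact neighbourhood, which gives the dominating constant. -/
lemma differentiableOn_intervalIntegral {Ω : Set ℂ} (hΩ : IsOpen Ω) {f : ℂ → ℝ → ℂ}
    (hf : ContinuousOn (Function.uncurry f) (Ω ×ˢ Set.univ))
    (hd : ∀ θ, DifferentiableOn ℂ (fun p => f p θ) Ω) (a b : ℝ) :
    DifferentiableOn ℂ (fun p => ∫ θ in a..b, f p θ) Ω := by
  intro p₀ hp
  obtain ⟨R, hR, hball⟩ := Metric.isOpen_iff.1 hΩ p₀ hp
  set r := R / 2
  have hr : 0 < r := by positivity
  have hsub : Metric.closedBall p₀ r ⊆ Ω :=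
    (Metric.closedBall_subset_ball (by simp only [r]; linarith)).trans hball
  have hdc : ContinuousOn (fun v : ℝ × ℂ => deriv (fun p => f p v.1) v.2) (Set.univ ×ˢ Ω) :=
    continuousOn_deriv_param isOpen_univ hΩ (f := fun θ p => f p θ)
      (hf.comp (f := Prod.swap) continuous_swap.continuousOn fun v hv => ⟨hv.2, trivial⟩)
      fun θ _ => hd θ
  obtain ⟨C, hC⟩ := (((isCompact_uIcc (a := a) (b := b)).prod
    (isCompact_closedBall p₀ r)).exists_bound_of_continuousOn
      (hdc.mono (Set.prod_mono (Set.subset_univ _) hsub)))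
  have hfc : ∀ p ∈ Ω, Continuous (f p) := fun p hp =>
    hf.comp_continuous (f := fun θ : ℝ => (p, θ)) (by fun_prop) fun θ => ⟨hp, trivial⟩
  have hfc' : Continuous fun θ => deriv (fun p => f p θ) p₀ :=
    hdc.comp_continuous (f := fun θ : ℝ => (θ, p₀)) (by fun_prop) fun θ => ⟨trivial, hp⟩
  have := intervalIntegral.hasDerivAt_integral_of_dominated_loc_of_deriv_le
    (μ := MeasureTheory.volume) (F := f) (F' := fun p θ => deriv (fun p => f p θ) p) (x₀ := p₀)
    (s := Metric.ball p₀ r) (bound := fun _ => C) (a := a) (b := b)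
    (Metric.ball_mem_nhds p₀ hr)
    (by filter_upwards [hΩ.mem_nhds hp] with p hp using (hfc p hp).aestronglyMeasurable)
    ((hfc p₀ hp).intervalIntegrable _ _) hfc'.aestronglyMeasurable
    (.of_forall fun θ hθ p hp => hC (θ, p) ⟨Set.uIoc_subset_uIcc hθ, Metric.ball_subset_closedBall hp⟩)
    intervalIntegrable_const
    (.of_forall fun θ _ p hp => ((hd θ).differentiableAt (hΩ.mem_nhds
      (hsub (Metric.ball_subset_closedBall hp)))).hasDerivAt)
  exact this.2.differentiableAt.differentiableWithinAt

/-- **Osgood's lemma** in two variables. -/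
theorem differentiable_of_continuous_of_separately {f : ℂ → ℂ → ℂ}
    (hc : Continuous (Function.uncurry f)) (h1 : ∀ y, Differentiable ℂ fun x => f x y)
    (h2 : ∀ x, Differentiable ℂ (f x)) : Differentiable ℂ (fun p : ℂ × ℂ => f p.1 p.2) := by
  intro u
  have c2 : Continuous fun v : ℂ × ℂ => deriv (f v.1) v.2 := by
    have := continuousOn_deriv_param isOpen_univ isOpen_univ (f := f) hc.continuousOn
      fun x _ => (h2 x).differentiableOn
    rwa [Set.univ_prod_univ, continuousOn_univ] at this
  have c1 : Continuous fun v : ℂ × ℂ => deriv (fun x => f x v.2) v.1 := by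
    have := continuousOn_deriv_param isOpen_univ isOpen_univ (f := fun y x => f x y)
      (hc.comp continuous_swap).continuousOn fun x _ => (h1 x).differentiableOn
    rw [Set.univ_prod_univ, continuousOn_univ] at this
    exact this.comp continuous_swap
  have := hasStrictFDerivAt_uncurry_coprod (𝕜 := ℂ) (u := u) (f := f)
    (f₁ := fun x y => ContinuousLinearMap.toSpanSingleton ℂ (deriv (fun x => f x y) x))
    (f₂ := fun x y => ContinuousLinearMap.toSpanSingleton ℂ (deriv (f x) y))
    (.of_forall fun v => (h1 v.2 v.1).hasDerivAt.hasFDerivAt)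
    (.of_forall fun v => (h2 v.1 v.2).hasDerivAt.hasFDerivAt)
    (((ContinuousLinearMap.toSpanSingletonCLE (𝕜 := ℂ) (E := ℂ)).continuous.comp c1).continuousAt)
    (((ContinuousLinearMap.toSpanSingletonCLE (𝕜 := ℂ) (E := ℂ)).continuous.comp c2).continuousAt)
  exact this.hasFDerivAt.differentiableAt

/-! ### Recovering an inversion-invariant function from one circle. -/

/-- Cauchy's formula for an annulus, one point inside. -/
theorem circleIntegral_annulus_sub {f : ℂ → ℂ} {r R : ℝ} (hr : 0 < r) {w : ℂ} (h1 : r < ‖w‖)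
    (h2 : ‖w‖ < R) (hf : ∀ z, r ≤ ‖z‖ → ‖z‖ ≤ R → DifferentiableAt ℂ f z) :
    (∮ z in C(0, R), (z - w)⁻¹ * f z) - (∮ z in C(0, r), (z - w)⁻¹ * f z) =
      2 * Real.pi * Complex.I * f w := by
  have hR : 0 < R := hr.trans (h1.trans h2)
  have hfw := hf w h1.le h2.le
  have hcf : ContinuousOn f (Metric.closedBall 0 R \ Metric.ball 0 r) := fun z hz =>
    (hf z (by simpa using hz.2) (by simpa using hz.1)).continuousAt.continuousWithinAt
  -- The difference quotient has a removable singularity at w, so its integrals over the two circles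
  -- coincide. Expanding it leaves the Cauchy integrals and the integrals of 1/(z - w), which are
  -- 2πi on the outer circle and 0 on the inner one.
  have hd : (∮ z in C(0, R), dslope f w z) = ∮ z in C(0, r), dslope f w z := by
    refine Complex.circleIntegral_eq_of_differentiable_on_annulus_off_countable hr
      (h1.trans h2).le (Set.countable_singleton w) ?_ ?_
    · intro z hz
      by_cases hzw : z = w
      · rw [hzw]; exact (continuousAt_dslope_same.2 hfw).continuousWithinAt
      · exact (continuousWithinAt_dslope_of_ne hzw).2 (hcf z hz)
    · rintro z ⟨⟨hz1, hz2⟩, hzw⟩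
      refine (differentiableAt_dslope_of_ne hzw).2 (hf z ?_ ?_)
      · simpa using (not_le.1 (by simpa using hz2 : ¬ ‖z‖ ≤ r)).le
      · simpa using (Metric.mem_ball.1 hz1).le
  have key : ∀ ρ : ℝ, r ≤ ρ → ρ ≤ R → ρ ≠ ‖w‖ → (∮ z in C(0, ρ), dslope f w z) =
      (∮ z in C(0, ρ), (z - w)⁻¹ * f z) - (∮ z in C(0, ρ), (z - w)⁻¹) * f w := by
    intro ρ hρ1 hρ2 hρw
    have hρ0 : 0 < ρ := hr.trans_le hρ1
    have hne : ∀ z ∈ Metric.sphere (0 : ℂ) ρ, z - w ≠ 0 := fun z hz h => by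
      rw [sub_eq_zero] at h
      rw [h] at hz
      exact hρw (by simpa using hz.symm)
    have hci : ContinuousOn (fun z : ℂ => (z - w)⁻¹) (Metric.sphere 0 ρ) :=
      ContinuousOn.inv₀ (by fun_prop) hne
    have hcs : ContinuousOn f (Metric.sphere 0 ρ) := hcf.mono fun z hz => by
      have : ‖z‖ = ρ := by simpa using hz
      simp [this, hρ1, hρ2]
    have i1 : CircleIntegrable (fun z => (z - w)⁻¹ * f z) 0 ρ :=
      ContinuousOn.circleIntegrable hρ0.le (hci.mul hcs)
    have i2 : CircleIntegrable (fun z => f w * (z - w)⁻¹) 0 ρ :=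
      ContinuousOn.circleIntegrable hρ0.le (continuousOn_const.mul hci)
    rw [mul_comm, ← circleIntegral.integral_const_mul, ← circleIntegral.integral_sub i1 i2]
    refine circleIntegral.integral_congr hρ0.le fun z hz => ?_
    have hzw : z ≠ w := fun h => hne z hz (sub_eq_zero.2 h)
    simp only [dslope_of_ne f hzw, slope_def_module, smul_eq_mul]
    ring
  rw [key R (h1.trans h2).le le_rfl h2.ne', key r le_rfl (h1.trans h2).le h1.ne] at hd
  rw [circleIntegral.integral_sub_inv_of_mem_ball (by simpa using h2)] at hd
  have h0 : (∮ z in C(0, r), (z - w)⁻¹) = 0 := by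
    refine Complex.circleIntegral_eq_zero_of_differentiable_on_off_countable hr.le
      Set.countable_empty ?_ ?_
    · refine ContinuousOn.inv₀ (by fun_prop) fun z hz h => ?_
      rw [sub_eq_zero] at h
      rw [h] at hz
      have : ‖w‖ ≤ r := by simpa using hz
      linarith
    · intro z hz
      refine DifferentiableAt.inv (by fun_prop) fun h => ?_
      rw [sub_eq_zero] at h
      rw [h] at hz
      have : ‖w‖ < r := by simpa using hz.1
      linarith
  rw [h0] at hd
  linear_combination hd

lemma circleIntegral_inv_mul {R : ℝ} (hR : R ≠ 0) (g : ℂ → ℂ) :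
    (∮ z in C(0, R), z⁻¹ * g z) = Complex.I * ∫ θ in (0 : ℝ)..2 * Real.pi, g (circleMap 0 R θ) := by
  rw [circleIntegral, ← intervalIntegral.integral_const_mul]
  refine intervalIntegral.integral_congr fun θ _ => ?_
  have h0 : circleMap 0 R θ ≠ 0 := circleMap_ne_center hR
  simp only [deriv_circleMap, smul_eq_mul]
  field_simp

/-- The inversion `z ↦ Rr / z` exchanges the circles of radii `R` and `r`. -/
lemma circleIntegral_inv_mul_inversion {R r : ℝ} (hR : R ≠ 0) (hr : r ≠ 0) (g : ℂ → ℂ) :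
    (∮ z in C(0, R), z⁻¹ * g z) = ∮ z in C(0, r), z⁻¹ * g (R * r / z) := by
  rw [circleIntegral_inv_mul hR, circleIntegral_inv_mul hr]
  congr 1
  have h := intervalIntegral.integral_comp_sub_left (a := 0) (b := 2 * Real.pi)
    (fun θ => g (circleMap 0 R θ)) (2 * Real.pi)
  simp only [sub_self, sub_zero] at h
  rw [← h]
  refine intervalIntegral.integral_congr fun θ _ => ?_
  have hr' : (r : ℂ) ≠ 0 := by exact_mod_cast hr
  simp only [circleMap, zero_add]
  congr 1
  have e : Complex.exp (((2 * Real.pi - θ : ℝ) : ℂ) * Complex.I) =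
      (Complex.exp (θ * Complex.I))⁻¹ := by
    rw [← Complex.exp_neg]
    push_cast
    rw [sub_mul, sub_eq_add_neg, add_comm, Complex.exp_add, Complex.exp_two_pi_mul_I, mul_one]
  rw [e]
  field_simp

/-- The average of `U(z)(1 - z²)/(1 - 2xz + z²)` over the circle of radius `ρ`. -/
noncomputable def chebAverage (ρ : ℝ) (U : ℂ → ℂ) (x : ℂ) : ℂ :=
  (2 * Real.pi : ℂ)⁻¹ * ∫ θ in (0 : ℝ)..2 * Real.pi, U (circleMap 0 ρ θ) *
    ((1 - circleMap 0 ρ θ ^ 2) / (1 - 2 * x * circleMap 0 ρ θ + circleMap 0 ρ θ ^ 2))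

/-- A function on `ℂ \ {0}` invariant under inversion is recovered from its values on a circle. -/
theorem chebAverage_eq {U : ℂ → ℂ} (hU : ∀ z, z ≠ 0 → DifferentiableAt ℂ U z)
    (hinv : ∀ z, z ≠ 0 → U (1 / z) = U z) {ρ : ℝ} (hρ : 0 < ρ) {y : ℂ} (h1 : ρ < ‖y‖)
    (h2 : ρ < ‖1 / y‖) : chebAverage ρ U ((y + 1 / y) / 2) = U y := by
  have hy0 : y ≠ 0 := norm_pos_iff.1 (hρ.trans h1)
  have h3 : ‖y‖ < 1 / ρ := by
    rw [norm_div, norm_one, lt_div_iff₀ (norm_pos_iff.2 hy0)] at h2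
    rw [lt_div_iff₀ hρ]; linarith
  have h4 : ‖1 / y‖ < 1 / ρ := by
    rw [norm_div, norm_one]
    exact one_div_lt_one_div_of_lt hρ h1
  have hd : ∀ z, ρ ≤ ‖z‖ → ‖z‖ ≤ 1 / ρ → DifferentiableAt ℂ U z := fun z hz _ =>
    hU z (norm_pos_iff.1 (hρ.trans_le hz))
  have hR : 0 < 1 / ρ := by positivity
  have a1 := circleIntegral_annulus_sub hρ h1 h3 hd
  have a2 := circleIntegral_annulus_sub hρ h2 h4 hd
  rw [hinv y hy0] at a2
  have a3 : (∮ z in C(0, 1 / ρ), z⁻¹ * U z) = ∮ z in C(0, ρ), z⁻¹ * U z := by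
    rw [circleIntegral_inv_mul_inversion hR.ne' hρ.ne']
    refine circleIntegral.integral_congr hρ.le fun z hz => ?_
    have hz0 : z ≠ 0 := by
      rintro rfl
      simp at hz; linarith
    have : ((1 / ρ : ℝ) : ℂ) * ρ / z = 1 / z := by
      have : (ρ : ℂ) ≠ 0 := by exact_mod_cast hρ.ne'
      push_cast; field_simp
    simp only [this, hinv z hz0]
  set k : ℂ → ℂ := fun z => (1 - z ^ 2) / (1 - 2 * ((y + 1 / y) / 2) * z + z ^ 2)
  have hk : ∀ z, z ≠ 0 → k (1 / z) = -k z := fun z hz => by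
    have e : 1 - 2 * ((y + 1 / y) / 2) * (1 / z) + (1 / z) ^ 2 =
        (1 - 2 * ((y + 1 / y) / 2) * z + z ^ 2) / z ^ 2 := by field_simp; ring
    simp only [k, e]
    rw [show 1 - (1 / z) ^ 2 = -(1 - z ^ 2) / z ^ 2 by field_simp; ring,
      div_div_div_cancel_right₀ (pow_ne_zero 2 hz), neg_div]
  -- Partial fractions: (1 - z²)/(z(z - y)(z - 1/y)) = 1/z - 1/(z - y) - 1/(z - 1/y).
  have split : ∀ R : ℝ, 0 < R → R ≠ ‖y‖ → R ≠ ‖1 / y‖ →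
      (∮ z in C(0, R), z⁻¹ * (U z * k z)) = (∮ z in C(0, R), z⁻¹ * U z) -
        (∮ z in C(0, R), (z - y)⁻¹ * U z) - ∮ z in C(0, R), (z - 1 / y)⁻¹ * U z := by
    intro R hR0 hR1 hR2
    have n0 : ∀ z ∈ Metric.sphere (0 : ℂ) R, z ≠ 0 := fun z hz h => by
      rw [h] at hz; simp at hz; linarith
    have n1 : ∀ z ∈ Metric.sphere (0 : ℂ) R, z - y ≠ 0 := fun z hz h => by
      rw [sub_eq_zero] at h; rw [h] at hz; exact hR1 (by simpa using hz.symm)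
    have n2 : ∀ z ∈ Metric.sphere (0 : ℂ) R, z - 1 / y ≠ 0 := fun z hz h => by
      rw [sub_eq_zero] at h; rw [h] at hz; exact hR2 (by simpa using hz.symm)
    have hUc : ContinuousOn U (Metric.sphere 0 R) := fun z hz =>
      (hU z (n0 z hz)).continuousAt.continuousWithinAt
    have i0 : CircleIntegrable (fun z => z⁻¹ * U z) 0 R :=
      ContinuousOn.circleIntegrable hR0.le ((continuousOn_id.inv₀ n0).mul hUc)
    have i1 : CircleIntegrable (fun z => (z - y)⁻¹ * U z) 0 R :=
      ContinuousOn.circleIntegrable hR0.le ((ContinuousOn.inv₀ (by fun_prop) n1).mul hUc)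
    have i2 : CircleIntegrable (fun z => (z - 1 / y)⁻¹ * U z) 0 R :=
      ContinuousOn.circleIntegrable hR0.le ((ContinuousOn.inv₀ (by fun_prop) n2).mul hUc)
    have i01 : CircleIntegrable (fun z => z⁻¹ * U z - (z - y)⁻¹ * U z) 0 R := i0.sub i1
    rw [← circleIntegral.integral_sub i0 i1, ← circleIntegral.integral_sub i01 i2]
    refine circleIntegral.integral_congr hR0.le fun z hz => ?_
    have m0 := n0 z hz
    have m1 := n1 z hz
    have m2 := n2 z hz
    have e : 1 - 2 * ((y + 1 / y) / 2) * z + z ^ 2 = (z - y) * (z - 1 / y) := by field_simp; ring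
    simp only [k, e]
    obtain ⟨u, hu⟩ : ∃ u, u = z - y := ⟨_, rfl⟩
    obtain ⟨v, hv⟩ : ∃ v, v = z - 1 / y := ⟨_, rfl⟩
    rw [← hu] at m1 ⊢
    rw [← hv] at m2 ⊢
    field_simp
    rw [hu, hv]
    field_simp
    ring
  have s1 := split ρ hρ h1.ne h2.ne
  have s2 := split (1 / ρ) hR h3.ne' h4.ne'
  -- Under inversion the kernel is odd and U is even, so the integrals over the radii ρ and 1/ρ are
  -- opposite. Their difference is given by the residues at y and 1/y, which both carry the value U
  -- y.
  have a4 : (∮ z in C(0, 1 / ρ), z⁻¹ * (U z * k z)) = -∮ z in C(0, ρ), z⁻¹ * (U z * k z) := by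
    rw [circleIntegral_inv_mul_inversion hR.ne' hρ.ne' (fun z => U z * k z), ← neg_one_mul,
      ← circleIntegral.integral_const_mul]
    refine circleIntegral.integral_congr hρ.le fun z hz => ?_
    have hz0 : z ≠ 0 := by
      rintro rfl
      simp at hz; linarith
    have : ((1 / ρ : ℝ) : ℂ) * ρ / z = 1 / z := by
      have : (ρ : ℂ) ≠ 0 := by exact_mod_cast hρ.ne'
      push_cast; field_simp
    simp only [this, hinv z hz0, hk z hz0]
    ring
  rw [s1, s2] at a4
  have final : (∮ z in C(0, ρ), z⁻¹ * (U z * k z)) = 2 * Real.pi * Complex.I * U y := by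
    rw [s1]
    linear_combination (1 / 2 : ℂ) * (a4 + a1 + a2 - a3)
  rw [circleIntegral_inv_mul hρ.ne'] at final
  have hI := Complex.I_ne_zero
  have hpi : (Real.pi : ℂ) ≠ 0 := by exact_mod_cast Real.pi_ne_zero
  rw [chebAverage]
  have f2 : ∫ θ in (0 : ℝ)..2 * Real.pi, U (circleMap 0 ρ θ) * k (circleMap 0 ρ θ) =
      2 * Real.pi * U y := mul_left_cancel₀ hI (by rw [final]; ring)
  rw [f2]
  field_simp

/-! ### Reduction of functions invariant under inversion -/

/-- The inequality relating x and ρ forces both roots y, 1/y of 1 - 2xz + z² to lie outside the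
circle; the same condition recurs below for this reason. -/
lemma cheb_denominator_ne_zero {ρ : ℝ} (hρ : 0 < ρ) {x : ℂ} (hx : 2 * ‖x‖ + 1 < 1 / ρ) (θ : ℝ) :
    1 - 2 * x * circleMap 0 ρ θ + circleMap 0 ρ θ ^ 2 ≠ 0 := by
  intro h
  have hn : ‖circleMap 0 ρ θ‖ = ρ := by simp [abs_of_pos hρ]
  have h1 : (1 : ℂ) = 2 * x * circleMap 0 ρ θ - circleMap 0 ρ θ ^ 2 := by linear_combination h
  have h2 : (1 : ℝ) ≤ 2 * ‖x‖ * ρ + ρ ^ 2 := by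
    calc (1 : ℝ) = ‖(1 : ℂ)‖ := by simp
      _ = ‖2 * x * circleMap 0 ρ θ - circleMap 0 ρ θ ^ 2‖ := by rw [← h1]
      _ ≤ ‖2 * x * circleMap 0 ρ θ‖ + ‖circleMap 0 ρ θ ^ 2‖ := norm_sub_le _ _
      _ = _ := by rw [norm_mul, norm_mul, norm_pow, hn]; simp
  rw [lt_div_iff₀ hρ] at hx
  have hρ1 : ρ < 1 := by nlinarith [norm_nonneg x]
  nlinarith

lemma continuousOn_chebAverage {X : Type*} [TopologicalSpace X] {S : Set X} {U : X → ℂ → ℂ}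
    {ρ : ℝ} (hρ : 0 < ρ)
    (hU : ContinuousOn (Function.uncurry U) (S ×ˢ Metric.sphere 0 ρ)) :
    ContinuousOn (fun v : X × ℂ => chebAverage ρ (U v.1) v.2)
      (S ×ˢ {x | 2 * ‖x‖ + 1 < 1 / ρ}) := by
  unfold chebAverage
  refine continuousOn_const.mul (continuousOn_intervalIntegral ?_ _ _)
  have hcm : Continuous fun w : (X × ℂ) × ℝ => circleMap 0 ρ w.2 := by unfold circleMap; fun_prop
  refine ContinuousOn.mul ?_ (ContinuousOn.div ?_ ?_ fun w hw =>
    cheb_denominator_ne_zero hρ hw.1.2 w.2)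
  · have h : Continuous fun w : (X × ℂ) × ℝ => (w.1.1, circleMap 0 ρ w.2) := by fun_prop
    exact hU.comp h.continuousOn fun w hw => ⟨hw.1.1, circleMap_mem_sphere _ hρ.le _⟩
  · fun_prop
  · fun_prop

lemma isOpen_cheb_region (ρ : ℝ) : IsOpen {x : ℂ | 2 * ‖x‖ + 1 < 1 / ρ} :=
  isOpen_lt (by fun_prop) (by fun_prop)

lemma differentiableOn_chebAverage {U : ℂ → ℂ} {ρ : ℝ} (hρ : 0 < ρ)
    (hU : ContinuousOn U (Metric.sphere 0 ρ)) :
    DifferentiableOn ℂ (chebAverage ρ U) {x | 2 * ‖x‖ + 1 < 1 / ρ} := by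
  unfold chebAverage
  refine (differentiableOn_intervalIntegral (isOpen_cheb_region ρ) ?_ ?_ _ _).const_mul _
  · have hcm : Continuous fun w : ℂ × ℝ => circleMap 0 ρ w.2 := by unfold circleMap; fun_prop
    refine ContinuousOn.mul ?_ (ContinuousOn.div ?_ ?_ fun w hw =>
      cheb_denominator_ne_zero hρ hw.1 w.2)
    · exact hU.comp hcm.continuousOn fun w hw => circleMap_mem_sphere _ hρ.le _
    · fun_prop
    · fun_prop
  · intro θ
    refine DifferentiableOn.const_mul (DifferentiableOn.div (by fun_prop) (by fun_prop)
      fun x hx => cheb_denominator_ne_zero hρ hx θ) _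

lemma differentiableOn_chebAverage_param {Ω : Set ℂ} (hΩ : IsOpen Ω) {U : ℂ → ℂ → ℂ} {ρ : ℝ}
    (hρ : 0 < ρ) (hU : ContinuousOn (Function.uncurry U) (Ω ×ˢ Metric.sphere 0 ρ))
    (hd : ∀ z ∈ Metric.sphere (0 : ℂ) ρ, DifferentiableOn ℂ (fun p => U p z) Ω) {x : ℂ}
    (hx : 2 * ‖x‖ + 1 < 1 / ρ) : DifferentiableOn ℂ (fun p => chebAverage ρ (U p) x) Ω := by
  unfold chebAverage
  refine (differentiableOn_intervalIntegral hΩ ?_ ?_ _ _).const_mul _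
  · have hcm : Continuous fun w : ℂ × ℝ => circleMap 0 ρ w.2 := by unfold circleMap; fun_prop
    refine ContinuousOn.mul ?_ (ContinuousOn.div ?_ ?_ fun w hw =>
      cheb_denominator_ne_zero hρ hx w.2)
    · have h : Continuous fun w : ℂ × ℝ => (w.1, circleMap 0 ρ w.2) := by fun_prop
      exact hU.comp h.continuousOn fun w hw => ⟨hw.1, circleMap_mem_sphere _ hρ.le _⟩
    · fun_prop
    · fun_prop
  · intro θ
    exact (hd _ (circleMap_mem_sphere _ hρ.le _)).mul_const _

lemma exists_joukowski (x : ℂ) : ∃ y : ℂ, y ≠ 0 ∧ (y + 1 / y) / 2 = x := by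
  obtain ⟨w, hw⟩ := IsAlgClosed.exists_pow_nat_eq (x ^ 2 - 1) (n := 2) (by norm_num)
  have h0 : x + w ≠ 0 := fun h => by
    have : (x + w) * (x - w) = 1 := by linear_combination -hw
    rw [h] at this; simp at this
  refine ⟨x + w, h0, ?_⟩
  field_simp
  linear_combination hw

lemma lt_norm_of_joukowski {ρ : ℝ} (hρ : 0 < ρ) {y : ℂ} (hy : y ≠ 0)
    (hx : 2 * ‖(y + 1 / y) / 2‖ + 1 < 1 / ρ) : ρ < ‖y‖ := by
  by_contra! h
  have hy' : 0 < ‖y‖ := norm_pos_iff.2 hy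
  have h1 : 1 / ρ ≤ ‖1 / y‖ := by
    rw [norm_div, norm_one]; exact one_div_le_one_div_of_le hy' h
  have h2 : ‖1 / y‖ ≤ ‖y + 1 / y‖ + ‖y‖ := by
    calc ‖1 / y‖ = ‖(y + 1 / y) - y‖ := by congr 1; ring
      _ ≤ _ := norm_sub_le _ _
  have h3 : 2 * ‖(y + 1 / y) / 2‖ = ‖y + 1 / y‖ := by
    rw [norm_div]; simp; ring
  rw [h3] at hx
  have h4 : 1 < 1 / ρ := by linarith [norm_nonneg (y + 1 / y)]
  have h5 : ρ < 1 := by rw [lt_div_iff₀ hρ] at h4; linarith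
  linarith

lemma chebAverage_eq' {U : ℂ → ℂ} (hU : ∀ z, z ≠ 0 → DifferentiableAt ℂ U z)
    (hinv : ∀ z, z ≠ 0 → U (1 / z) = U z) {ρ : ℝ} (hρ : 0 < ρ) {y : ℂ} (hy : y ≠ 0)
    (hx : 2 * ‖(y + 1 / y) / 2‖ + 1 < 1 / ρ) : chebAverage ρ U ((y + 1 / y) / 2) = U y :=
  chebAverage_eq hU hinv hρ (lt_norm_of_joukowski hρ hy hx)
    (lt_norm_of_joukowski hρ (one_div_ne_zero hy) (by rwa [one_div_one_div, add_comm (1 / y)]))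

lemma exists_radius (x : ℝ) (hx : 0 ≤ x) : ∃ ρ : ℝ, 0 < ρ ∧ x < 1 / ρ :=
  ⟨1 / (x + 1), by positivity, by rw [one_div_one_div]; linarith⟩

/-- A function invariant under inversion in its first variable is a function of `(y + 1/y)/2`. -/
theorem exists_factor_of_inversion_invariant {G : ℂ → ℂ → ℂ}
    (hc : ContinuousOn (Function.uncurry G) ({0}ᶜ ×ˢ Set.univ))
    (h1 : ∀ x z, z ≠ 0 → DifferentiableAt ℂ (fun z => G z x) z)
    (h2 : ∀ z, z ≠ 0 → Differentiable ℂ (G z)) (hinv : ∀ x z, z ≠ 0 → G (1 / z) x = G z x) :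
    ∃ H : ℂ → ℂ → ℂ, Differentiable ℂ (fun p : ℂ × ℂ => H p.1 p.2) ∧
      ∀ y x, y ≠ 0 → H ((y + 1 / y) / 2) x = G y x := by
  -- The choice r of preimages need not be continuous. Regularity comes from `key`, which locally
  -- expresses G (r L) as an average that is holomorphic in L.
  choose r hr0 hr using exists_joukowski
  have key : ∀ ρ > 0, ∀ L x, 2 * ‖L‖ + 1 < 1 / ρ → G (r L) x = chebAverage ρ (fun z => G z x) L := by
    intro ρ hρ L x hL
    conv_rhs => rw [← hr L]
    exact (chebAverage_eq' (h1 x) (hinv x) hρ (hr0 L) (by rwa [hr])).symm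
  have hsph : ∀ ρ : ℝ, 0 < ρ → Metric.sphere (0 : ℂ) ρ ⊆ {0}ᶜ := fun ρ hρ z hz h => by
    rw [Set.mem_singleton_iff.1 h] at hz; simp at hz; linarith
  refine ⟨fun L x => G (r L) x, ?_, ?_⟩
  · refine differentiable_of_continuous_of_separately ?_ ?_ (fun L => h2 _ (hr0 L))
    · rw [continuous_iff_continuousAt]
      rintro ⟨L₀, x₀⟩
      obtain ⟨ρ, hρ, hL⟩ := exists_radius (2 * ‖L₀‖ + 1) (by positivity)
      have hcont := continuousOn_chebAverage (S := Set.univ) (U := fun x z => G z x) hρ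
        (hc.comp (f := Prod.swap) continuous_swap.continuousOn
          fun v hv => ⟨hsph ρ hρ hv.2, trivial⟩)
      have hcont2 : ContinuousOn (fun v : ℂ × ℂ => G (r v.1) v.2)
          ({x | 2 * ‖x‖ + 1 < 1 / ρ} ×ˢ Set.univ) :=
        (hcont.comp (f := Prod.swap) continuous_swap.continuousOn
          fun v hv => ⟨trivial, hv.1⟩).congr fun v hv => key ρ hρ _ _ hv.1
      exact hcont2.continuousAt (((isOpen_cheb_region ρ).prod isOpen_univ).mem_nhds ⟨hL, trivial⟩)
    · intro x L₀
      obtain ⟨ρ, hρ, hL⟩ := exists_radius (2 * ‖L₀‖ + 1) (by positivity)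
      have hd := differentiableOn_chebAverage (U := fun z => G z x) hρ fun z hz =>
        (h1 x z (hsph ρ hρ hz)).continuousAt.continuousWithinAt
      exact (hd.congr fun L hL => key ρ hρ L x hL).differentiableAt
        ((isOpen_cheb_region ρ).mem_nhds hL)
  · intro y x hy
    obtain ⟨ρ, hρ, hL⟩ := exists_radius (2 * ‖(y + 1 / y) / 2‖ + 1) (by positivity)
    show G (r ((y + 1 / y) / 2)) x = G y x
    rw [key ρ hρ _ x hL, chebAverage_eq' (h1 x) (hinv x) hρ hy hL]

/-! ### The continuation in the variables `s = q^ν` and `x` -/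

lemma qPochHom_eq (z u q : ℂ) (k : ℕ) : qPochHom z (z * u) q k = z ^ k * qPoch u q k := by
  rw [qPochHom, qPoch, ← Finset.card_range k, ← Finset.prod_const, Finset.card_range,
    ← Finset.prod_mul_distrib]
  exact Finset.prod_congr rfl fun j _ => by ring

/-- The homogeneous product hides a fifth upper parameter w/z, since z^k (v; q)_k is the product for
w = zv. The series is symmetric in it and the fourth parameter. -/
lemma wpSum_exchange (q A b₀ b₁ b₂ u v z : ℂ) (g : Fin 5 → ℂ) :
    wpSum q A ![b₀, b₁, b₂, u] g z (z * v) = wpSum q A ![b₀, b₁, b₂, v] g z (z * u) := by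
  refine tsum_congr fun k => ?_
  simp only [wpTerm, qPochHom_eq, Fin.prod_univ_four, Matrix.cons_val]
  generalize ∏ i, qPochInf (g i * q ^ k) q = P
  generalize qPoch u q k = U
  generalize qPoch v q k = U'
  ring

lemma wpSum_swap_lower (q A g₀ g₁ g₂ g₃ g₄ z w : ℂ) (b : Fin 4 → ℂ) :
    wpSum q A b ![g₀, g₁, g₂, g₃, g₄] z w = wpSum q A b ![g₀, g₁, g₂, g₄, g₃] z w := by
  refine tsum_congr fun k => ?_
  simp only [wpTerm, Fin.prod_univ_five, Matrix.cons_val]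
  rw [mul_right_comm (_ * _ * _) (qPochInf (g₃ * q ^ k) q)]

lemma wpSum_swap_lower' (q A g₀ g₁ g₂ g₃ g₄ z w : ℂ) (b : Fin 4 → ℂ) :
    wpSum q A b ![g₀, g₁, g₂, g₃, g₄] z w = wpSum q A b ![g₀, g₁, g₃, g₂, g₄] z w := by
  refine tsum_congr fun k => ?_
  simp only [wpTerm, Fin.prod_univ_five, Matrix.cons_val]
  rw [mul_right_comm (_ * _) (qPochInf (g₂ * q ^ k) q)]

lemma wpSum_swap_upper (q A b₀ b₁ b₂ b₃ z w : ℂ) (g : Fin 5 → ℂ) :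
    wpSum q A ![b₀, b₁, b₂, b₃] g z w = wpSum q A ![b₀, b₁, b₃, b₂] g z w := by
  refine tsum_congr fun k => ?_
  simp only [wpTerm, Fin.prod_univ_four, Matrix.cons_val]
  rw [mul_right_comm (_ * _) (qPoch b₂ q k)]

/-- The involution exchanges the upper parameters abs and q/(cds), one visible and one hidden in the
homogeneous product, and the lower parameters q/(dsy) and abcs/y. -/
lemma awSeries'_symm {q a b c d s y : ℂ} (hq0 : q ≠ 0) (ha : a ≠ 0) (hb : b ≠ 0) (hc : c ≠ 0)
    (hd : d ≠ 0) (hs : s ≠ 0) :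
    awSeries' q a b c d (q / (a * b * c * d * s)) y = awSeries' q a b c d s y := by
  have e1 : q * y / (d * (q / (a * b * c * d * s))) = c * y * (a * b * s) := by field_simp
  have e2 : q * y / (d * s) = c * y * (q / (c * d * s)) := by field_simp
  have e3 : a * b * (q / (a * b * c * d * s)) = q / (c * d * s) := by field_simp
  have e4 : q / (d * (q / (a * b * c * d * s)) * y) = a * b * c * s / y := by field_simp
  have e5 : a * b * c * (q / (a * b * c * d * s)) / y = q / (d * s * y) := by field_simp
  rw [awSeries', awSeries', e1, e2, e3, e4, e5, wpSum_exchange, wpSum_swap_lower]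

/-- Inversion only permutes the parameters: ay with a/y, and q/(dsy) with qy/(ds). -/
lemma awSeries_inv {q a b c d s y : ℂ} :
    awSeries q a b c d s (1 / y) = awSeries q a b c d s y := by
  have e1 : q / (d * s * (1 / y)) = q * y / (d * s) := by
    rw [mul_one_div, div_div_eq_mul_div]
  have e2 : q * (1 / y) / (d * s) = q / (d * s * y) := by
    rw [mul_one_div, div_div, mul_comm y]
  have e3 : a / (1 / y) = a * y := by rw [div_div_eq_mul_div, div_one]
  rw [awSeries, awSeries, e1, e2, e3, mul_one_div, wpSum_swap_upper, wpSum_swap_lower']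

lemma isOpen_compl_zero : IsOpen ({0}ᶜ : Set ℂ) := isOpen_compl_singleton

lemma differentiableAt_awSeries {q a b c d s : ℂ} (hq : ‖q‖ < 1) (hd : d ≠ 0) (hs : s ≠ 0)
    (h : ‖b * c * s‖ < 1) {y : ℂ} (hy : y ≠ 0) :
    DifferentiableAt ℂ (awSeries q a b c d s) y := by
  have hD : DifferentiableOn ℂ (awSeries q a b c d s) {0}ᶜ := by
    unfold awSeries
    refine DifferentiableOn.const_mul (differentiableOn_wpSum hq isOpen_compl_zero
      (differentiableOn_const _) (fin4_forall ?_ ?_ ?_ ?_) (fin5_forall ?_ ?_ ?_ ?_ ?_)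
      (differentiableOn_const _) (differentiableOn_const _) (fun _ _ => h)) _ <;>
    · simp only [Matrix.cons_val]
      intro y hy
      have hy0 : y ≠ 0 := hy
      have : d * s * y ≠ 0 := by positivity
      refine DifferentiableAt.differentiableWithinAt ?_
      fun_prop (disch := assumption)
  exact hD.differentiableAt (isOpen_compl_zero.mem_nhds hy)

lemma continuousOn_awSeries' {q a b c d : ℂ} (hq : ‖q‖ < 1) (hd : d ≠ 0) :
    ContinuousOn (fun v : ℂ × ℂ => awSeries' q a b c d v.1 v.2)
      ({0}ᶜ ×ˢ ({0}ᶜ ∩ {y | ‖c * y‖ < 1})) := by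
  have hO : IsOpen (({0}ᶜ : Set ℂ) ×ˢ ({0}ᶜ ∩ {y : ℂ | ‖c * y‖ < 1})) :=
    isOpen_compl_zero.prod (isOpen_compl_zero.inter (isOpen_lt (by fun_prop) (by fun_prop)))
  have hP := continuous_qPochInf hq
  unfold awSeries'
  refine ContinuousOn.mul (by fun_prop) (continuousOn_wpSum hq hO ?_ (fin4_forall ?_ ?_ ?_ ?_)
    (fin5_forall ?_ ?_ ?_ ?_ ?_) ?_ ?_ (fun v hv => hv.2.2)) <;>
  · try simp only [Matrix.cons_val]
    rintro ⟨s, y⟩ ⟨hs, hy, -⟩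
    have hs0 : s ≠ 0 := hs
    have hy0 : y ≠ 0 := hy
    have h1 : d * s * y ≠ 0 := by positivity
    have h2 : d * y ≠ 0 := by positivity
    have h3 : d * s ≠ 0 := by positivity
    refine ContinuousAt.continuousWithinAt ?_
    fun_prop (disch := assumption)

lemma differentiableOn_awSeries' {q a b c d y : ℂ} (hq : ‖q‖ < 1) (hd : d ≠ 0) (hy : y ≠ 0)
    (h : ‖c * y‖ < 1) : DifferentiableOn ℂ (fun s => awSeries' q a b c d s y) {0}ᶜ := by
  unfold awSeries'
  refine DifferentiableOn.const_mul (differentiableOn_wpSum hq isOpen_compl_zero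
    (differentiableOn_const _) (fin4_forall ?_ ?_ ?_ ?_) (fin5_forall ?_ ?_ ?_ ?_ ?_)
    (differentiableOn_const _) ?_ (fun _ _ => h)) _ <;>
  · try simp only [Matrix.cons_val]
    intro s hs
    have hs0 : s ≠ 0 := hs
    have h1 : d * s * y ≠ 0 := by positivity
    have h2 : d * s ≠ 0 := by positivity
    refine DifferentiableAt.differentiableWithinAt ?_
    fun_prop (disch := assumption)

/-- The radii of the circles around zero that avoid the poles of `awSeries' / (ab/(dy); q)_∞`. -/
def GoodRadius (q a b d : ℂ) (ρ : ℝ) : Prop :=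
  0 < ρ ∧ ρ < 1 ∧ ∀ k : ℕ, ‖a * b / d‖ * ‖q‖ ^ k ≠ ρ

lemma exists_goodRadius (q a b d : ℂ) (x : ℝ) (hx : 0 ≤ x) :
    ∃ ρ, GoodRadius q a b d ρ ∧ x < 1 / ρ := by
  have hcount : (Set.range fun k : ℕ => ‖a * b / d‖ * ‖q‖ ^ k).Countable := Set.countable_range _
  obtain ⟨ρ, hρ1, hρ2⟩ := (hcount.dense_compl ℝ).exists_mem_open (isOpen_Ioo (a := (0 : ℝ))
    (b := 1 / (x + 1))) (Set.nonempty_Ioo.2 (by positivity))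
  have h1 : ρ * (x + 1) < 1 := by
    have := hρ2.2; rwa [lt_div_iff₀ (by positivity)] at this
  refine ⟨ρ, ⟨hρ2.1, ?_, fun k hk => hρ1 ⟨k, hk⟩⟩, ?_⟩
  · nlinarith [hρ2.1]
  · rw [lt_div_iff₀ hρ2.1]; nlinarith [hρ2.1]

section
variable {q : ℝ} (hq0 : 0 < q) (hq1 : q < 1) {a b c d : ℂ} (ha : a ≠ 0) (hb : b ≠ 0) (hc : c ≠ 0)
  (hd : d ≠ 0) (hc1 : ‖c‖ < 1)

lemma norm_ofReal_lt_one {q : ℝ} (hq0 : 0 < q) (hq1 : q < 1) : ‖(q : ℂ)‖ < 1 := by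
  simpa [abs_of_pos hq0] using hq1

/-- The transformed series divided by `(ab/(dy); q)_∞`. -/
noncomputable def awMero' (q a b c d s y : ℂ) : ℂ :=
  awSeries' q a b c d s y / qPochInf (a * b / (d * y)) q

include hd hc1 in
lemma goodRadius_facts {ρ : ℝ} (hρ : GoodRadius q a b d ρ) {z : ℂ}
    (hz : z ∈ Metric.sphere (0 : ℂ) ρ) :
    z ≠ 0 ∧ ‖c * z‖ < 1 ∧ ∀ n : ℕ, a * b / (d * z) * (q : ℂ) ^ n ≠ 1 := by
  have hn : ‖z‖ = ρ := by simpa using hz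
  have hz0 : z ≠ 0 := norm_pos_iff.1 (hn ▸ hρ.1)
  refine ⟨hz0, ?_, fun n h => ?_⟩
  · rw [norm_mul, hn]
    have := hρ.1
    have := hρ.2.1
    nlinarith [norm_nonneg c]
  · have h2 : a * b / d * (q : ℂ) ^ n = z := by
      field_simp at h ⊢
      linear_combination h
    refine hρ.2.2 n ?_
    rw [← hn, ← h2, norm_mul, norm_pow]

include hq0 hq1 hd hc1 in
lemma continuousOn_awMero' {ρ : ℝ} (hρ : GoodRadius q a b d ρ) :
    ContinuousOn (Function.uncurry (awMero' q a b c d)) ({0}ᶜ ×ˢ Metric.sphere 0 ρ) := by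
  have hq := norm_ofReal_lt_one hq0 hq1
  have hP := continuous_qPochInf hq
  have hf := fun z hz => goodRadius_facts hd hc1 hρ (z := z) hz
  refine ContinuousOn.div ((continuousOn_awSeries' hq hd).mono ?_) ?_ ?_
  · exact Set.prod_mono le_rfl fun z hz => ⟨(hf z hz).1, (hf z hz).2.1⟩
  · refine hP.comp_continuousOn ?_
    rintro ⟨s, y⟩ ⟨-, hy⟩
    have hy0 : y ≠ 0 := (hf y hy).1
    have h2 : d * y ≠ 0 := by positivity
    refine ContinuousAt.continuousWithinAt ?_
    fun_prop (disch := assumption)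
  · exact fun v hv => qPochInf_ne_zero hq (hf v.2 hv.2).2.2

include hq0 hq1 hd hc1 in
lemma differentiableOn_awMero' {ρ : ℝ} (hρ : GoodRadius q a b d ρ) {z : ℂ}
    (hz : z ∈ Metric.sphere (0 : ℂ) ρ) :
    DifferentiableOn ℂ (fun s => awMero' q a b c d s z) {0}ᶜ := by
  have hf := goodRadius_facts hd hc1 hρ hz
  exact (differentiableOn_awSeries' (norm_ofReal_lt_one hq0 hq1) hd hf.1 hf.2.1).div_const _

include hq0 hq1 ha hb hd hc1 in
-- On the circle the two series agree, and the first is holomorphic and inversion-invariant on all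
-- of ℂ \ {0}, so the average reproduces it. The left side, however, makes sense for all s ≠ 0.
lemma chebAverage_awMero' {ρ : ℝ} (hρ : GoodRadius q a b d ρ) {s y : ℂ} (hs : s ≠ 0)
    (hbcs : ‖b * c * s‖ < 1) (hA : ∀ n : ℕ, a / (d * s) * (q : ℂ) ^ n ≠ 1) (hy : y ≠ 0)
    (hx : 2 * ‖(y + 1 / y) / 2‖ + 1 < 1 / ρ) :
    chebAverage ρ (awMero' q a b c d s) ((y + 1 / y) / 2) =
      awSeries q a b c d s y / qPochInf (a / (d * s)) q := by
  have hq := norm_ofReal_lt_one hq0 hq1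
  have hqc : (q : ℂ) ≠ 0 := by exact_mod_cast hq0.ne'
  rw [← chebAverage_eq' (U := fun y => awSeries q a b c d s y / qPochInf (a / (d * s)) q)
    (fun z hz => (differentiableAt_awSeries hq hd hs hbcs hz).div_const _)
    (fun z _ => by rw [awSeries_inv]) hρ.1 hy hx]
  unfold chebAverage
  congr 1
  refine intervalIntegral.integral_congr fun θ _ => ?_
  have hf := goodRadius_facts hd hc1 hρ (circleMap_mem_sphere (0 : ℂ) hρ.1.le θ)
  simp only
  rw [awSeries_transformation hq hqc ha hb hd hs hf.1 hA hf.2.2 hbcs hf.2.1, awMero']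

include hq0 ha hd in
/-- The identity theorem in the variable `s = q^ν`, from the region where `awSeries` converges. -/
lemma eq_of_eq_on_convergence_region {F G : ℂ → ℂ} (hF : DifferentiableOn ℂ F {0}ᶜ)
    (hG : DifferentiableOn ℂ G {0}ᶜ)
    (h : ∀ s, s ≠ 0 → ‖b * c * s‖ < 1 → (∀ n : ℕ, a / (d * s) * (q : ℂ) ^ n ≠ 1) → F s = G s)
    {s : ℂ} (hs : s ≠ 0) : F s = G s := by
  have hpre : IsPreconnected ({0}ᶜ : Set ℂ) :=
    (isConnected_compl_singleton_of_one_lt_rank (by simp) 0).isPreconnected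
  -- The excluded values satisfy sd/a = q^n > 0, so the half-plane Re(sd/a) < 0 avoids all of them.
  -- The point -τa/d lies in it, and τ is small enough for |bcs| < 1.
  set τ : ℝ := 1 / (‖b * c * (a / d)‖ + 1)
  have hτ : 0 < τ := by positivity
  set s₀ : ℂ := -(τ * (a / d))
  have hτc : (τ : ℂ) ≠ 0 := by exact_mod_cast hτ.ne'
  have hs₀ : s₀ ≠ 0 := neg_ne_zero.2 (by positivity)
  have hO : IsOpen ({s : ℂ | (s * d / a).re < 0} ∩ {s : ℂ | ‖b * c * s‖ < 1}) :=
    (isOpen_lt (by fun_prop) (by fun_prop)).inter (isOpen_lt (by fun_prop) (by fun_prop))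
  have hmem : s₀ ∈ ({s : ℂ | (s * d / a).re < 0} ∩ {s : ℂ | ‖b * c * s‖ < 1}) := by
    constructor
    · have : s₀ * d / a = ((-τ : ℝ) : ℂ) := by
        simp only [s₀]; push_cast; field_simp
      rw [Set.mem_ofPred_eq, this, Complex.ofReal_re]; linarith
    · have : b * c * s₀ = -(τ * (b * c * (a / d))) := by simp only [s₀]; ring
      rw [Set.mem_ofPred_eq, this, norm_neg, norm_mul, Complex.norm_real,
        Real.norm_of_nonneg hτ.le]
      simp only [τ]
      rw [one_div, inv_mul_lt_one₀ (by positivity)]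
      linarith
  refine (hF.analyticOnNhd isOpen_compl_zero).eqOn_of_preconnected_of_eventuallyEq
    (hG.analyticOnNhd isOpen_compl_zero) hpre hs₀ ?_ hs
  filter_upwards [hO.mem_nhds hmem, isOpen_compl_zero.mem_nhds hs₀] with s ⟨h1, h2⟩ hs
  have hs0 : s ≠ 0 := hs
  refine h s hs0 h2 fun n h => ?_
  have : s * d / a = ((q ^ n : ℝ) : ℂ) := by
    push_cast
    field_simp at h ⊢
    linear_combination -h
  rw [Set.mem_ofPred_eq, this, Complex.ofReal_re] at h1
  have : 0 < q ^ n := by positivity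
  linarith

include hq0 hq1 ha hb hd hc1 in
-- The integrand may have poles in y between the two circles, so the contour is not moved. Both
-- averages are holomorphic in s and equal the first series where it converges, hence they agree for
-- all s ≠ 0.
lemma chebAverage_awMero'_eq {ρ ρ' : ℝ} (hρ : GoodRadius q a b d ρ) (hρ' : GoodRadius q a b d ρ')
    {x : ℂ} (hx : 2 * ‖x‖ + 1 < 1 / ρ) (hx' : 2 * ‖x‖ + 1 < 1 / ρ') {s : ℂ} (hs : s ≠ 0) :
    chebAverage ρ (awMero' q a b c d s) x = chebAverage ρ' (awMero' q a b c d s) x := by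
  have hd1 := differentiableOn_chebAverage_param isOpen_compl_zero hρ.1
    (continuousOn_awMero' (a := a) (b := b) hq0 hq1 hd hc1 hρ)
    (fun z hz => differentiableOn_awMero' hq0 hq1 hd hc1 hρ hz) hx
  have hd2 := differentiableOn_chebAverage_param isOpen_compl_zero hρ'.1
    (continuousOn_awMero' (a := a) (b := b) hq0 hq1 hd hc1 hρ')
    (fun z hz => differentiableOn_awMero' hq0 hq1 hd hc1 hρ' hz) hx'
  refine eq_of_eq_on_convergence_region (b := b) (c := c) hq0 ha hd hd1 hd2
    (fun s hs h2 hA => ?_) hs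
  obtain ⟨y, hy, rfl⟩ := exists_joukowski x
  rw [chebAverage_awMero' hq0 hq1 ha hb hd hc1 hρ hs h2 hA hy hx,
    chebAverage_awMero' hq0 hq1 ha hb hd hc1 hρ' hs h2 hA hy hx']

include hq0 hq1 ha hb hc hd hc1 in
theorem exists_awContinuation : ∃ V : ℂ → ℂ → ℂ,
    ContinuousOn (Function.uncurry V) ({0}ᶜ ×ˢ Set.univ) ∧
    (∀ x, DifferentiableOn ℂ (fun s => V s x) {0}ᶜ) ∧ (∀ s, s ≠ 0 → Differentiable ℂ (V s)) ∧
    (∀ s x, s ≠ 0 → V (q / (a * b * c * d * s)) x = V s x) ∧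
    ∀ s y : ℂ, s ≠ 0 → y ≠ 0 → ‖b * c * s‖ < 1 → (∀ n : ℕ, a / (d * s) * (q : ℂ) ^ n ≠ 1) →
      V s ((y + 1 / y) / 2) = awSeries q a b c d s y / qPochInf (a / (d * s)) q := by
  have hqc : (q : ℂ) ≠ 0 := by exact_mod_cast hq0.ne'
  -- The radius is chosen separately for each x, without regularity. By independence of the radius
  -- it may be frozen at ρ x₀ near x₀, where continuity and holomorphy are those of a single
  -- average.
  choose ρ hρ hx using fun x : ℂ => exists_goodRadius (q : ℂ) a b d (2 * ‖x‖ + 1) (by positivity)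
  have key : ∀ x₀ x s : ℂ, s ≠ 0 → 2 * ‖x‖ + 1 < 1 / ρ x₀ →
      chebAverage (ρ x) (awMero' q a b c d s) x = chebAverage (ρ x₀) (awMero' q a b c d s) x :=
    fun x₀ x s hs hxx => chebAverage_awMero'_eq hq0 hq1 ha hb hd hc1 (hρ x) (hρ x₀) (hx x) hxx hs
  refine ⟨fun s x => chebAverage (ρ x) (awMero' q a b c d s) x, ?_, ?_, ?_, ?_, ?_⟩
  · rintro ⟨s₀, x₀⟩ ⟨hs₀, -⟩
    have h := continuousOn_chebAverage (hρ x₀).1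
      (continuousOn_awMero' (a := a) (b := b) hq0 hq1 hd hc1 (hρ x₀))
    have h' : ContinuousOn (Function.uncurry fun s x => chebAverage (ρ x) (awMero' q a b c d s) x)
        ({0}ᶜ ×ˢ {x | 2 * ‖x‖ + 1 < 1 / ρ x₀}) := h.congr fun v hv => key x₀ v.2 v.1 hv.1 hv.2
    exact (h'.continuousAt ((isOpen_compl_zero.prod (isOpen_cheb_region _)).mem_nhds
      ⟨hs₀, hx x₀⟩)).continuousWithinAt
  · exact fun x => differentiableOn_chebAverage_param isOpen_compl_zero (hρ x).1
      (continuousOn_awMero' (a := a) (b := b) hq0 hq1 hd hc1 (hρ x))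
      (fun z hz => differentiableOn_awMero' hq0 hq1 hd hc1 (hρ x) hz) (hx x)
  · intro s hs x₀
    have hcs : ContinuousOn (awMero' q a b c d s) (Metric.sphere 0 (ρ x₀)) :=
      (continuousOn_awMero' (a := a) (b := b) hq0 hq1 hd hc1 (hρ x₀)).comp
        (f := fun z => (s, z)) (by fun_prop) fun z hz => ⟨hs, hz⟩
    have h := (differentiableOn_chebAverage (hρ x₀).1 hcs).congr
      (fun x hxx => key x₀ x s hs hxx)
    exact h.differentiableAt ((isOpen_cheb_region _).mem_nhds (hx x₀))
  · intro s x hs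
    have e : awMero' q a b c d (q / (a * b * c * d * s)) = awMero' q a b c d s := by
      funext y
      rw [awMero', awMero', awSeries'_symm hqc ha hb hc hd hs]
    show chebAverage _ _ x = chebAverage _ _ x
    rw [e]
  · intro s y hs hy h1 h2
    exact chebAverage_awMero' hq0 hq1 ha hb hd hc1 (hρ _) hs h1 h2 hy (hx _)

end

/-! ### The series `₈φ₇` in terms of `wpSum` -/

/-- The very-well-poised factor: the four products with ±√A combine to (1 - A q^(2n))/(1 - A),
written here without division. -/
lemma qPoch_mul_sqrt {q r A : ℂ} (hr : r ^ 2 = A) (n : ℕ) :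
    qPoch (q * r) q n * qPoch (-(q * r)) q n * (1 - A) =
      qPoch r q n * qPoch (-r) q n * (1 - A * q ^ (2 * n)) := by
  have h1 : (1 - r) * qPoch (q * r) q n = qPoch r q n * (1 - r * q ^ n) := by
    rw [← qPoch_succ, qPoch_succ', mul_comm q r]
  have h2 : (1 - -r) * qPoch (-(q * r)) q n = qPoch (-r) q n * (1 - -r * q ^ n) := by
    rw [← qPoch_succ, qPoch_succ', neg_mul, mul_comm q r]
  have h3 : A * q ^ (2 * n) = (r * q ^ n) ^ 2 := by rw [← hr]; ring
  rw [h3, ← hr]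
  linear_combination ((1 - -r) * qPoch (-(q * r)) q n) * h1 + (qPoch r q n * (1 - r * q ^ n)) * h2

lemma wpTerm_algebra {A T PA S S' R R' Q G₀ G₁ G₂ G₃ G₄ I₀ I₁ I₂ I₃ I₄ B₀ B₁ B₂ B₃ U z : ℂ}
    (hQ : Q ≠ 0) (hR : R ≠ 0) (hR' : R' ≠ 0) (h0 : G₀ ≠ 0) (h1 : G₁ ≠ 0) (h2 : G₂ ≠ 0)
    (h3 : G₃ ≠ 0) (h4 : G₄ ≠ 0) (key : S * S' * (1 - A) = R * R' * (1 - T)) :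
    (1 - A) * (G₀ * I₀ * (G₁ * I₁) * (G₂ * I₂) * (G₃ * I₃) * (G₄ * I₄)) *
      (PA * (S * (S' * (B₀ * (B₁ * (U * (B₂ * B₃)))))) /
        (Q * (R * (R' * (G₀ * (G₁ * (G₄ * (G₃ * G₂))))))) * z) =
    (1 - T) * (PA * Q⁻¹) * (B₀ * B₁ * B₂ * B₃) * (I₀ * I₁ * I₂ * I₃ * I₄) * (z * U) := by
  have e1 : G₀ * I₀ * (G₁ * I₁) * (G₂ * I₂) * (G₃ * I₃) * (G₄ * I₄) =
      (G₀ * G₁ * G₂ * G₃ * G₄) * (I₀ * I₁ * I₂ * I₃ * I₄) := by ring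
  have e2 : PA * (S * (S' * (B₀ * (B₁ * (U * (B₂ * B₃)))))) =
      S * S' * (PA * ((B₀ * B₁ * B₂ * B₃) * U)) := by ring
  have e3 : Q * (R * (R' * (G₀ * (G₁ * (G₄ * (G₃ * G₂)))))) =
      Q * (R * R' * (G₀ * G₁ * G₂ * G₃ * G₄)) := by ring
  have hG : G₀ * G₁ * G₂ * G₃ * G₄ ≠ 0 := by positivity
  have hRR : R * R' ≠ 0 := mul_ne_zero hR hR'
  have hT : 1 - T = S * S' * (1 - A) / (R * R') := by
    rw [key, mul_div_cancel_left₀ _ hRR]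
  rw [hT, e1, e2, e3]
  generalize 1 - A = A'
  generalize G₀ * G₁ * G₂ * G₃ * G₄ = G at *
  generalize R * R' = R₁ at *
  generalize S * S' = S₁
  generalize I₀ * I₁ * I₂ * I₃ * I₄ = I
  generalize B₀ * B₁ * B₂ * B₃ = B
  clear e1 e2 e3 hT key
  field_simp

/-- Multiplication by the infinite products of the lower parameters turns each 1/(g; q)_n into (g
q^n; q)_∞. The upper parameter u goes into the homogeneous product. Only r² = A is used, so the
branch of the square root is irrelevant. -/
lemma basicHypergeometric_eq_wpSum {q A r b₀ b₁ b₂ b₃ u g₀ g₁ g₂ g₃ g₄ z : ℂ} (hq : ‖q‖ < 1)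
    (hr : r ^ 2 = A) (hA : ∀ n : ℕ, A * q ^ n ≠ 1) (h0 : ∀ n : ℕ, g₀ * q ^ n ≠ 1)
    (h1 : ∀ n : ℕ, g₁ * q ^ n ≠ 1) (h2 : ∀ n : ℕ, g₂ * q ^ n ≠ 1) (h3 : ∀ n : ℕ, g₃ * q ^ n ≠ 1)
    (h4 : ∀ n : ℕ, g₄ * q ^ n ≠ 1) :
    (1 - A) * (qPochInf g₀ q * qPochInf g₁ q * qPochInf g₂ q * qPochInf g₃ q * qPochInf g₄ q) *
      basicHypergeometric [A, q * r, -(q * r), b₀, b₁, u, b₂, b₃] [r, -r, g₀, g₁, g₄, g₃, g₂] q z =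
    wpSum q A ![b₀, b₁, b₂, b₃] ![g₀, g₁, g₂, g₃, g₄] z (z * u) := by
  rw [basicHypergeometric, ← tsum_mul_left, wpSum]
  refine tsum_congr fun n => ?_
  have hne : ∀ {g : ℂ}, (∀ n : ℕ, g * q ^ n ≠ 1) → qPoch g q n ≠ 0 := fun h =>
    qPoch_ne_zero fun k _ => h k
  have hA1 : 1 - A ≠ 0 := sub_ne_zero.2 fun h => hA 0 (by rw [← h]; simp)
  have hr1 : qPoch r q n ≠ 0 := qPoch_ne_zero fun k _ h =>
    hA (2 * k) (by rw [← hr, mul_comm 2 k, pow_mul, ← mul_pow, h, one_pow])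
  have hr2 : qPoch (-r) q n ≠ 0 := qPoch_ne_zero fun k _ h =>
    hA (2 * k) (by rw [← hr, mul_comm 2 k, pow_mul, ← mul_pow, ← neg_sq, ← neg_mul, h, one_pow])
  have key := qPoch_mul_sqrt (q := q) hr n
  rw [wpTerm, qPochHom_eq, qPochInf_eq_qPoch_mul hq g₀ n, qPochInf_eq_qPoch_mul hq g₁ n,
    qPochInf_eq_qPoch_mul hq g₂ n, qPochInf_eq_qPoch_mul hq g₃ n, qPochInf_eq_qPoch_mul hq g₄ n]
  simp only [qPochs, List.map_cons, List.map_nil, List.prod_cons, List.prod_nil, mul_one,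
    List.length_cons, List.length_nil, Fin.prod_univ_four, Fin.prod_univ_five, Matrix.cons_val]
  -- The exponent 1 + 7 - 8 of the sign and quadratic-power factor of the series is 0.
  norm_num only [zpow_zero, mul_one]
  exact wpTerm_algebra (hne fun k => mul_pow_ne_one hq k) hr1 hr2 (hne h0) (hne h1) (hne h2)
    (hne h3) (hne h4) key

section
variable {q : ℝ} (hq0 : 0 < q) (hq1 : q < 1) {a b c d : ℂ} (ha0 : a ≠ 0) (hb0 : b ≠ 0)
  (hc0 : c ≠ 0) (hd0 : d ≠ 0) (ha : ‖a‖ < 1) (hb : ‖b‖ < 1) (hc : ‖c‖ < 1) (hd : ‖(q : ℂ) / d‖ < 1)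

lemma mul_pow_ne_one_of_norm_lt_one {q x : ℂ} (hq : ‖q‖ < 1) (hx : ‖x‖ < 1) (n : ℕ) :
    x * q ^ n ≠ 1 := fun h => by
  have h1 := norm_mul_pow_le hq le_rfl n (a := x)
  rw [h, norm_one] at h1
  linarith

lemma norm_mul_lt_one' {x y : ℂ} (hx : ‖x‖ < 1) (hy : ‖y‖ < 1) : ‖x * y‖ < 1 := by
  rw [norm_mul]
  nlinarith [norm_nonneg x, norm_nonneg y]

include hq0 hq1 ha0 hb0 hc0 hd0 ha hb hc hd in
lemma awU_eq {ν z : ℂ} (h : AWRegular q a b c d ν z) :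
    qPochInfs [(q : ℂ) ^ (1 + z) / d, (q : ℂ) ^ (1 - z) / d] q * awU q a b c d ν z =
      awSeries q a b c d ((q : ℂ) ^ ν) ((q : ℂ) ^ z) / qPochInf (a / (d * (q : ℂ) ^ ν)) q /
        (qPochInf (a * b) q * qPochInf (a * c) q * qPochInf (b * c) q) := by
  have hq := norm_ofReal_lt_one hq0 hq1
  have hqc : (q : ℂ) ≠ 0 := by exact_mod_cast hq0.ne'
  have e1 : (q : ℂ) ^ (1 - ν + z) = q * (q : ℂ) ^ z / (q : ℂ) ^ ν := by
    rw [Complex.cpow_add _ _ hqc, Complex.cpow_sub _ _ hqc, Complex.cpow_one]; ring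
  have e2 : (q : ℂ) ^ (1 - ν - z) = q / ((q : ℂ) ^ ν * (q : ℂ) ^ z) := by
    rw [Complex.cpow_sub _ _ hqc, Complex.cpow_sub _ _ hqc, Complex.cpow_one, div_div]
  have e3 : (q : ℂ) ^ (1 - ν) = q / (q : ℂ) ^ ν := by
    rw [Complex.cpow_sub _ _ hqc, Complex.cpow_one]
  have e4 : (q : ℂ) ^ (1 + z) = q * (q : ℂ) ^ z := by
    rw [Complex.cpow_add _ _ hqc, Complex.cpow_one]
  have e5 : (q : ℂ) ^ (1 - z) = q / (q : ℂ) ^ z := by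
    rw [Complex.cpow_sub _ _ hqc, Complex.cpow_one]
  obtain ⟨-, hreg⟩ := h
  have hs : (q : ℂ) ^ ν ≠ 0 := by simp [Complex.cpow_eq_zero_iff, hqc]
  have hy : (q : ℂ) ^ z ≠ 0 := by simp [Complex.cpow_eq_zero_iff, hqc]
  have hA : ∀ n : ℕ, a / (d * (q : ℂ) ^ ν) * (q : ℂ) ^ n ≠ 1 := fun n h => (hreg n).1 (by
    rw [Complex.cpow_sub _ _ hqc, Complex.cpow_natCast, ← h]; field_simp)
  have h4 : ∀ n : ℕ, q * (q : ℂ) ^ z / d * (q : ℂ) ^ n ≠ 1 := fun n h => (hreg n).2.1 (by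
    rw [Complex.cpow_add _ _ hqc, Complex.cpow_add _ _ hqc, Complex.cpow_natCast,
      Complex.cpow_one, ← h]; ring)
  have h5 : ∀ n : ℕ, q / (q : ℂ) ^ z / d * (q : ℂ) ^ n ≠ 1 := fun n h => (hreg n).2.2.1 (by
    rw [Complex.cpow_sub _ _ hqc, Complex.cpow_add _ _ hqc, Complex.cpow_natCast,
      Complex.cpow_one, ← h]; ring)
  have h2 : ∀ n : ℕ, q / (d * (q : ℂ) ^ ν * (q : ℂ) ^ z) * (q : ℂ) ^ n ≠ 1 := fun n h =>
    (hreg n).2.2.2.2 (by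
      rw [Complex.cpow_sub _ _ hqc, Complex.cpow_sub _ _ hqc, Complex.cpow_add _ _ hqc,
        Complex.cpow_natCast, Complex.cpow_one, ← h]; field_simp)
  have h3 : ∀ n : ℕ, q * (q : ℂ) ^ z / (d * (q : ℂ) ^ ν) * (q : ℂ) ^ n ≠ 1 := fun n h =>
    (hreg n).2.2.2.1 (by
      rw [Complex.cpow_add _ _ hqc, Complex.cpow_sub _ _ hqc, Complex.cpow_add _ _ hqc,
        Complex.cpow_natCast, Complex.cpow_one, ← h]; field_simp)
  rw [awU, e1, e2, e3, e4, e5, Complex.cpow_neg, Complex.cpow_neg]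
  generalize (q : ℂ) ^ ν = s at *
  generalize (q : ℂ) ^ z = y at *
  have hqa : ‖(q : ℂ) * a / d‖ < 1 := by
    rw [mul_div_right_comm]; exact norm_mul_lt_one' hd ha
  have hab := norm_mul_lt_one' ha hb
  have hac := norm_mul_lt_one' ha hc
  have hbc := norm_mul_lt_one' hb hc
  have hr : ((a / (d * s)) ^ ((1 : ℂ) / 2)) ^ 2 = a / (d * s) := by
    rw [one_div]; exact Complex.cpow_nat_inv_pow _ two_ne_zero
  have hA1 : a / (d * s) ≠ 1 := fun h => hA 0 (by rw [h]; simp)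
  have f1 : a * s⁻¹ / d = a / (d * s) := by field_simp
  have f2 : q / s / (b * d) = q / (b * d * s) := by field_simp
  have f3 : q / s / (c * d) = q / (c * d * s) := by field_simp
  have f4 : q * y / s / d = q * y / (d * s) := by field_simp
  have f5 : q / (s * y) / d = q / (d * s * y) := by field_simp
  have f6 : q / s * a / d = a / (d * s) * q := by field_simp
  have f7 : b * (q : ℂ) / d = b * c * s * (q / (c * d * s)) := by field_simp
  rw [f1, f2, f3, f4, f5, f6, awSeries, f7, mul_comm a (q : ℂ), ← div_eq_mul_inv, one_div s,
    ← basicHypergeometric_eq_wpSum hq hr hA (mul_pow_ne_one_of_norm_lt_one hq hqa)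
      (mul_pow_ne_one_of_norm_lt_one hq hab) h2 h3 (mul_pow_ne_one_of_norm_lt_one hq hac)]
  have n1 := qPochInf_ne_zero hq hA
  rw [qPochInf_eq_mul hq (a / (d * s))] at n1 ⊢
  have n2 := qPochInf_ne_zero hq h4
  have n3 := qPochInf_ne_zero hq h5
  have n4 := qPochInf_ne_zero_of_norm_lt_one hq hab
  have n5 := qPochInf_ne_zero_of_norm_lt_one hq hac
  have n6 := qPochInf_ne_zero_of_norm_lt_one hq hbc
  have n7 := left_ne_zero_of_mul n1
  have n8 := right_ne_zero_of_mul n1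
  simp only [qPochInfs, List.map_cons, List.map_nil, List.prod_cons, List.prod_nil, mul_one]
  generalize basicHypergeometric _ _ _ _ = Φ
  generalize qPochInf (a / (d * s) * q) q = I1 at *
  generalize qPochInf (q * y / d) q = I2 at *
  generalize qPochInf (q / y / d) q = I3 at *
  generalize qPochInf (a * b) q = I4 at *
  generalize qPochInf (a * c) q = I5 at *
  generalize qPochInf (b * c) q = I6 at *
  generalize qPochInf (b * c * s) q = I7 at *
  generalize qPochInf (q * a / d) q = I8 at *
  generalize qPochInf (q / (d * s * y)) q = I9 at *
  generalize qPochInf (q * y / (d * s)) q = I10 at *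
  generalize 1 - a / (d * s) = T at *
  field_simp

end

/-! ### The function `v` as an entire function of `λ` and `x` -/

lemma Differentiable.eq_of_eventuallyEq {f g : ℂ → ℂ} (hf : Differentiable ℂ f)
    (hg : Differentiable ℂ g) {z₀ : ℂ} (h : f =ᶠ[𝓝 z₀] g) : f = g :=
  AnalyticOnNhd.eq_of_eventuallyEq (fun z _ => hf.analyticAt z) (fun z _ => hg.analyticAt z) h

section
variable {q : ℝ} (hq0 : 0 < q) (hq1 : q < 1) {a b c d : ℂ} (ha0 : a ≠ 0) (hb0 : b ≠ 0)
  (hc0 : c ≠ 0) (hd0 : d ≠ 0) (ha : ‖a‖ < 1) (hb : ‖b‖ < 1) (hc : ‖c‖ < 1) (hd : ‖(q : ℂ) / d‖ < 1)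

include hq0 in
lemma exists_cpow_eq {y : ℂ} (hq1 : q < 1) (hy : y ≠ 0) : ∃ z : ℂ, (q : ℂ) ^ z = y := by
  have hqc : (q : ℂ) ≠ 0 := by exact_mod_cast hq0.ne'
  have hlog : Complex.log q ≠ 0 := by
    rw [← Complex.ofReal_log hq0.le]
    exact_mod_cast (Real.log_neg hq0 hq1).ne
  refine ⟨Complex.log y / Complex.log q, ?_⟩
  rw [Complex.cpow_def_of_ne_zero hqc, mul_div_cancel₀ _ hlog, Complex.exp_log hy]

lemma qLattice_eq (q : ℝ) (z : ℂ) : qLattice q z = ((q : ℂ) ^ z + 1 / (q : ℂ) ^ z) / 2 := by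
  rw [qLattice, Complex.cpow_neg, one_div]

include hq0 hq1 in
lemma exists_qLattice_eq (x : ℂ) : ∃ z, qLattice q z = x := by
  obtain ⟨y, hy, rfl⟩ := exists_joukowski x
  obtain ⟨z, rfl⟩ := exists_cpow_eq hq0 hq1 hy
  exact ⟨z, qLattice_eq q z⟩

/-- The factor `4 q^{3/2} / (1 - q)²` of the eigenvalues. -/
noncomputable def awScale (q : ℝ) : ℂ := 4 * (q : ℂ) ^ ((3 : ℂ) / 2) / (1 - (q : ℂ)) ^ 2

include hq0 hq1 in
lemma awScale_ne_zero : awScale q ≠ 0 := by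
  have hqc : (q : ℂ) ≠ 0 := by exact_mod_cast hq0.ne'
  have h1 : 1 - (q : ℂ) ≠ 0 := by
    rw [← Complex.ofReal_one, ← Complex.ofReal_sub]; exact_mod_cast (sub_pos.2 hq1).ne'
  have h2 : (q : ℂ) ^ ((3 : ℂ) / 2) ≠ 0 := by simp [Complex.cpow_eq_zero_iff, hqc]
  exact div_ne_zero (mul_ne_zero (by norm_num) h2) (pow_ne_zero _ h1)

include hq0 in
lemma awEigenvalue_eq (ν : ℂ) : awEigenvalue q a b c d ν =
    -(awScale q * awE q a b c d ((q : ℂ) ^ ν)) := by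
  have hqc : (q : ℂ) ≠ 0 := by exact_mod_cast hq0.ne'
  rw [awEigenvalue, awScale, awE, Complex.cpow_neg, Complex.cpow_sub _ _ hqc, Complex.cpow_one,
    one_div]
  ring

include hq0 ha0 hb0 hc0 hd0 in
lemma exists_awE_eq (l : ℂ) : ∃ s, s ≠ 0 ∧ awE q a b c d s = l := by
  have hqc : (q : ℂ) ≠ 0 := by exact_mod_cast hq0.ne'
  -- The number κ is a fixed point of s ↦ q/(abcds). In σ = s/κ the involution is inversion, and the
  -- eigenvalue is affine in (σ + 1/σ)/2.
  obtain ⟨κ, hκ⟩ := IsAlgClosed.exists_pow_nat_eq ((q : ℂ) / (a * b * c * d)) (n := 2) (by norm_num)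
  have hκ0 : κ ≠ 0 := fun h => by
    rw [h] at hκ
    have : (q : ℂ) / (a * b * c * d) ≠ 0 := by positivity
    exact this (by rw [← hκ]; simp)
  have hp : a * b * c * d / q = 1 / κ ^ 2 := by rw [hκ, one_div_div]
  obtain ⟨σ, hσ, h⟩ := exists_joukowski (κ / 2 * (1 + a * b * c * d / q + l))
  refine ⟨κ * σ, mul_ne_zero hκ0 hσ, ?_⟩
  have e : awE q a b c d (κ * σ) = -((1 - 1 / (κ * σ)) * (1 - a * b * c * d / q * (κ * σ))) := by
    rw [awE]; ring
  rw [hp] at h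
  rw [e, hp]
  field_simp at h ⊢
  linear_combination h

include hq0 hq1 ha0 hb0 hc0 hd0 in
lemma exists_awEigenvalue_eq (l : ℂ) : ∃ ν, awEigenvalue q a b c d ν = l := by
  obtain ⟨s, hs, h⟩ := exists_awE_eq hq0 ha0 hb0 hc0 hd0 (-(l / awScale q))
  obtain ⟨ν, rfl⟩ := exists_cpow_eq hq0 hq1 hs
  exact ⟨ν, by rw [awEigenvalue_eq hq0, h, mul_neg, neg_neg,
    mul_div_cancel₀ _ (awScale_ne_zero hq0 hq1)]⟩

include hq0 hq1 ha0 hb0 hc0 hd0 ha hb hc hd in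
/-- The continuation exists, and it solves the difference equation. -/
theorem exists_isAWContinuation : ∃ V : ℂ → ℂ → ℂ, IsAWContinuation q a b c d V ∧
    ∀ l y : ℂ, y ≠ 0 → 1 - y ^ 2 ≠ 0 → 1 - q * y ^ 2 ≠ 0 → y ^ 2 - q ≠ 0 →
      awB q a b c d y * V l ((q * y + 1 / (q * y)) / 2) +
        awB q a b c d (1 / y) * V l ((y / q + 1 / (y / q)) / 2) -
        (awA q a b c d y + awA q a b c d (1 / y) - l / awScale q) * V l ((y + 1 / y) / 2) = 0 := by
  have hq := norm_ofReal_lt_one hq0 hq1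
  have hqc : (q : ℂ) ≠ 0 := by exact_mod_cast hq0.ne'
  obtain ⟨U, hU1, hU2, hU3, hU4, hU5⟩ := exists_awContinuation hq0 hq1 ha0 hb0 hc0 hd0 hc
  obtain ⟨κ, hκ⟩ := IsAlgClosed.exists_pow_nat_eq ((q : ℂ) / (a * b * c * d)) (n := 2) (by norm_num)
  have hκ0 : κ ≠ 0 := fun h => by
    rw [h] at hκ
    have : (q : ℂ) / (a * b * c * d) ≠ 0 := by positivity
    exact this (by rw [← hκ]; simp)
  have hp : a * b * c * d / q = 1 / κ ^ 2 := by rw [hκ, one_div_div]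
  -- In σ = s/κ the symmetry in s becomes invariance under inversion, so the continuation is an
  -- entire function of (σ + 1/σ)/2 and x; the first of these is affine in λ.
  obtain ⟨H, hH1, hH2⟩ := exists_factor_of_inversion_invariant (G := fun σ x => U (κ * σ) x)
    (by
      refine hU1.comp (f := fun v : ℂ × ℂ => (κ * v.1, v.2)) (by fun_prop) ?_
      exact fun v hv => ⟨mul_ne_zero hκ0 hv.1, trivial⟩)
    (fun x z hz => ((hU2 x).differentiableAt (isOpen_compl_zero.mem_nhds
      (mul_ne_zero hκ0 hz))).comp z (f := fun z => κ * z) (by fun_prop))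
    (fun z hz => hU3 _ (mul_ne_zero hκ0 hz))
    (fun x z hz => by
      have : κ * (1 / z) = q / (a * b * c * d * (κ * z)) := by
        rw [← div_div, ← hκ]; field_simp
      rw [this, hU4 _ _ (mul_ne_zero hκ0 hz)])
  set N := qPochInf (a * b) q * qPochInf (a * c) q * qPochInf (b * c) q
  have hC := awScale_ne_zero hq0 hq1
  set V : ℂ → ℂ → ℂ := fun l x => H (κ / 2 * (1 + a * b * c * d / q - l / awScale q)) x / N
  have hV : ∀ s x, s ≠ 0 → V (-(awScale q * awE q a b c d s)) x = U s x / N := by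
    intro s x hs
    have h1 := hH2 (s / κ) x (div_ne_zero hs hκ0)
    have h2 : κ / 2 * (1 + a * b * c * d / q - -(awScale q * awE q a b c d s) / awScale q) =
        (s / κ + 1 / (s / κ)) / 2 := by
      have e : awE q a b c d s = -((1 - 1 / s) * (1 - a * b * c * d / q * s)) := by
        rw [awE]; ring
      rw [e, hp]
      field_simp
      ring
    simp only [V]
    rw [h2, h1, mul_div_cancel₀ _ hκ0]
  refine ⟨V, ⟨?_, ?_⟩, ?_⟩
  · have : Differentiable ℂ fun p : ℂ × ℂ =>
        (κ / 2 * (1 + a * b * c * d / q - p.1 / awScale q), p.2) := by fun_prop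
    have h2 : Differentiable ℂ fun p : ℂ × ℂ =>
        H (κ / 2 * (1 + a * b * c * d / q - p.1 / awScale q)) p.2 := hH1.comp this
    have h3 : Differentiable ℂ fun p : ℂ × ℂ =>
        H (κ / 2 * (1 + a * b * c * d / q - p.1 / awScale q)) p.2 * N⁻¹ := h2.mul_const N⁻¹
    simpa only [V, div_eq_mul_inv] using h3
  · intro ν z h
    have hs : (q : ℂ) ^ ν ≠ 0 := by simp [Complex.cpow_eq_zero_iff, hqc]
    have hy : (q : ℂ) ^ z ≠ 0 := by simp [Complex.cpow_eq_zero_iff, hqc]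
    rw [awU_eq hq0 hq1 ha0 hb0 hc0 hd0 ha hb hc hd h, awEigenvalue_eq hq0, hV _ _ hs,
      qLattice_eq, hU5 _ _ hs hy h.1]
    intro n hn
    refine (h.2 n).1 ?_
    rw [Complex.cpow_sub _ _ hqc, Complex.cpow_natCast, ← hn]; field_simp
  · intro l y hy hy1 hy2 hy3
    obtain ⟨s, hs, hl⟩ := exists_awE_eq hq0 ha0 hb0 hc0 hd0 (-(l / awScale q))
    have hl' : l = -(awScale q * awE q a b c d s) := by rw [hl]; field_simp
    have hUd : ∀ x, DifferentiableOn ℂ (fun s => U s x) {0}ᶜ := hU2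
    -- The equation is known for the convergent series and extends to all s ≠ 0 by the identity
    -- theorem in s, since `awE` is holomorphic there.
    have key := eq_of_eq_on_convergence_region (b := b) (c := c) hq0 ha0 hd0
      (F := fun s => awB q a b c d y * U s ((q * y + 1 / (q * y)) / 2) +
        awB q a b c d (1 / y) * U s ((y / q + 1 / (y / q)) / 2) -
        (awA q a b c d y + awA q a b c d (1 / y) + awE q a b c d s) * U s ((y + 1 / y) / 2))
      (G := fun _ => 0)
      (by
        have hE : DifferentiableOn ℂ (awE q a b c d) {0}ᶜ := by
          unfold awE
          intro s hs
          have hs0 : s ≠ 0 := hs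
          exact DifferentiableAt.differentiableWithinAt (by fun_prop (disch := assumption))
        exact ((((hUd _).const_mul _).add ((hUd _).const_mul _)).sub
          ((hE.const_add _).mul (hUd _)))) (differentiableOn_const _)
      (fun s hs h1 h2 => by
        have hqy : (q : ℂ) * y ≠ 0 := mul_ne_zero hqc hy
        have hyq : y / q ≠ 0 := div_ne_zero hy hqc
        have := awSeries_equation hq hqc ha0 hb0 hd0 hs hy hy1 hy2 hy3 h2 h1
        rw [hU5 _ _ hs hqy h1 h2, hU5 _ _ hs hyq h1 h2, hU5 _ _ hs hy h1 h2]
        rw [← zero_div (qPochInf (a / (d * s)) q), ← this]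
        ring) hs
    have h3 : -(l / awScale q) = awE q a b c d s := hl.symm
    rw [sub_eq_add_neg _ (l / awScale q), h3]
    simp only [hl', hV _ _ hs]
    rw [← zero_div N, ← key]
    ring

/-! ### Uniqueness of the continuation. -/

include hq0 hq1 ha0 hd0 hd in
-- Regularity imposes infinitely many inequations. The ones involving ν forbid certain quantities to
-- equal a positive power of q or 1, so asking that their negatives lie in the slit plane is a
-- single open condition that implies them for all n at once.
lemma exists_open_regular : ∃ ν₀ : ℂ, ∀ᶠ p : ℂ × ℂ in 𝓝 (ν₀, 0), AWRegular q a b c d p.1 p.2 := by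
  have hqc : (q : ℂ) ≠ 0 := by exact_mod_cast hq0.ne'
  have hq := norm_ofReal_lt_one hq0 hq1
  -- With q^ν₀ = -τw/d and z = 0, the quantities to be kept in the slit plane are τw/a and τw.
  -- Either w = 1 works, or 1/a is a nonpositive real and w = i does.
  obtain ⟨w, hw1, hw2⟩ : ∃ w : ℂ, w ∈ Complex.slitPlane ∧ w / a ∈ Complex.slitPlane := by
    by_cases h : 1 / a ∈ Complex.slitPlane
    · exact ⟨1, Complex.one_mem_slitPlane, h⟩
    · refine ⟨Complex.I, by simp [Complex.mem_slitPlane_iff], ?_⟩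
      rw [Complex.mem_slitPlane_iff] at h ⊢
      push Not at h
      obtain ⟨h1, h2⟩ := h
      have h3 : Complex.I / a = Complex.I * (1 / a) := by ring
      right
      rw [h3, Complex.mul_im]
      simp only [Complex.I_re, Complex.I_im, zero_mul, one_mul, zero_add]
      intro h4
      exact one_div_ne_zero ha0 (Complex.ext h4 h2)
  have hw0 : w ≠ 0 := Complex.slitPlane_ne_zero hw1
  set τ : ℝ := 1 / (‖b * c * (w / d)‖ + 1)
  have hτ : 0 < τ := by positivity
  have hτc : (τ : ℂ) ≠ 0 := by exact_mod_cast hτ.ne'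
  obtain ⟨ν₀, hν₀⟩ := exists_cpow_eq hq0 hq1 (y := -(τ * (w / d))) (neg_ne_zero.2 (by positivity))
  refine ⟨ν₀, ?_⟩
  have hpow : Continuous fun z : ℂ => (q : ℂ) ^ z := by
    simp_rw [Complex.cpow_def_of_ne_zero hqc]; fun_prop
  have hc1 : Continuous fun p : ℂ × ℂ => (q : ℂ) ^ p.1 := hpow.comp continuous_fst
  have hc2 : Continuous fun p : ℂ × ℂ => (q : ℂ) ^ p.2 := hpow.comp continuous_snd
  have hc3 : Continuous fun p : ℂ × ℂ => (q : ℂ) ^ (-p.2) := hpow.comp continuous_snd.neg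
  have hslit : ∀ {t : ℂ}, t ∈ Complex.slitPlane → ∀ (r : ℝ), 0 < r → (r : ℂ) * t ∈ Complex.slitPlane := by
    intro t ht r hr
    rw [Complex.mem_slitPlane_iff] at ht ⊢
    simp only [Complex.mul_re, Complex.mul_im, Complex.ofReal_re, Complex.ofReal_im, zero_mul,
      sub_zero, add_zero]
    exact ht.imp (fun h => mul_pos hr h) (fun h => mul_ne_zero hr.ne' h)
  have hneg : ∀ r : ℝ, 0 < r → -(r : ℂ) ∉ Complex.slitPlane := by
    intro r hr h
    rw [Complex.mem_slitPlane_iff] at h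
    simp at h
    linarith
  have E1 : ∀ᶠ p : ℂ × ℂ in 𝓝 (ν₀, 0), ‖b * c * (q : ℂ) ^ p.1‖ < 1 := by
    refine (isOpen_lt (by fun_prop) continuous_const).mem_nhds ?_
    show ‖b * c * (q : ℂ) ^ ν₀‖ < 1
    rw [hν₀]
    have : b * c * -(τ * (w / d)) = -(τ * (b * c * (w / d))) := by ring
    rw [this, norm_neg, norm_mul, Complex.norm_real, Real.norm_of_nonneg hτ.le]
    simp only [τ]
    rw [one_div, inv_mul_lt_one₀ (by positivity)]
    linarith
  have E2 : ∀ᶠ p : ℂ × ℂ in 𝓝 (ν₀, 0), -((q : ℂ) ^ p.1 * d / a) ∈ Complex.slitPlane := by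
    refine (Complex.isOpen_slitPlane.preimage (by fun_prop)).mem_nhds ?_
    show -((q : ℂ) ^ ν₀ * d / a) ∈ Complex.slitPlane
    have : -(-(τ * (w / d)) * d / a) = τ * (w / a) := by field_simp
    rw [hν₀, this]
    exact hslit hw2 _ hτ
  have E3 : ∀ᶠ p : ℂ × ℂ in 𝓝 (ν₀, 0),
      -((q : ℂ) ^ p.1 * d * (q : ℂ) ^ (-p.2)) ∈ Complex.slitPlane := by
    refine (Complex.isOpen_slitPlane.preimage (by fun_prop)).mem_nhds ?_
    show -((q : ℂ) ^ ν₀ * d * (q : ℂ) ^ (-(0 : ℂ))) ∈ Complex.slitPlane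
    have : -(-(τ * (w / d)) * d * 1) = τ * w := by field_simp
    rw [hν₀, neg_zero, Complex.cpow_zero, this]
    exact hslit hw1 _ hτ
  have E4 : ∀ᶠ p : ℂ × ℂ in 𝓝 (ν₀, 0),
      -((q : ℂ) ^ p.1 * d * (q : ℂ) ^ p.2) ∈ Complex.slitPlane := by
    refine (Complex.isOpen_slitPlane.preimage (by fun_prop)).mem_nhds ?_
    show -((q : ℂ) ^ ν₀ * d * (q : ℂ) ^ (0 : ℂ)) ∈ Complex.slitPlane
    have : -(-(τ * (w / d)) * d * 1) = τ * w := by field_simp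
    rw [hν₀, Complex.cpow_zero, this]
    exact hslit hw1 _ hτ
  have E5 : ∀ᶠ p : ℂ × ℂ in 𝓝 (ν₀, 0), ‖(q : ℂ) / d * (q : ℂ) ^ p.2‖ < 1 := by
    refine (isOpen_lt (by fun_prop) continuous_const).mem_nhds ?_
    show ‖(q : ℂ) / d * (q : ℂ) ^ (0 : ℂ)‖ < 1
    simpa using hd
  have E6 : ∀ᶠ p : ℂ × ℂ in 𝓝 (ν₀, 0), ‖(q : ℂ) / d * (q : ℂ) ^ (-p.2)‖ < 1 := by
    refine (isOpen_lt (by fun_prop) continuous_const).mem_nhds ?_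
    show ‖(q : ℂ) / d * (q : ℂ) ^ (-(0 : ℂ))‖ < 1
    simpa using hd
  filter_upwards [E1, E2, E3, E4, E5, E6] with ⟨ν, z⟩ h1 h2 h3 h4 h5 h6
  simp only at h1 h2 h3 h4 h5 h6 ⊢
  have hs : (q : ℂ) ^ ν ≠ 0 := by simp [Complex.cpow_eq_zero_iff, hqc]
  have hy : (q : ℂ) ^ z ≠ 0 := by simp [Complex.cpow_eq_zero_iff, hqc]
  refine ⟨h1, fun n => ⟨fun h => ?_, fun h => ?_, fun h => ?_, fun h => ?_, fun h => ?_⟩⟩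
  · rw [Complex.cpow_sub _ _ hqc, Complex.cpow_natCast] at h
    refine hneg (q ^ n) (by positivity) ?_
    convert h2 using 2
    push_cast
    field_simp at h ⊢
    linear_combination h
  · refine mul_pow_ne_one_of_norm_lt_one hq h5 n ?_
    rw [← h, Complex.cpow_add _ _ hqc, Complex.cpow_add _ _ hqc, Complex.cpow_natCast,
      Complex.cpow_one]
    ring
  · refine mul_pow_ne_one_of_norm_lt_one hq h6 n ?_
    rw [← h, Complex.cpow_sub _ _ hqc, Complex.cpow_add _ _ hqc, Complex.cpow_natCast,
      Complex.cpow_one, Complex.cpow_neg]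
    ring
  · rw [Complex.cpow_add _ _ hqc, Complex.cpow_sub _ _ hqc, Complex.cpow_add _ _ hqc,
      Complex.cpow_natCast, Complex.cpow_one] at h
    refine hneg (q ^ (n + 1)) (by positivity) ?_
    convert h3 using 2
    rw [Complex.cpow_neg]
    push_cast
    field_simp at h ⊢
    linear_combination h
  · rw [Complex.cpow_sub _ _ hqc, Complex.cpow_sub _ _ hqc, Complex.cpow_add _ _ hqc,
      Complex.cpow_natCast, Complex.cpow_one] at h
    refine hneg (q ^ (n + 1)) (by positivity) ?_
    convert h4 using 2
    push_cast
    field_simp at h ⊢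
    linear_combination h

include hq0 hq1 ha0 hb0 hc0 hd0 hd in
-- Two continuations agree for (ν, z) in an open set; the identity theorem, first in z and then in
-- ν, spreads this to all (ν, z), and every pair (λ, x) comes from such a pair.
theorem IsAWContinuation.unique {V V' : ℂ → ℂ → ℂ} (hV : IsAWContinuation q a b c d V)
    (hV' : IsAWContinuation q a b c d V') : V = V' := by
  have hqc : (q : ℂ) ≠ 0 := by exact_mod_cast hq0.ne'
  have hpow : Differentiable ℂ fun z : ℂ => (q : ℂ) ^ z := by
    simp_rw [Complex.cpow_def_of_ne_zero hqc]; fun_prop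
  have hE : Differentiable ℂ (awEigenvalue q a b c d) := by
    have h1 : Differentiable ℂ fun ν : ℂ => (q : ℂ) ^ (-ν) := hpow.comp differentiable_neg
    have h2 : Differentiable ℂ fun ν : ℂ => (q : ℂ) ^ (ν - 1) :=
      hpow.comp (differentiable_id.sub_const 1)
    unfold awEigenvalue
    fun_prop
  have hL : Differentiable ℂ (qLattice q) := by
    have h1 : Differentiable ℂ fun ν : ℂ => (q : ℂ) ^ (-ν) := hpow.comp differentiable_neg
    unfold qLattice
    fun_prop
  obtain ⟨ν₀, hreg⟩ := exists_open_regular (b := b) (c := c) hq0 hq1 ha0 hd0 hd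
  have hev : ∀ᶠ p : ℂ × ℂ in 𝓝 (ν₀, 0), V (awEigenvalue q a b c d p.1) (qLattice q p.2) =
      V' (awEigenvalue q a b c d p.1) (qLattice q p.2) := by
    filter_upwards [hreg] with p hp
    rw [hV.2 _ _ hp, hV'.2 _ _ hp]
  have hd1 : ∀ {V : ℂ → ℂ → ℂ}, IsAWContinuation q a b c d V → ∀ ν, Differentiable ℂ fun z =>
      V (awEigenvalue q a b c d ν) (qLattice q z) := fun hV ν =>
    hV.1.comp (f := fun z => (awEigenvalue q a b c d ν, qLattice q z))
      ((differentiable_const _).prodMk hL)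
  have hd2 : ∀ {V : ℂ → ℂ → ℂ}, IsAWContinuation q a b c d V → ∀ z, Differentiable ℂ fun ν =>
      V (awEigenvalue q a b c d ν) (qLattice q z) := fun hV z =>
    hV.1.comp (f := fun ν => (awEigenvalue q a b c d ν, qLattice q z))
      (hE.prodMk (differentiable_const _))
  have h1 : ∀ᶠ ν in 𝓝 ν₀, ∀ z, V (awEigenvalue q a b c d ν) (qLattice q z) =
      V' (awEigenvalue q a b c d ν) (qLattice q z) := by
    filter_upwards [hev.curry_nhds] with ν hν z
    exact congrFun (Differentiable.eq_of_eventuallyEq (hd1 hV ν) (hd1 hV' ν) hν) z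
  funext l x
  obtain ⟨ν, rfl⟩ := exists_awEigenvalue_eq hq0 hq1 ha0 hb0 hc0 hd0 l
  obtain ⟨z, rfl⟩ := exists_qLattice_eq hq0 hq1 x
  exact congrFun (Differentiable.eq_of_eventuallyEq (hd2 hV z) (hd2 hV' z)
    (h1.mono fun ν hν => hν z)) ν

end

/-! ### The weight and the boundary term -/

/-- `(py, p/y; q)_∞`. -/
noncomputable def qPair (q p y : ℂ) : ℂ := qPochInf (p * y) q * qPochInf (p / y) q

/-- `(pqy, p/y; q)_∞`. -/
noncomputable def qPairShift (q p y : ℂ) : ℂ := qPochInf (p * (q * y)) q * qPochInf (p / y) q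

/-- The weight as a function of `y = e^{iθ}`. -/
noncomputable def awCircleWeight (q a b c d α y : ℂ) : ℂ :=
  qPochInf (y ^ 2) q * qPochInf (1 / y ^ 2) q /
    (qPair q a y * qPair q b y * qPair q c y * qPair q (q / d) y *
      (qPair q α y * qPair q (q / α) y))

/-- The product of the weight, of `awB`, and of `1 - α y`. -/
noncomputable def awKernel (q a b c d α y : ℂ) : ℂ :=
  -(d * y) * (qPochInf (q ^ 2 * y ^ 2) q * qPochInf (1 / y ^ 2) q /
    (qPairShift q a y * qPairShift q b y * qPairShift q c y * qPairShift q (q / d) y *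
      (qPairShift q α y * qPair q (q / α) y)))

/-- The Casoratian of two functions. -/
def casoratian (q : ℂ) (F G : ℂ → ℂ) (y : ℂ) : ℂ := F (q * y) * G y - F y * G (q * y)

lemma qPair_inv (q p y : ℂ) : qPair q p (1 / y) = qPair q p y := by
  rw [qPair, qPair, div_div_eq_mul_div, div_one, mul_one_div, mul_comm]

lemma awCircleWeight_inv (q a b c d α y : ℂ) :
    awCircleWeight q a b c d α (1 / y) = awCircleWeight q a b c d α y := by
  rw [awCircleWeight, awCircleWeight]
  simp only [qPair_inv, one_div_pow, one_div_one_div]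
  rw [mul_comm (qPochInf (1 / y ^ 2) q)]

section
variable {q : ℂ} (hq : ‖q‖ < 1) (hq0 : q ≠ 0)

include hq in
lemma qPair_eq (p y : ℂ) : qPair q p y = (1 - p * y) * qPairShift q p y := by
  rw [qPair, qPairShift, qPochInf_eq_mul hq (p * y), mul_assoc p y q, mul_comm y q, mul_assoc]

include hq0 in
lemma qPairShift_inv (p : ℂ) {y : ℂ} (hy : y ≠ 0) :
    qPairShift q p (1 / (q * y)) = qPairShift q p y := by
  have e1 : p * (q * (1 / (q * y))) = p / y := by field_simp
  have e2 : p / (1 / (q * y)) = p * (q * y) := by rw [div_div_eq_mul_div, div_one]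
  rw [qPairShift, qPairShift, e1, e2, mul_comm]

include hq in
lemma qPair_ne_zero {p y : ℂ} (h1 : ‖p * y‖ < 1) (h2 : ‖p / y‖ < 1) : qPair q p y ≠ 0 :=
  mul_ne_zero (qPochInf_ne_zero_of_norm_lt_one hq h1) (qPochInf_ne_zero_of_norm_lt_one hq h2)

include hq in
lemma qPairShift_ne_zero {p y : ℂ} (hp : ‖p‖ < 1) (h1 : 1 ≤ ‖y‖) (h2 : ‖q * y‖ ≤ 1) :
    qPairShift q p y ≠ 0 := by
  refine mul_ne_zero (qPochInf_ne_zero_of_norm_lt_one hq ?_)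
    (qPochInf_ne_zero_of_norm_lt_one hq ?_)
  · rw [norm_mul]
    nlinarith [norm_nonneg p, norm_nonneg (q * y)]
  · rw [norm_div, div_lt_one (by linarith)]
    linarith

include hq in
lemma differentiableAt_qPair (p : ℂ) {y : ℂ} (hy : y ≠ 0) : DifferentiableAt ℂ (qPair q p) y := by
  have h := differentiable_qPochInf hq
  unfold qPair
  exact (h.differentiableAt.comp y (f := fun y => p * y) (by fun_prop)).mul
    (h.differentiableAt.comp y (f := fun y => p / y) (by fun_prop (disch := assumption)))

include hq in
lemma differentiableAt_qPairShift (p : ℂ) {y : ℂ} (hy : y ≠ 0) :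
    DifferentiableAt ℂ (qPairShift q p) y := by
  have h := differentiable_qPochInf hq
  unfold qPairShift
  exact (h.differentiableAt.comp y (f := fun y => p * (q * y)) (by fun_prop)).mul
    (h.differentiableAt.comp y (f := fun y => p / y) (by fun_prop (disch := assumption)))

variable {a b c d α : ℂ}

include hq in
-- Multiplying the weight by the leading coefficient cancels the first factors of the products for
-- a, b, c and q/d. Only 1 - αy, which has no counterpart in `awB`, stays in the denominator; it
-- produces the boundary term.
lemma awKernel_eq {y : ℂ} (h1 : 1 - y ^ 2 ≠ 0) (h2 : 1 - q * y ^ 2 ≠ 0)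
    (ha : 1 - a * y ≠ 0) (hb : 1 - b * y ≠ 0) (hc : 1 - c * y ≠ 0) (hd : 1 - q / d * y ≠ 0) :
    awKernel q a b c d α y / (1 - α * y) = awCircleWeight q a b c d α y * awB q a b c d y := by
  have e1 : qPochInf (y ^ 2) q = (1 - y ^ 2) * ((1 - q * y ^ 2) * qPochInf (q ^ 2 * y ^ 2) q) := by
    rw [qPochInf_eq_mul hq (y ^ 2), mul_comm (y ^ 2) q, qPochInf_eq_mul hq (q * y ^ 2)]
    ring_nf
  have e2 : q * y / d = q / d * y := by ring
  rw [awKernel, awCircleWeight, awB, e1, e2, qPair_eq hq a, qPair_eq hq b, qPair_eq hq c,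
    qPair_eq hq (q / d), qPair_eq hq α]
  generalize qPochInf (q ^ 2 * y ^ 2) q = I1
  generalize qPochInf (1 / y ^ 2) q = I2
  generalize 1 - y ^ 2 = x1 at *
  generalize 1 - q * y ^ 2 = x2 at *
  generalize 1 - a * y = x3 at *
  generalize 1 - b * y = x4 at *
  generalize 1 - c * y = x5 at *
  generalize 1 - q / d * y = x6 at *
  generalize 1 - α * y = x7
  have e3 : x3 * qPairShift q a y * (x4 * qPairShift q b y) * (x5 * qPairShift q c y) *
      (x6 * qPairShift q (q / d) y) * (x7 * qPairShift q α y * qPair q (q / α) y) =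
      (x3 * x4 * x5 * x6) * x7 * (qPairShift q a y * qPairShift q b y * qPairShift q c y *
        qPairShift q (q / d) y * (qPairShift q α y * qPair q (q / α) y)) := by ring
  rw [e3]
  generalize qPairShift q a y * qPairShift q b y * qPairShift q c y *
        qPairShift q (q / d) y * (qPairShift q α y * qPair q (q / α) y) = P
  field_simp

include hq hq0 in
-- Weight times leading coefficient is invariant under y ↦ 1/(qy), the condition that makes the
-- difference operator formally symmetric. The parameters α and q/α form a pair for which the
-- exchanged factors 1 - αy and 1 - qy/α compensate.
lemma awKernel_inv {y : ℂ} (hα : α ≠ 0) (hy : y ≠ 0) (h1 : 1 - α * y ≠ 0)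
    (h2 : 1 - q / α * y ≠ 0) :
    awKernel q a b c d α (1 / (q * y)) / (1 - α * (1 / (q * y))) =
      awKernel q a b c d α y / (1 - α * y) := by
  have e1 : q ^ 2 * (1 / (q * y)) ^ 2 = 1 / y ^ 2 := by field_simp
  have e2 : 1 / (1 / (q * y)) ^ 2 = q ^ 2 * y ^ 2 := by field_simp
  have e3 : qPair q (q / α) y = (1 - q / α * y) * qPairShift q (q / α) y := qPair_eq hq _ _
  have e4 : qPair q (q / α) (1 / (q * y)) = (1 - 1 / (α * y)) * qPairShift q (q / α) y := by
    rw [qPair_eq hq, qPairShift_inv hq0 _ hy]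
    congr 2
    field_simp
  rw [awKernel, awKernel, e1, e2, e3, e4]
  simp only [qPairShift_inv hq0 _ hy]
  have h3 : 1 - α * (1 / (q * y)) = -(α / (q * y)) * (1 - q / α * y) := by field_simp; ring
  have h4 : 1 - 1 / (α * y) = -(1 / (α * y)) * (1 - α * y) := by field_simp; ring
  rw [h3, h4]
  generalize qPairShift q a y * qPairShift q b y * qPairShift q c y * qPairShift q (q / d) y = P
  rw [mul_comm (qPochInf (1 / y ^ 2) q)]
  generalize qPochInf (q ^ 2 * y ^ 2) q * qPochInf (1 / y ^ 2) q = I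
  generalize qPairShift q α y = P1
  generalize qPairShift q (q / α) y = P2
  generalize 1 - α * y = x1 at *
  generalize 1 - q / α * y = x2 at *
  field_simp

/-- The map y ↦ 1/(qy) followed by inversion exchanges y and qy, hence the sign. -/
lemma casoratian_inv {F G : ℂ → ℂ} (hF : ∀ y, y ≠ 0 → F (1 / y) = F y)
    (hG : ∀ y, y ≠ 0 → G (1 / y) = G y) (hq0 : q ≠ 0) {y : ℂ} (hy : y ≠ 0) :
    casoratian q F G (1 / (q * y)) = -casoratian q F G y := by
  have e : q * (1 / (q * y)) = 1 / y := by field_simp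
  rw [casoratian, casoratian, e, hF _ hy, hG _ hy, hF _ (mul_ne_zero hq0 hy),
    hG _ (mul_ne_zero hq0 hy)]
  ring

lemma casoratian_inv' {F G : ℂ → ℂ} (hF : ∀ y, y ≠ 0 → F (1 / y) = F y)
    (hG : ∀ y, y ≠ 0 → G (1 / y) = G y) (hq0 : q ≠ 0) {y : ℂ} (hy : y ≠ 0) :
    casoratian q F G (1 / y) = F (y / q) * G y - F y * G (y / q) := by
  have e : q * (1 / y) = 1 / (y / q) := by field_simp
  rw [casoratian, e, hF _ hy, hG _ hy, hF _ (div_ne_zero hy hq0), hG _ (div_ne_zero hy hq0)]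

lemma differentiableAt_casoratian {F G : ℂ → ℂ} (hF : ∀ y, y ≠ 0 → DifferentiableAt ℂ F y)
    (hG : ∀ y, y ≠ 0 → DifferentiableAt ℂ G y) (hq0 : q ≠ 0) {y : ℂ} (hy : y ≠ 0) :
    DifferentiableAt ℂ (casoratian q F G) y := by
  have h1 := (hF _ (mul_ne_zero hq0 hy)).comp y (f := fun y => q * y) (by fun_prop)
  have h2 := (hG _ (mul_ne_zero hq0 hy)).comp y (f := fun y => q * y) (by fun_prop)
  exact (h1.mul (hG _ hy)).sub ((hF _ hy).mul h2)

/-- Green's formula for two solutions of the difference equation, pointwise. -/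
lemma casoratian_identity {F G : ℂ → ℂ} (hF : ∀ y, y ≠ 0 → F (1 / y) = F y)
    (hG : ∀ y, y ≠ 0 → G (1 / y) = G y) (hq : ‖q‖ < 1) (hq0 : q ≠ 0) {l m y : ℂ} (hy : ‖y‖ = 1)
    (hFe : 1 - y ^ 2 ≠ 0 → 1 - q * y ^ 2 ≠ 0 → y ^ 2 - q ≠ 0 →
      awB q a b c d y * F (q * y) + awB q a b c d (1 / y) * F (y / q) -
        (awA q a b c d y + awA q a b c d (1 / y) - l) * F y = 0)
    (hGe : 1 - y ^ 2 ≠ 0 → 1 - q * y ^ 2 ≠ 0 → y ^ 2 - q ≠ 0 →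
      awB q a b c d y * G (q * y) + awB q a b c d (1 / y) * G (y / q) -
        (awA q a b c d y + awA q a b c d (1 / y) - m) * G y = 0)
    (ha : ‖a‖ < 1) (hb : ‖b‖ < 1) (hc : ‖c‖ < 1) (hd : ‖q / d‖ < 1) :
    (l - m) * (F y * G y * awCircleWeight q a b c d α y) =
      -(awKernel q a b c d α y / (1 - α * y) * casoratian q F G y +
        awKernel q a b c d α (1 / y) / (1 - α * (1 / y)) * casoratian q F G (1 / y)) := by
  have hy0 : y ≠ 0 := norm_pos_iff.1 (by rw [hy]; norm_num)
  have hy' : ‖1 / y‖ = 1 := by rw [norm_div, hy]; simp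
  by_cases h1 : y ^ 2 = 1
  -- At y = ±1 the difference equation is unavailable because its coefficients have zero
  -- denominators, but the weight and the kernel vanish there.
  · have e0 : qPochInf 1 q = 0 := qPochInf_eq_zero hq (k := 0) (by simp)
    have e1 : awKernel q a b c d α y = 0 := by simp [awKernel, h1, e0]
    have e2 : awKernel q a b c d α (1 / y) = 0 := by simp [awKernel, h1, e0]
    have e3 : awCircleWeight q a b c d α y = 0 := by simp [awCircleWeight, h1, e0]
    rw [e1, e2, e3]; ring
  · have key : ∀ {p z : ℂ}, ‖p‖ < 1 → ‖z‖ = 1 → 1 - p * z ≠ 0 := fun {p z} hp hz h => by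
      have h2 : ‖p * z‖ = ‖(1 : ℂ)‖ := by rw [← sub_eq_zero.1 h]
      rw [norm_mul, hz, norm_one] at h2
      linarith
    have hy2 : ‖y ^ 2‖ = 1 := by rw [norm_pow, hy, one_pow]
    have hy2' : ‖(1 / y) ^ 2‖ = 1 := by rw [norm_pow, hy', one_pow]
    have n1 : 1 - y ^ 2 ≠ 0 := sub_ne_zero.2 (Ne.symm h1)
    have n1' : 1 - (1 / y) ^ 2 ≠ 0 := fun h => h1 (by field_simp at h; linear_combination h)
    have n2 : y ^ 2 - q ≠ 0 := fun h => by
      have := sub_eq_zero.1 h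
      rw [this] at hy2; linarith
    rw [awKernel_eq hq n1 (key hq hy2) (key ha hy) (key hb hy) (key hc hy) (key hd hy),
      awKernel_eq hq n1' (key hq hy2') (key ha hy') (key hb hy') (key hc hy') (key hd hy'),
      awCircleWeight_inv, casoratian_inv' hF hG hq0 hy0, casoratian]
    have h3 := hFe n1 (key hq hy2) n2
    have h4 := hGe n1 (key hq hy2) n2
    linear_combination awCircleWeight q a b c d α y * (G y * h3 - F y * h4)

end

/-! ### The integral over the unit circle -/

lemma circleIntegral_inv_mul_symm {g : ℂ → ℂ} (hg : ContinuousOn g (Metric.sphere 0 1))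
    (hinv : ∀ z, z ≠ 0 → g (1 / z) = g z) :
    (∮ z in C(0, 1), z⁻¹ * g z) =
      2 * Complex.I * ∫ θ in (0 : ℝ)..Real.pi, g (Complex.exp (Complex.I * θ)) := by
  have hcm : ∀ θ : ℝ, circleMap 0 1 θ = Complex.exp (Complex.I * θ) := fun θ => by
    simp [circleMap, mul_comm]
  have hcont : Continuous fun θ : ℝ => g (Complex.exp (Complex.I * θ)) := by
    simp_rw [← hcm]
    exact hg.comp_continuous (continuous_circleMap 0 1) fun θ => circleMap_mem_sphere _ zero_le_one θ
  rw [circleIntegral_inv_mul one_ne_zero]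
  simp_rw [hcm]
  rw [← intervalIntegral.integral_add_adjacent_intervals
    (hcont.intervalIntegrable 0 Real.pi) (hcont.intervalIntegrable Real.pi (2 * Real.pi))]
  have h := intervalIntegral.integral_comp_sub_left (a := 0) (b := Real.pi)
    (fun θ : ℝ => g (Complex.exp (Complex.I * θ))) (2 * Real.pi)
  rw [sub_zero, show 2 * Real.pi - Real.pi = Real.pi by ring] at h
  rw [← h]
  have h2 : ∀ θ : ℝ, g (Complex.exp (Complex.I * ((2 * Real.pi - θ : ℝ) : ℂ))) =
      g (Complex.exp (Complex.I * θ)) := fun θ => by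
    rw [← hinv _ (Complex.exp_ne_zero (Complex.I * θ)), one_div, ← Complex.exp_neg]
    congr 1
    rw [Complex.exp_eq_exp_iff_exists_int]
    exact ⟨1, by push_cast; ring⟩
  simp_rw [h2]
  ring

section
variable {q : ℝ} (hq0 : 0 < q) (hq1 : q < 1) {a b c d α : ℂ} (ha : ‖a‖ < 1) (hb : ‖b‖ < 1)
  (hc : ‖c‖ < 1) (hd : ‖(q : ℂ) / d‖ < 1) (hα1 : ‖α‖ < 1) (hα2 : q < ‖α‖ ^ 2)

include hq0 hα2 in
lemma norm_param_pos : 0 < ‖α‖ := by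
  rcases (norm_nonneg α).eq_or_lt with h | h
  · rw [← h] at hα2; norm_num at hα2; linarith
  · exact h

include hq0 hα1 hα2 in
lemma norm_div_param_lt_one : ‖(q : ℂ) / α‖ < 1 := by
  have h0 := norm_param_pos hq0 hα2
  rw [norm_div, Complex.norm_real, Real.norm_of_nonneg hq0.le, div_lt_one h0]
  nlinarith

include hq0 hq1 ha hb hc hd hα1 hα2 in
-- In the annulus 1 ≤ |y| ≤ q^(-1/2) no denominator of the kernel vanishes. The critical parameter
-- is qy/α, where (q|y|)² ≤ q < |α|² is needed.
lemma differentiableAt_awKernel {y : ℂ} (h1 : 1 ≤ ‖y‖) (h2 : q * ‖y‖ ^ 2 ≤ 1) :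
    DifferentiableAt ℂ (awKernel q a b c d α) y := by
  have hq := norm_ofReal_lt_one hq0 hq1
  have hy : y ≠ 0 := norm_pos_iff.1 (by linarith)
  have hα0 := norm_param_pos hq0 hα2
  have hqα := norm_div_param_lt_one hq0 hα1 hα2
  have h3 : ‖(q : ℂ) * y‖ ≤ 1 := by
    rw [norm_mul, Complex.norm_real, Real.norm_of_nonneg hq0.le]
    nlinarith
  have h4 : ‖(q : ℂ) / α * y‖ < 1 := by
    rw [norm_mul, norm_div, Complex.norm_real, Real.norm_of_nonneg hq0.le, div_mul_eq_mul_div,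
      div_lt_one hα0]
    refine lt_of_pow_lt_pow_left₀ 2 hα0.le ?_
    calc (q * ‖y‖) ^ 2 = q * (q * ‖y‖ ^ 2) := by ring
      _ ≤ q * 1 := by gcongr
      _ < _ := by linarith
  have h5 : ‖(q : ℂ) / α / y‖ < 1 := by
    rw [norm_div, div_lt_one (by linarith)]
    linarith
  have hP := differentiable_qPochInf hq
  have d1 := hP.differentiableAt.comp y (f := fun y => (q : ℂ) ^ 2 * y ^ 2) (by fun_prop)
  have d2 := hP.differentiableAt.comp y (f := fun y => 1 / y ^ 2)
    (by have := pow_ne_zero 2 hy; fun_prop (disch := assumption))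
  have hS := fun p => differentiableAt_qPairShift hq p hy
  have hN := fun {p} hp => qPairShift_ne_zero (p := p) hq hp h1 h3
  unfold awKernel
  refine (by fun_prop : DifferentiableAt ℂ (fun y => -(d * y)) y).mul ((d1.mul d2).div
    (((((hS _).mul (hS _)).mul (hS _)).mul (hS _)).mul ((hS _).mul (differentiableAt_qPair hq _ hy)))
    ?_)
  exact mul_ne_zero (mul_ne_zero (mul_ne_zero (mul_ne_zero (hN ha) (hN hb)) (hN hc)) (hN hd))
    (mul_ne_zero (hN hα1) (qPair_ne_zero hq h4 h5))

include hq0 hq1 ha hb hc hd hα1 hα2 in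
lemma continuousOn_awCircleWeight :
    ContinuousOn (awCircleWeight q a b c d α) (Metric.sphere 0 1) := by
  have hq := norm_ofReal_lt_one hq0 hq1
  have hqα := norm_div_param_lt_one hq0 hα1 hα2
  intro y hy
  have hy1 : ‖y‖ = 1 := by simpa using hy
  have hy0 : y ≠ 0 := norm_pos_iff.1 (by rw [hy1]; norm_num)
  have hP := differentiable_qPochInf hq
  have d1 := hP.differentiableAt.comp y (f := fun y => y ^ 2) (by fun_prop)
  have d2 := hP.differentiableAt.comp y (f := fun y => 1 / y ^ 2)
    (by have := pow_ne_zero 2 hy0; fun_prop (disch := assumption))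
  have hS := fun p => differentiableAt_qPair hq p hy0
  have hN : ∀ {p : ℂ}, ‖p‖ < 1 → qPair q p y ≠ 0 := fun hp =>
    qPair_ne_zero hq (by rwa [norm_mul, hy1, mul_one]) (by rwa [norm_div, hy1, div_one])
  unfold awCircleWeight
  refine ((d1.mul d2).div (((((hS _).mul (hS _)).mul (hS _)).mul (hS _)).mul ((hS _).mul (hS _)))
    ?_).continuousAt.continuousWithinAt
  exact mul_ne_zero (mul_ne_zero (mul_ne_zero (mul_ne_zero (hN ha) (hN hb)) (hN hc)) (hN hd))
    (mul_ne_zero (hN hα1) (hN hqα))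

include hq0 hq1 ha hb hc hd hα1 hα2 in
/-- Green's formula on the unit circle: the boundary term is a residue at `1 / α`. -/
theorem circleIntegral_green {F G : ℂ → ℂ} (hF : ∀ y, y ≠ 0 → F (1 / y) = F y)
    (hG : ∀ y, y ≠ 0 → G (1 / y) = G y) (hFd : ∀ y, y ≠ 0 → DifferentiableAt ℂ F y)
    (hGd : ∀ y, y ≠ 0 → DifferentiableAt ℂ G y) {l m : ℂ}
    (hFe : ∀ y : ℂ, y ≠ 0 → 1 - y ^ 2 ≠ 0 → 1 - q * y ^ 2 ≠ 0 → y ^ 2 - q ≠ 0 →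
      awB q a b c d y * F (q * y) + awB q a b c d (1 / y) * F (y / q) -
        (awA q a b c d y + awA q a b c d (1 / y) - l) * F y = 0)
    (hGe : ∀ y : ℂ, y ≠ 0 → 1 - y ^ 2 ≠ 0 → 1 - q * y ^ 2 ≠ 0 → y ^ 2 - q ≠ 0 →
      awB q a b c d y * G (q * y) + awB q a b c d (1 / y) * G (y / q) -
        (awA q a b c d y + awA q a b c d (1 / y) - m) * G y = 0) :
    (l - m) * (∮ z in C(0, 1), z⁻¹ * (F z * G z * awCircleWeight q a b c d α z)) =
      -(4 * Real.pi * Complex.I) *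
        (awKernel q a b c d α (1 / α) * casoratian q F G (1 / α)) := by
  have hq := norm_ofReal_lt_one hq0 hq1
  have hqc : (q : ℂ) ≠ 0 := by exact_mod_cast hq0.ne'
  have hαp := norm_param_pos hq0 hα2
  have hα0 : α ≠ 0 := norm_pos_iff.1 hαp
  set T : ℂ → ℂ := fun z => awKernel q a b c d α z / (1 - α * z) * casoratian q F G z
  -- R = q^(-1/2) is the radius of the circle that z ↦ 1/(qz) maps to itself.
  obtain ⟨R, hR0, hR⟩ : ∃ R : ℝ, 0 < R ∧ q * R ^ 2 = 1 :=
    ⟨(√q)⁻¹, by positivity, by rw [inv_pow, Real.sq_sqrt hq0.le, mul_inv_cancel₀ hq0.ne']⟩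
  have hR1 : 1 < R := by
    by_contra! h
    have : R ^ 2 ≤ 1 := pow_le_one₀ hR0.le h
    nlinarith
  have hαR : 1 < ‖α‖ * R := by
    by_contra! h
    have : (‖α‖ * R) ^ 2 ≤ 1 := pow_le_one₀ (by positivity) h
    nlinarith [sq_nonneg R]
  have hdk : ∀ z : ℂ, 1 ≤ ‖z‖ → ‖z‖ ≤ R → DifferentiableAt ℂ
      (fun z => awKernel q a b c d α z * casoratian q F G z) z := fun z h1 h2 => by
    have hz : z ≠ 0 := norm_pos_iff.1 (by linarith)
    refine (differentiableAt_awKernel hq0 hq1 ha hb hc hd hα1 hα2 h1 ?_).mul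
      (differentiableAt_casoratian hFd hGd hqc hz)
    calc q * ‖z‖ ^ 2 ≤ q * R ^ 2 := by gcongr
      _ = 1 := hR
  have hden : ∀ z : ℂ, ‖z‖ = 1 → 1 - α * z ≠ 0 := fun z hz h => by
    have h2 : ‖α * z‖ = ‖(1 : ℂ)‖ := by rw [← sub_eq_zero.1 h]
    rw [norm_mul, hz, norm_one] at h2
    linarith
  have hTc : ContinuousOn T (Metric.sphere 0 1) := by
    intro z hz
    have hz1 : ‖z‖ = 1 := by simpa using hz
    have h := ((hdk z hz1.ge (by linarith)).div (by fun_prop : DifferentiableAt ℂ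
      (fun z => 1 - α * z) z) (hden z hz1)).continuousAt.continuousWithinAt (s := Metric.sphere 0 1)
    refine h.congr (fun z _ => ?_) ?_ <;> simp only [T] <;> rw [Pi.div_apply] <;> ring
  have hsph : ∀ z ∈ Metric.sphere (0 : ℂ) 1, z ≠ 0 := fun z hz h => by simp [h] at hz
  have hTi : ContinuousOn (fun z => T (1 / z)) (Metric.sphere 0 1) := by
    refine hTc.comp (f := fun z => 1 / z) (fun z hz => ?_) fun z hz => by simpa using hz
    have hz0 := hsph z hz
    exact ContinuousAt.continuousWithinAt (by fun_prop (disch := assumption))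
  have hinv : ContinuousOn (fun z : ℂ => z⁻¹) (Metric.sphere 0 1) := fun z hz =>
    (continuousAt_inv₀ (hsph z hz)).continuousWithinAt
  -- The terms T(z) and T(1/z) of the pointwise identity have the same integral over the unit
  -- circle, hence the factor 2.
  have hA : (l - m) * (∮ z in C(0, 1), z⁻¹ * (F z * G z * awCircleWeight q a b c d α z)) =
      -(2 * ∮ z in C(0, 1), z⁻¹ * T z) := by
    have e1 : (∮ z in C(0, 1), z⁻¹ * T z) = ∮ z in C(0, 1), z⁻¹ * T (1 / z) := by
      rw [circleIntegral_inv_mul_inversion one_ne_zero one_ne_zero]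
      simp
    have i1 : CircleIntegrable (fun z => z⁻¹ * T z) 0 1 :=
      (hinv.mul hTc).circleIntegrable zero_le_one
    have i2 : CircleIntegrable (fun z => z⁻¹ * T (1 / z)) 0 1 :=
      (hinv.mul hTi).circleIntegrable zero_le_one
    rw [two_mul]
    nth_rewrite 2 [e1]
    rw [← circleIntegral.integral_add i1 i2, ← circleIntegral.integral_const_mul,
      ← neg_one_mul, ← circleIntegral.integral_const_mul]
    refine circleIntegral.integral_congr zero_le_one fun z hz => ?_
    have hz0 := hsph z hz
    have h := casoratian_identity (α := α) hF hG hq hqc (by simpa using hz) (hFe z hz0) (hGe z hz0)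
      ha hb hc hd
    linear_combination z⁻¹ * h
  -- On this circle T changes sign under z ↦ 1/(qz), while the integral is unchanged, so it equals
  -- its own negative.
  have hB : (∮ z in C(0, R), z⁻¹ * T z) = 0 := by
    have e1 : (∮ z in C(0, R), z⁻¹ * T z) = -∮ z in C(0, R), z⁻¹ * T z := by
      conv_lhs => rw [circleIntegral_inv_mul_inversion hR0.ne' hR0.ne']
      rw [← neg_one_mul, ← circleIntegral.integral_const_mul]
      refine circleIntegral.integral_congr hR0.le fun z hz => ?_
      have hzR : ‖z‖ = R := by simpa using hz
      have hz0 : z ≠ 0 := norm_pos_iff.1 (hzR ▸ hR0)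
      have e2 : (R : ℂ) * R / z = 1 / (q * z) := by
        have : (q : ℂ) * R ^ 2 = 1 := by exact_mod_cast hR
        field_simp
        linear_combination this
      have n1 : 1 - α * z ≠ 0 := fun h => by
        have h2 : ‖α * z‖ = ‖(1 : ℂ)‖ := by rw [← sub_eq_zero.1 h]
        rw [norm_mul, hzR, norm_one] at h2
        linarith
      have n2 : 1 - q / α * z ≠ 0 := fun h => by
        have h2 : ‖(q : ℂ) / α * z‖ = ‖(1 : ℂ)‖ := by rw [← sub_eq_zero.1 h]
        rw [norm_mul, hzR, norm_one, norm_div, Complex.norm_real, Real.norm_of_nonneg hq0.le] at h2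
        field_simp at h2
        nlinarith
      simp only [T]
      rw [e2, awKernel_inv hq hqc hα0 hz0 n1 n2, casoratian_inv hF hG hqc hz0]
      ring
    exact self_eq_neg.1 e1
  have hw : ‖1 / α‖ = 1 / ‖α‖ := by rw [norm_div, norm_one]
  -- Since 1 < 1/|α| < R, the point 1/α lies strictly between the circles, and z⁻¹ T(z) has there a
  -- simple pole coming from 1/(1 - αz) = -(1/α)/(z - 1/α).
  have hC := circleIntegral_annulus_sub (r := 1) (R := R) (w := 1 / α) zero_lt_one
    (by rw [hw, lt_div_iff₀ hαp]; linarith) (by rw [hw, div_lt_iff₀ hαp]; linarith)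
    (f := fun z => -(1 / α) * z⁻¹ * (awKernel q a b c d α z * casoratian q F G z))
    (fun z h1 h2 => by
      have hz : z ≠ 0 := norm_pos_iff.1 (by linarith)
      exact ((differentiableAt_inv hz).const_mul _).mul (hdk z h1 h2))
  have e3 : ∀ z : ℂ, (z - 1 / α)⁻¹ * (-(1 / α) * z⁻¹ *
      (awKernel q a b c d α z * casoratian q F G z)) = z⁻¹ * T z := fun z => by
    have : (z - 1 / α)⁻¹ * -(1 / α) = (1 - α * z)⁻¹ := by
      have : 1 - α * z = -(α * (z - 1 / α)) := by field_simp; ring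
      rw [this, inv_neg, mul_inv]; ring
    have hT : T z = awKernel q a b c d α z * (1 - α * z)⁻¹ * casoratian q F G z := by
      simp only [T, div_eq_mul_inv]
    rw [hT, ← this]
    ring
  simp only [e3] at hC
  rw [hB] at hC
  have e4 : (1 / α)⁻¹ = α := by rw [one_div, inv_inv]
  rw [e4] at hC
  rw [hA]
  have e5 : 1 / α * α = 1 := by field_simp
  linear_combination 2 * hC + (-(4 * Real.pi * Complex.I) * (awKernel q a b c d α (1 / α) *
    casoratian q F G (1 / α))) * e5

end

/-! ### The main formula -/

/-- The products in α² and q/α² cancel between numerator and denominator up to one factor 1 - q/α²,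
which the step ∇x of the lattice cancels later. -/
lemma awKernel_one_div {q a b c d α : ℂ} (hq : ‖q‖ < 1) (hα : α ≠ 0)
    (h1 : qPochInf (α ^ 2) q ≠ 0) (h2 : qPochInf (q / α ^ 2) q ≠ 0) :
    awKernel q a b c d α (1 / α) = -(d / α) / (1 - q / α ^ 2) *
      (qPochInfs [q, q, α * a, q * a / α, α * b, q * b / α, α * c, q * c / α,
        q * α / d, q ^ 2 / (α * d)] q)⁻¹ := by
  have e1 : q ^ 2 * (1 / α) ^ 2 = q / α ^ 2 * q := by field_simp
  have e2 : 1 / (1 / α) ^ 2 = α ^ 2 := by field_simp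
  have e3 : ∀ p, qPairShift q p (1 / α) = qPochInf (q * p / α) q * qPochInf (α * p) q := fun p => by
    rw [qPairShift, show p * (q * (1 / α)) = q * p / α by ring,
      show p / (1 / α) = α * p by field_simp]
  have e4 : qPair q (q / α) (1 / α) = qPochInf (q / α ^ 2) q * qPochInf q q := by
    rw [qPair, show q / α * (1 / α) = q / α ^ 2 by field_simp,
      show q / α / (1 / α) = q by field_simp]
  have h3 := h2
  rw [qPochInf_eq_mul hq] at h3
  rw [awKernel, e1, e2, e4, qPochInf_eq_mul hq (q / α ^ 2)]
  simp only [e3, qPochInfs, List.map_cons, List.map_nil, List.prod_cons, List.prod_nil, mul_one]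
  rw [show q * (q / d) / α = q ^ 2 / (α * d) by ring, show α * (q / d) = q * α / d by ring,
    show q * α / α = q by field_simp, show α * α = α ^ 2 by ring]
  have h4 := left_ne_zero_of_mul h3
  have h5 := right_ne_zero_of_mul h3
  generalize 1 - q / α ^ 2 = x at *
  generalize qPochInf (q / α ^ 2 * q) q = y at *
  generalize qPochInf (α ^ 2) q = z at *
  generalize qPochInf q q = Q
  generalize qPochInf (q * a / α) q = A1
  generalize qPochInf (α * a) q = A2
  generalize qPochInf (q * b / α) q = B1
  generalize qPochInf (α * b) q = B2
  generalize qPochInf (q * c / α) q = C1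
  generalize qPochInf (α * c) q = C2
  generalize qPochInf (q * α / d) q = D1
  generalize qPochInf (q ^ 2 / (α * d)) q = D2
  have e5 : A1 * A2 * (B1 * B2) * (C1 * C2) * (D2 * D1) * (Q * z * (x * y * Q)) =
      z * y * x * (Q * (Q * (A2 * (A1 * (B2 * (B1 * (C2 * (C1 * (D1 * D2))))))))) := by ring
  rw [e5]
  generalize Q * (Q * (A2 * (A1 * (B2 * (B1 * (C2 * (C1 * (D1 * D2)))))))) = P
  field_simp

lemma awWeight_eq (q : ℝ) (a b c d α : ℂ) (θ : ℝ) :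
    awWeight q a b c d α θ = awCircleWeight q a b c d α (Complex.exp (Complex.I * θ)) := by
  have e1 : Complex.exp (2 * Complex.I * θ) = Complex.exp (Complex.I * θ) ^ 2 := by
    rw [← Complex.exp_nat_mul]; congr 1; push_cast; ring
  rw [awWeight, awCircleWeight, Complex.exp_neg, Complex.exp_neg, e1]
  generalize Complex.exp (Complex.I * θ) = y
  simp only [qPair, qPochInfs, List.map_cons, List.map_nil, List.prod_cons, List.prod_nil, mul_one]
  rw [one_div, mul_div_right_comm _ y d, mul_div_right_comm _ y⁻¹ d, mul_div_right_comm _ y α,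
    mul_div_right_comm _ y⁻¹ α]
  simp only [div_eq_mul_inv, mul_assoc]

lemma cos_eq_joukowski (θ : ℝ) : ((Real.cos θ : ℝ) : ℂ) =
    (Complex.exp (Complex.I * θ) + 1 / Complex.exp (Complex.I * θ)) / 2 := by
  rw [Complex.ofReal_cos, Complex.cos, one_div, ← Complex.exp_neg, mul_comm Complex.I, neg_mul]

lemma comp_joukowski_inv (f : ℂ → ℂ) (y : ℂ) :
    f ((1 / y + 1 / (1 / y)) / 2) = f ((y + 1 / y) / 2) := by
  rw [one_div_one_div, add_comm]

section
variable {q : ℝ} (hq0 : 0 < q) (hq1 : q < 1) {a b c d α₀ α : ℂ} (ha : ‖a‖ < 1) (hb : ‖b‖ < 1)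
  (hc : ‖c‖ < 1) (hd : ‖(q : ℂ) / d‖ < 1) (hα₀ : 0 < α₀.re) (hα₁ : α₀.re < 1 / 2)
  (hα : α = (q : ℂ) ^ α₀)

include hq0 hq1 hα₀ hα₁ hα in
-- Since |α| = q^(Re α₀), the strip 0 < Re α₀ < 1/2 says exactly that 1/α lies strictly between the
-- unit circle and the circle of radius q^(-1/2).
lemma norm_param : ‖α‖ < 1 ∧ q < ‖α‖ ^ 2 := by
  have h : ‖α‖ = q ^ α₀.re := by rw [hα, Complex.norm_cpow_eq_rpow_re_of_pos hq0]
  refine ⟨by rw [h]; exact Real.rpow_lt_one hq0.le hq1 hα₀, ?_⟩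
  rw [h, ← Real.rpow_natCast, ← Real.rpow_mul hq0.le]
  nth_rewrite 1 [← Real.rpow_one q]
  exact Real.rpow_lt_rpow_of_exponent_gt hq0 hq1 (by push_cast; linarith)

include hq0 hq1 ha hb hc hd hα₀ hα₁ hα in
lemma continuous_awWeight : Continuous (awWeight q a b c d α) := by
  obtain ⟨h1, h2⟩ := norm_param hq0 hq1 hα₀ hα₁ hα
  simp_rw [funext (awWeight_eq q a b c d α)]
  refine (continuousOn_awCircleWeight hq0 hq1 ha hb hc hd h1 h2).comp_continuous (by fun_prop) ?_
  intro θ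
  rw [mem_sphere_zero_iff_norm, mul_comm, Complex.norm_exp_ofReal_mul_I]

include hq0 hα in
-- The points y = 1/α and qy = q/α correspond to the lattice points x(α₀) and x(α₀ - 1), because x
-- is even. The prefactor is ∇x at α₀.
lemma qWronskian_eq (f g : ℂ → ℂ) (hΔ : α / q * (1 - q / α ^ 2) * (1 - q) ≠ 0) :
    casoratian q (fun y => f ((y + 1 / y) / 2)) (fun y => g ((y + 1 / y) / 2)) (1 / α) =
      -(α / q * (1 - q / α ^ 2) * (1 - q) / 2) * qWronskian q f g α₀ := by
  have hqc : (q : ℂ) ≠ 0 := by exact_mod_cast hq0.ne'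
  have hα0 : α ≠ 0 := by simp [hα, Complex.cpow_eq_zero_iff, hqc]
  have e1 : qLattice q α₀ = (α + 1 / α) / 2 := by rw [qLattice_eq, ← hα]
  have e2 : qLattice q (α₀ - 1) = (q * (1 / α) + 1 / (q * (1 / α))) / 2 := by
    rw [qLattice_eq, Complex.cpow_sub _ _ hqc, Complex.cpow_one, ← hα]
    field_simp; ring
  have e3 : (1 / α + 1 / (1 / α)) / 2 = (α + 1 / α) / 2 := by rw [one_div_one_div, add_comm]
  have e4 : (α + 1 / α) / 2 - (q * (1 / α) + 1 / (q * (1 / α))) / 2 =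
      -(α / q * (1 - q / α ^ 2) * (1 - q) / 2) := by
    field_simp; ring
  rw [qWronskian, nablaX, nablaX, e1, e2, e4, casoratian]
  simp only [e3]
  generalize f ((α + 1 / α) / 2) = f1
  generalize g ((α + 1 / α) / 2) = g1
  generalize f ((q * (1 / α) + 1 / (q * (1 / α))) / 2) = f2
  generalize g ((q * (1 / α) + 1 / (q * (1 / α))) / 2) = g2
  generalize α / q * (1 - q / α ^ 2) * (1 - q) = Δ at *
  field_simp
  ring

include hq0 hq1 ha hb hc hd hα₀ hα₁ hα in
/-- Green's formula for two solutions of the difference equation. -/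
theorem integral_green {f g : ℂ → ℂ} (hf : Differentiable ℂ f) (hg : Differentiable ℂ g) {l m : ℂ}
    (hfe : ∀ y : ℂ, y ≠ 0 → 1 - y ^ 2 ≠ 0 → 1 - q * y ^ 2 ≠ 0 → y ^ 2 - q ≠ 0 →
      awB q a b c d y * f ((q * y + 1 / (q * y)) / 2) +
        awB q a b c d (1 / y) * f ((y / q + 1 / (y / q)) / 2) -
        (awA q a b c d y + awA q a b c d (1 / y) - l / awScale q) * f ((y + 1 / y) / 2) = 0)
    (hge : ∀ y : ℂ, y ≠ 0 → 1 - y ^ 2 ≠ 0 → 1 - q * y ^ 2 ≠ 0 → y ^ 2 - q ≠ 0 →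
      awB q a b c d y * g ((q * y + 1 / (q * y)) / 2) +
        awB q a b c d (1 / y) * g ((y / q + 1 / (y / q)) / 2) -
        (awA q a b c d y + awA q a b c d (1 / y) - m / awScale q) * g ((y + 1 / y) / 2) = 0) :
    (l - m) * (∫ θ in (0 : ℝ)..Real.pi, f (Real.cos θ) * g (Real.cos θ) *
      awWeight q a b c d α θ) = awConst q a b c d α * qWronskian q f g α₀ := by
  have hq := norm_ofReal_lt_one hq0 hq1
  have hqc : (q : ℂ) ≠ 0 := by exact_mod_cast hq0.ne'
  have h1q : 1 - (q : ℂ) ≠ 0 := by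
    rw [← Complex.ofReal_one, ← Complex.ofReal_sub]; exact_mod_cast (sub_pos.2 hq1).ne'
  obtain ⟨hα1, hα2⟩ := norm_param hq0 hq1 hα₀ hα₁ hα
  have hαp := norm_param_pos hq0 hα2
  have hα0 : α ≠ 0 := norm_pos_iff.1 hαp
  have hX : ∀ {f : ℂ → ℂ}, Differentiable ℂ f → ∀ y : ℂ, y ≠ 0 →
      DifferentiableAt ℂ (fun y => f ((y + 1 / y) / 2)) y := fun hf y hy =>
    hf.differentiableAt.comp y (f := fun y : ℂ => (y + 1 / y) / 2)
      (by fun_prop (disch := assumption))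
  have key := circleIntegral_green hq0 hq1 ha hb hc hd hα1 hα2
    (F := fun y => f ((y + 1 / y) / 2)) (G := fun y => g ((y + 1 / y) / 2))
    (fun y _ => comp_joukowski_inv f y) (fun y _ => comp_joukowski_inv g y) (hX hf) (hX hg) hfe hge
  rw [circleIntegral_inv_mul_symm (g := fun z => f ((z + 1 / z) / 2) * g ((z + 1 / z) / 2) *
      awCircleWeight q a b c d α z)
    (by
      have hc0 : ∀ {f : ℂ → ℂ}, Differentiable ℂ f →
          ContinuousOn (fun y : ℂ => f ((y + 1 / y) / 2)) (Metric.sphere 0 1) := fun hf z hz =>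
        (hX hf z fun h => by simp [h] at hz).continuousAt.continuousWithinAt
      exact ((hc0 hf).mul (hc0 hg)).mul (continuousOn_awCircleWeight hq0 hq1 ha hb hc hd hα1 hα2))
    (fun z _ => by
      rw [comp_joukowski_inv f, comp_joukowski_inv g, awCircleWeight_inv])] at key
  simp only [← cos_eq_joukowski, ← awWeight_eq] at key
  have hq2 : ‖(q : ℂ) / α ^ 2‖ < 1 := by
    rw [norm_div, norm_pow, Complex.norm_real, Real.norm_of_nonneg hq0.le,
      div_lt_one (by positivity)]
    exact hα2
  have hα22 : ‖α ^ 2‖ < 1 := by rw [norm_pow]; exact pow_lt_one₀ (norm_nonneg _) hα1 two_ne_zero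
  have hx : 1 - (q : ℂ) / α ^ 2 ≠ 0 := fun h => by
    rw [← sub_eq_zero.1 h, norm_one] at hq2; exact lt_irrefl _ hq2
  rw [awKernel_one_div hq hα0 (qPochInf_ne_zero_of_norm_lt_one hq hα22)
      (qPochInf_ne_zero_of_norm_lt_one hq hq2),
    qWronskian_eq hq0 hα f g (mul_ne_zero (mul_ne_zero (div_ne_zero hα0 hqc) hx) h1q)] at key
  have hC := awScale_ne_zero hq0 hq1
  have h32 : (q : ℂ) ^ ((3 : ℂ) / 2) = q * (q : ℂ) ^ ((1 : ℂ) / 2) := by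
    rw [show (3 : ℂ) / 2 = 1 + 1 / 2 by norm_num, Complex.cpow_add _ _ hqc, Complex.cpow_one]
  rw [awConst]
  generalize qPochInfs _ _ = P at *
  generalize (∫ θ in (0 : ℝ)..Real.pi, f (Real.cos θ) * g (Real.cos θ) *
      awWeight q a b c d α θ) = J at *
  generalize qWronskian q f g α₀ = W at *
  -- Folding the circle onto [0, π] contributes 2i, and -4πi/(2i) = -2π; the factor `awScale`
  -- converts eigenvalues of the difference operator into λ.
  have h2 : (l - m) * J = -(2 * Real.pi) * awScale q *
      (-(d / α) / (1 - q / α ^ 2) * P⁻¹ * (-(α / q * (1 - q / α ^ 2) * (1 - q) / 2) * W)) := by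
    have h3 : (l - m) * J = awScale q / (2 * Complex.I) *
        ((l / awScale q - m / awScale q) * (2 * Complex.I * J)) := by
      field_simp
    rw [h3, key]
    field_simp
    ring
  rw [h2, awScale, h32]
  generalize 1 - (q : ℂ) / α ^ 2 = x at *
  generalize (q : ℂ) ^ ((1 : ℂ) / 2) = r
  generalize P⁻¹ = P'
  generalize 1 - (q : ℂ) = s at *
  field_simp

end

/-- The difference quotient at m is J l itself, so continuity of J is enough; this replaces
l'Hôpital's rule in the limit of equal eigenvalues. -/
lemma hasDerivAt_sub_mul {J : ℂ → ℂ} {m : ℂ} (hJ : ContinuousAt J m) :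
    HasDerivAt (fun l => (l - m) * J l) (J m) m := by
  rw [hasDerivAt_iff_tendsto_slope]
  refine (hJ.tendsto.mono_left nhdsWithin_le_nhds).congr' ?_
  filter_upwards [self_mem_nhdsWithin] with l hl
  have h : l - m ≠ 0 := sub_ne_zero.2 hl
  rw [slope_def_field]
  field_simp
  ring
end

/-! ### The theorem. -/

theorem mainTheorem1 (q : ℝ) (hq0 : 0 < q) (hq1 : q < 1)
    (a b c d α₀ α η : ℂ) (ha0 : a ≠ 0) (hb0 : b ≠ 0) (hc0 : c ≠ 0) (hd0 : d ≠ 0)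
    (ha : ‖a‖ < 1) (hb : ‖b‖ < 1) (hc : ‖c‖ < 1) (hd : ‖(q : ℂ) / d‖ < 1)
    (hα₀ : 0 < α₀.re) (hα₁ : α₀.re < 1 / 2)
    (hα : α = (q : ℂ) ^ α₀) (hη : η = (α + α⁻¹) / 2) :
    -- the entire function `v` is well defined
    (∃! V : ℂ → ℂ → ℂ, IsAWContinuation q a b c d V) ∧
    -- the integrals exist
    (∀ μ ν : ℂ, IntervalIntegrable
      (fun θ : ℝ => awV q a b c d μ (Real.cos θ) * awV q a b c d ν (Real.cos θ) *
        awWeight q a b c d α θ) MeasureTheory.volume 0 Real.pi) ∧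
    -- the main equation
    (∀ μ ν : ℂ, awEigenvalue q a b c d μ ≠ awEigenvalue q a b c d ν →
      ∫ θ in (0 : ℝ)..Real.pi,
          awV q a b c d μ (Real.cos θ) * awV q a b c d ν (Real.cos θ) *
            awWeight q a b c d α θ =
        awConst q a b c d α *
          (qWronskian q (awV q a b c d μ) (awV q a b c d ν) α₀ /
            (awEigenvalue q a b c d μ - awEigenvalue q a b c d ν))) ∧
    -- its limiting case
    (∀ ν : ℂ,
      ∫ θ in (0 : ℝ)..Real.pi, awV q a b c d ν (Real.cos θ) ^ 2 * awWeight q a b c d α θ =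
        awConst q a b c d α *
          (deriv (fun l => awVOfEigenvalue q a b c d l η) (awEigenvalue q a b c d ν) *
              nablaX q (awV q a b c d ν) α₀ -
            awV q a b c d ν η *
              deriv (fun l => nablaX q (awVOfEigenvalue q a b c d l) α₀)
                (awEigenvalue q a b c d ν))) ∧
    -- orthogonality under the boundary condition
    (∀ μ ν : ℂ, awEigenvalue q a b c d μ ≠ awEigenvalue q a b c d ν →
      awV q a b c d μ η = 0 → awV q a b c d ν η = 0 →
      ∫ θ in (0 : ℝ)..Real.pi,
          awV q a b c d μ (Real.cos θ) * awV q a b c d ν (Real.cos θ) *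
            awWeight q a b c d α θ = 0) ∧
    -- the squared norm under the boundary condition
    (∀ ν : ℂ, awV q a b c d ν η = 0 →
      ∫ θ in (0 : ℝ)..Real.pi, awV q a b c d ν (Real.cos θ) ^ 2 * awWeight q a b c d α θ =
        awConst q a b c d α *
          (deriv (fun l => awVOfEigenvalue q a b c d l η) (awEigenvalue q a b c d ν) *
            nablaX q (awV q a b c d ν) α₀)) := by
  have hqc : (q : ℂ) ≠ 0 := by exact_mod_cast hq0.ne'
  obtain ⟨V, hV, hVe⟩ := exists_isAWContinuation hq0 hq1 ha0 hb0 hc0 hd0 ha hb hc hd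
  have huniq : ∀ V', IsAWContinuation q a b c d V' → V' = V := fun V' h =>
    h.unique hq0 hq1 ha0 hb0 hc0 hd0 hd hV
  -- Existence shows that the chosen function is a continuation, and uniqueness identifies it with
  -- the constructed V, for which the difference equation is known.
  have hepsilon : awVOfEigenvalue q a b c d = V :=
    huniq _ (Classical.epsilon_spec (p := IsAWContinuation q a b c d) ⟨V, hV⟩)
  have hawV : ∀ ν, awV q a b c d ν = V (awEigenvalue q a b c d ν) := fun ν => by
    funext x; rw [awV, hepsilon]
  have hη' : qLattice q α₀ = η := by rw [qLattice_eq, ← hα, hη, one_div]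
  have hVd : ∀ l, Differentiable ℂ (V l) := fun l =>
    hV.1.comp (f := fun x => (l, x)) (by fun_prop)
  have hVl : ∀ x, Differentiable ℂ fun l => V l x := fun x =>
    hV.1.comp (f := fun l => (l, x)) (by fun_prop)
  have hVc : Continuous fun p : ℂ × ℂ => V p.1 p.2 := hV.1.continuous
  have hw := continuous_awWeight hq0 hq1 ha hb hc hd hα₀ hα₁ hα
  have hcos : ∀ l, Continuous fun θ : ℝ => V l (Real.cos θ) := fun l =>
    (hVd l).continuous.comp (by fun_prop)
  set J : ℂ → ℂ → ℂ := fun l m => ∫ θ in (0 : ℝ)..Real.pi,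
    V l (Real.cos θ) * V m (Real.cos θ) * awWeight q a b c d α θ
  have green : ∀ l m, (l - m) * J l m = awConst q a b c d α * qWronskian q (V l) (V m) α₀ :=
    fun l m => integral_green hq0 hq1 ha hb hc hd hα₀ hα₁ hα (hVd l) (hVd m) (hVe l) (hVe m)
  have main : ∀ l m, l ≠ m →
      J l m = awConst q a b c d α * (qWronskian q (V l) (V m) α₀ / (l - m)) := fun l m h => by
    rw [← mul_div_assoc, ← green, mul_div_cancel_left₀ _ (sub_ne_zero.2 h)]
  have limit : ∀ m, J m m = awConst q a b c d α *
      (deriv (fun l => V l η) m * nablaX q (V m) α₀ -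
        V m η * deriv (fun l => nablaX q (V l) α₀) m) := fun m => by
    have hJ : Continuous fun l => J l m := by
      rw [← continuousOn_univ]
      refine continuousOn_intervalIntegral (Continuous.continuousOn ?_) _ _
      have h1 : Continuous fun p : ℂ × ℝ => V p.1 (Real.cos p.2) :=
        hVc.comp (f := fun p : ℂ × ℝ => (p.1, (Real.cos p.2 : ℂ))) (by fun_prop)
      exact (h1.mul ((hcos m).comp continuous_snd)).mul (hw.comp continuous_snd)
    have h1 : HasDerivAt (fun l => V l η) (deriv (fun l => V l η) m) m :=
      (hVl η).differentiableAt.hasDerivAt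
    have h2 : HasDerivAt (fun l => nablaX q (V l) α₀) (deriv (fun l => nablaX q (V l) α₀) m) m := by
      refine DifferentiableAt.hasDerivAt ?_
      unfold nablaX
      exact ((hVl _).differentiableAt.sub (hVl _).differentiableAt).div_const _
    have h3 := ((h1.mul_const (nablaX q (V m) α₀)).sub (h2.const_mul (V m η))).const_mul
      (awConst q a b c d α)
    -- Both sides of Green's formula are differentiated in l at l = m: the left gives J m m, and the
    -- right the derivative of the Wronskian in its first argument.
    refine (hasDerivAt_sub_mul hJ.continuousAt).unique (h3.congr_of_eventuallyEq ?_)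
    refine Filter.Eventually.of_forall fun l => ?_
    simp only [green, qWronskian, hη', Pi.sub_apply]
  simp only [hepsilon, hawV]
  refine ⟨⟨V, hV, huniq⟩, fun μ ν => ?_, fun μ ν h => main _ _ h, fun ν => ?_,
    fun μ ν h h1 h2 => ?_, fun ν h => ?_⟩
  · exact (((hcos _).mul (hcos _)).mul hw).intervalIntegrable _ _
  · simp only [sq]
    exact limit _
  -- Each of the two terms of the Wronskian contains a value at η, so the boundary condition removes
  -- both.
  · refine (main _ _ h).trans ?_
    rw [qWronskian, hη', h1, h2]
    simp
  · simp only [sq]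
    refine (limit _).trans ?_
    rw [h, zero_mul, sub_zero]
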